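/- **Setting.** Let $n\ge1$, $p_0\ge p_1\ge\dots\ge p_n\ge1$ be integers, $N=p_0+\dots+p_n$, $Q=p_0+3p_1+\dots+(2n+1)p_n$. Write $x=(x^{(p_0)},\dots,x^{(p_n)})\in\mathbb R^{p_0}\times\dots\times\mathbb R^{p_n}=\mathbb R^N$ and $z=(x,t)\in\mathbb R^{N+1}$. Let $B\in\mathbb R^{N\times N}$ have as only nonzero blocks the blocks $\mathbb B_j$ ($j=1,\dots,n$) in block position $(j-1,j)$, where $\mathbb B_j$ is $p_{j-1}\times p_j$ of rank $p_j$. Let $\lambda,\Lambda>0$. For an open set $\Omega\subseteq\mathbb R^{N+1}$ consider coefficients $A(z)=\begin{bmatrix}\mathbb A(z)&0\\0&0\end{bmatrix}$, symmetric, with $\lambda\mathbb I_{p_0}\le\mathbb A(z)\le\Lambda\mathbb I_{p_0}$ for all $z\in\Omega$, and the operator $$\mathcal L_A u=\mathrm{tr}(A(z)D_x^2u)+\langle x,B\nabla_x u\rangle-\partial_tu .$$ A classical solution of $\mathcal L_Au=0$ in an open set $D$ is a function $u\in C^2(D)$ satisfying the equation at each point of $D$. Put $E(\sigma)=\exp(-\sigma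 B^T)$, $(x,t)\circ(\xi,\tau)=(\xi+E(\tau)x,\,t+\tau)$, with inverse $(x,t)^{-1}=(-E(-t)x,-t)$; $|x|_B=\sum_{i=0}^n|x^{(p_i)}|^{1/(2i+1)}$, $\|(x,t)\|_B=|x|_B+|t|^{1/2}$; $\mathcal Q_r^{t_1,t_2}(z_0)=z_0\circ(\{|x|_B<r\}\times(t_1,t_2))$; $\sigma_0=\min_{|x|=1}|x|_B$, $\bar\sigma=\max_{|x|=1}|x|_B$. Fix $b_B$ with $0<b_B\le(\sigma_0/\bar\sigma)^2$ and $\|E(\sigma)\|\le2$ for all $|\sigma|\le b_B$. For $K>0$ let $\mathcal Q^1_r(z_0)=\mathcal Q_{Kr}^{-b_Br^2,0}(z_0)$ and $\theta=K/\sigma_0$. Let $\mathrm{osc}_Su=\sup_Su-\inf_Su\in[0,\infty]$, and write $S\Subset D$ if $\overline S$ is compact and contained in $D$. A modulus of continuity is a non-decreasing $\omega:[0,1)\to[0,1)$ with $\lim_{s\to0^+}\omega(s)=\omega(0)=0$; $A$ has modulus $\omega$ in $\Omega$ if $\|\mathbb A(z)-\mathbb A(z_0)\|\le\omega(\epsilon)$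 for all $0<\epsilon<1$, $z_0\in\Omega$, $z\in\Omega\cap\mathcal Q_\epsilon^{-\epsilon^2,\epsilon^2}(z_0)$. **(H1).** Suppose $\Lambda/\lambda<1+\frac2Q$. There is $K_0$, depending only on the $p_i$, $B,\lambda,\Lambda,b_B$, such that for every $K>K_0$ we have $\theta>1$, and there are $\eta>0$ and $\alpha>0$ and, for every $\rho>0$, a constant $C_\rho>0$, with $\eta,\alpha$ depending only on the $p_i$, $B,\lambda,\Lambda,b_B,K$ and $C_\rho$ only on these and $\rho$, such that the following holds. Whenever $\Omega$ and $A$ are as above, $D\subseteq\Omega$ is open and $u$ is a classical solution of $\mathcal L_Au=0$ in $D$: 1. if $r>0$ and $\mathcal Q^1_r(z_0)\Subset D$, then $\displaystyle \mathrm{osc}_{\mathcal Q^1_r(z_0)}u\ge\Big(1+\frac\eta4\Big)\,\mathrm{osc}_{\mathcal Q^1_{r/\theta}(z_0)}u$; 2. $|u(z)-u(\zeta)|\le C_\rho\,\|\zeta^{-1}\circ z\|_B^{\alpha}\,\|u\|_{L^\infty(D)}$ for all $z,\zeta$ with $\mathcal Q^1_\rho(z),\mathcal Q^1_\rho(\zeta)\Subset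 D$ (an inequality in $[0,\infty]$). **(H2).** Without the assumption on $\Lambda/\lambda$: there is $K_0$, depending only on the $p_i$, $B,\lambda,\Lambda,b_B$, such that for every $K>K_0$ we have $\theta>1$, and there are $\eta,\alpha>0$, depending only on the $p_i$, $B,\lambda,\Lambda,b_B,K$, such that for every modulus of continuity $\omega$ there are $\epsilon_0\in(0,1)$ and, for every $\rho>0$, a constant $C_\rho>0$ (depending in addition on $\omega$, and $C_\rho$ on $\rho$) such that the following holds. Whenever $\Omega$ and $A$ are as above and $A$ has modulus $\omega$ in $\Omega$, $D\subseteq\Omega$ is open and $u$ is a classical solution of $\mathcal L_Au=0$ in $D$: the inequality in 1 holds whenever $0<r\le\epsilon_0/K$ and $\mathcal Q^1_r(z_0)\subseteq D$, and the estimate in 2 holds. -/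

import Mathlib

open MeasureTheory Filter Topology Set
open scoped ENNReal Matrix

noncomputable section

namespace Kolmogorov

variable {n : ℕ}

/-- Index set of the coordinates of `ℝ^N = ℝ^{p₀} × ⋯ × ℝ^{pₙ}`, `N = p₀ + ⋯ + pₙ`:
a pair (block, position inside the block). -/
abbrev Idx (p : Fin (n + 1) → ℕ) : Type := Σ i : Fin (n + 1), Fin (p i)

/-- `ℝ^N` with its Euclidean norm. -/
abbrev Space (p : Fin (n + 1) → ℕ) : Type := EuclideanSpace ℝ (Idx p)

/-- Points `z = (x, t)` of `ℝ^{N+1} = ℝ^N × ℝ`. -/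
abbrev Pt (p : Fin (n + 1) → ℕ) : Type := Space p × ℝ

/-- The number `Q = p₀ + 3 p₁ + ⋯ + (2n+1) pₙ`; the homogeneous dimension is `Q + 2`. -/
def hdim (p : Fin (n + 1) → ℕ) : ℕ := ∑ i : Fin (n + 1), (2 * (i : ℕ) + 1) * p i

/-- The block structure of the drift matrix: the only nonzero blocks of `B` are the blocks `𝔹_j`
(`j = 1, …, n`) in position `(j-1, j)`, of size `p_{j-1} × p_j`, and `𝔹_j` has rank `p_j`. -/
structure IsDriftMatrix (p : Fin (n + 1) → ℕ) (B : Matrix (Idx p) (Idx p) ℝ) : Prop where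
  off_block : ∀ k l : Idx p, (k.1 : ℕ) + 1 ≠ (l.1 : ℕ) → B k l = 0
  block_rank : ∀ j : Fin n,
    (B.submatrix (fun a : Fin (p j.castSucc) => (⟨j.castSucc, a⟩ : Idx p))
      (fun c : Fin (p j.succ) => (⟨j.succ, c⟩ : Idx p))).rank = p j.succ

/-- The upper left `p₀ × p₀` block `𝔸` of an `N × N` matrix. -/
def topBlock (p : Fin (n + 1) → ℕ) (A : Matrix (Idx p) (Idx p) ℝ) :
    Matrix (Fin (p 0)) (Fin (p 0)) ℝ :=
  A.submatrix (fun a => (⟨0, a⟩ : Idx p)) (fun a => (⟨0, a⟩ : Idx p))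

/-- `A(z)` is symmetric, vanishes outside its upper left block `𝔸(z)`, and
`lam 𝕀 ≤ 𝔸(z) ≤ Lam 𝕀`, for every `z ∈ Ω`. -/
structure IsElliptic (p : Fin (n + 1) → ℕ) (lam Lam : ℝ) (Ω : Set (Pt p))
    (A : Pt p → Matrix (Idx p) (Idx p) ℝ) : Prop where
  symm : ∀ z ∈ Ω, (A z).IsSymm
  off_block : ∀ z ∈ Ω, ∀ k l : Idx p, (k.1 ≠ 0 ∨ l.1 ≠ 0) → A z k l = 0
  lower : ∀ z ∈ Ω, (topBlock p (A z) - lam • (1 : Matrix (Fin (p 0)) (Fin (p 0)) ℝ)).PosSemidef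
  upper : ∀ z ∈ Ω, (Lam • (1 : Matrix (Fin (p 0)) (Fin (p 0)) ℝ) - topBlock p (A z)).PosSemidef

/-! ### The operator -/

/-- The `k`-th spatial unit vector of `ℝ^{N+1}`. -/
def spaceDir (p : Fin (n + 1) → ℕ) (k : Idx p) : Pt p := (EuclideanSpace.single k 1, 0)

/-- The spatial gradient `∇u(z)`. -/
def grad {p : Fin (n + 1) → ℕ} (u : Pt p → ℝ) (z : Pt p) : Idx p → ℝ :=
  fun k => fderiv ℝ u z (spaceDir p k)

/-- The spatial Hessian `D²u(z)`. -/
def hess {p : Fin (n + 1) → ℕ} (u : Pt p → ℝ) (z : Pt p) : Matrix (Idx p) (Idx p) ℝ :=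
  Matrix.of fun k l => fderiv ℝ (fun w => fderiv ℝ u w (spaceDir p l)) z (spaceDir p k)

/-- The time derivative `∂ₜu(z)`. -/
def timeDeriv {p : Fin (n + 1) → ℕ} (u : Pt p → ℝ) (z : Pt p) : ℝ :=
  fderiv ℝ u z ((0 : Space p), (1 : ℝ))

/-- `ℒ_A u (z) = tr (A(z) D²u(z)) + ⟨x, B ∇u(z)⟩ - ∂ₜu(z)`, where `z = (x, t)`. -/
def opL {p : Fin (n + 1) → ℕ} (B : Matrix (Idx p) (Idx p) ℝ)
    (A : Pt p → Matrix (Idx p) (Idx p) ℝ) (u : Pt p → ℝ) (z : Pt p) : ℝ :=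
  (A z * hess u z).trace + (fun k => z.1 k) ⬝ᵥ (B *ᵥ grad u z) - timeDeriv u z

/-- `u` is a classical solution of `ℒ_A u = 0` in `D`: `u ∈ C²(D)` and the equation holds at
every point of `D`. -/
def IsClassicalSolution {p : Fin (n + 1) → ℕ} (B : Matrix (Idx p) (Idx p) ℝ)
    (A : Pt p → Matrix (Idx p) (Idx p) ℝ) (D : Set (Pt p)) (u : Pt p → ℝ) : Prop :=
  ContDiffOn ℝ 2 u D ∧ ∀ z ∈ D, opL B A u z = 0

/-! ### The group, the homogeneous norm and the cylinders -/

/-- `E(σ) = exp (-σ Bᵀ)`, acting on `ℝ^N`; its norm is the operator norm for the Euclidean norm. -/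
def flow {p : Fin (n + 1) → ℕ} (B : Matrix (Idx p) (Idx p) ℝ) (σ : ℝ) :
    Space p →L[ℝ] Space p :=
  Matrix.toEuclideanCLM (n := Idx p) (𝕜 := ℝ) (NormedSpace.exp (-(σ • Bᵀ)))

/-- The group law `(x, t) ∘ (ξ, τ) = (ξ + E(τ) x, t + τ)`. -/
def gmul {p : Fin (n + 1) → ℕ} (B : Matrix (Idx p) (Idx p) ℝ) (z ζ : Pt p) : Pt p :=
  (ζ.1 + flow B ζ.2 z.1, z.2 + ζ.2)

/-- The inverse `(x, t)⁻¹ = (-E(-t) x, -t)` for the group law. -/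
def ginv {p : Fin (n + 1) → ℕ} (B : Matrix (Idx p) (Idx p) ℝ) (z : Pt p) : Pt p :=
  (-(flow B (-z.2) z.1), -z.2)

/-- The component `x^{(p_i)} ∈ ℝ^{p_i}` of `x ∈ ℝ^N`. -/
def block {p : Fin (n + 1) → ℕ} (x : Space p) (i : Fin (n + 1)) : EuclideanSpace ℝ (Fin (p i)) :=
  WithLp.toLp 2 fun a => x ⟨i, a⟩

/-- `|x|_B = ∑ i, |x^{(p_i)}|^{1/(2i+1)}`. -/
def spaceNorm {p : Fin (n + 1) → ℕ} (x : Space p) : ℝ :=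
  ∑ i : Fin (n + 1), ‖block x i‖ ^ (1 / (2 * (i : ℝ) + 1))

/-- `‖(x, t)‖_B = |x|_B + |t|^{1/2}`. -/
def homNorm {p : Fin (n + 1) → ℕ} (z : Pt p) : ℝ :=
  spaceNorm z.1 + |z.2| ^ (1 / 2 : ℝ)

/-- The homogeneous ball `B_r(0)` of `ℝ^N`. -/
def hball (p : Fin (n + 1) → ℕ) (r : ℝ) : Set (Space p) := {x | spaceNorm x < r}

/-- The cylinder `𝒬_r^{t₁,t₂}(z₀) = z₀ ∘ (B_r(0) × (t₁, t₂))`. -/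
def cyl {p : Fin (n + 1) → ℕ} (B : Matrix (Idx p) (Idx p) ℝ) (r t₁ t₂ : ℝ) (z₀ : Pt p) :
    Set (Pt p) :=
  gmul B z₀ '' (hball p r ×ˢ Ioo t₁ t₂)

/-- The cylinder `𝒬¹_r(z₀) = 𝒬_{K r}^{-b r², 0}(z₀)`. -/
def cylOne {p : Fin (n + 1) → ℕ} (B : Matrix (Idx p) (Idx p) ℝ) (b K r : ℝ) (z₀ : Pt p) :
    Set (Pt p) :=
  cyl B (K * r) (-(b * r ^ 2)) 0 z₀

/-- `σ₀ = min_{|x| = 1} |x|_B`. -/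
def sigmaMin (p : Fin (n + 1) → ℕ) : ℝ :=
  sInf (spaceNorm '' Metric.sphere (0 : Space p) 1)

/-- `σ̄ = max_{|x| = 1} |x|_B`. -/
def sigmaMax (p : Fin (n + 1) → ℕ) : ℝ :=
  sSup (spaceNorm '' Metric.sphere (0 : Space p) 1)

/-- The requirements on the time scale `b = b_B`: `0 < b ≤ (σ₀ / σ̄)²` and `‖E(σ)‖ ≤ 2` for
`|σ| ≤ b`. -/
structure IsTimeScale {p : Fin (n + 1) → ℕ} (B : Matrix (Idx p) (Idx p) ℝ) (b : ℝ) : Prop where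
  pos : 0 < b
  le_sq : b ≤ (sigmaMin p / sigmaMax p) ^ 2
  flow_le : ∀ σ : ℝ, |σ| ≤ b → ‖flow B σ‖ ≤ 2

/-! ### Moduli of continuity, oscillation, compact inclusion -/

/-- `ω : [0, 1) → [0, 1)` is non-decreasing with `lim_{s → 0+} ω(s) = ω(0) = 0`. -/
structure IsModulus (ω : ℝ → ℝ) : Prop where
  mapsTo : MapsTo ω (Ico 0 1) (Ico 0 1)
  mono : MonotoneOn ω (Ico 0 1)
  zero : ω 0 = 0
  tendsto : Tendsto ω (𝓝[>] 0) (𝓝 0)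

/-- `A` admits the uniform modulus of continuity `ω` in `Ω`:
`‖𝔸(z) - 𝔸(z₀)‖ ≤ ω(ε)` whenever `0 < ε < 1`, `z₀ ∈ Ω` and `z ∈ Ω ∩ 𝒬_ε^{-ε²,ε²}(z₀)`. -/
def HasModulus {p : Fin (n + 1) → ℕ} (B : Matrix (Idx p) (Idx p) ℝ) (ω : ℝ → ℝ)
    (Ω : Set (Pt p)) (A : Pt p → Matrix (Idx p) (Idx p) ℝ) : Prop :=
  ∀ ε : ℝ, 0 < ε → ε < 1 → ∀ z₀ ∈ Ω, ∀ z ∈ Ω ∩ cyl B ε (-ε ^ 2) (ε ^ 2) z₀,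
    ‖Matrix.toEuclideanCLM (n := Fin (p 0)) (𝕜 := ℝ)
      (topBlock p (A z) - topBlock p (A z₀))‖ ≤ ω ε

/-- `osc_S u = sup_S u - inf_S u`, as an extended real number. -/
def osc {X : Type*} (S : Set X) (u : X → ℝ) : EReal :=
  (⨆ z ∈ S, (u z : EReal)) - ⨅ z ∈ S, (u z : EReal)

/-- `S ⋐ D`: the closure of `S` is compact and contained in `D`. -/
def CompactlyIn {X : Type*} [TopologicalSpace X] (S D : Set X) : Prop :=
  IsCompact (closure S) ∧ closure S ⊆ D

/-- The Hölder estimate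
`|u(z) - u(ζ)| ≤ C ‖ζ⁻¹ ∘ z‖_B^α ‖u‖_{L^∞(D)}` for all `z, ζ` with `𝒬¹_ρ(z), 𝒬¹_ρ(ζ) ⋐ D`.
It is an inequality in `[0, ∞]`, so it is also meaningful for unbounded `u`. -/
def HolderEstimate {p : Fin (n + 1) → ℕ} (B : Matrix (Idx p) (Idx p) ℝ) (b K ρ C α : ℝ)
    (D : Set (Pt p)) (u : Pt p → ℝ) : Prop :=
  ∀ z ζ : Pt p, CompactlyIn (cylOne B b K ρ z) D → CompactlyIn (cylOne B b K ρ ζ) D →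
    ENNReal.ofReal |u z - u ζ| ≤
      ENNReal.ofReal (C * homNorm (gmul B (ginv B ζ) z) ^ α) * eLpNorm u ∞ (volume.restrict D)

end Kolmogorov

end

open Kolmogorov

/-! The heart is a growth lemma in the style of Landis (`exists_lower_bound`): a nonnegative
solution that is at least `h` on half of an earlier cylinder is at least `κ * h` on a later one.
Translations preserve the class of operators and dilations rescale it, so unit scale suffices,
provided the constants are uniform in the coefficients.

The barrier is a modified fundamental solution. For a constant matrix A put C(t) = ∫₀ᵗ E(s) A E(s)ᵀ
ds, M = C(t)⁻¹, m = M x and g = t^{-s} exp(-⟨M x, x⟩/4). The Lyapunov equation C' + BᵀC + CB = A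
yields tr(AM) = Q/t and, for arbitrary coefficients a, ℒ_a g = g (⟨(a - A)m, m⟩/4 + s/t - tr(aM)/2).
So if A ≤ a ≤ μA and s > μQ/2, then g is a strict subsolution, whatever the regularity of a
(`HasCovBounds.opL_barrier_pos`). On the other hand, the integral of g over the poles at time lag T
is O(T^{Q/2 - s}), so potentials of bounded densities are bounded as soon as s < Q/2 + 1
(`exists_lintegral_kernel_le`). Such an s exists because μ < 1 + 2/Q. The rank conditions on the
blocks of B make C(1) positive definite, with bounds that depend on A only through its ellipticity
constants.

For the growth lemma, poles are spread over the set E where w ≥ h, and w is compared with a small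
multiple of their potential, lowered by a constant that dominates it on the lateral boundary. The
comparison is needed only where w ≤ h/2. That set is compact and disjoint from E, so the kernel is
continuous there and the potential may be replaced by a finite sum (`exists_riemann_sum`). No
integral has to be differentiated.

The growth lemma, applied to u - inf u or to sup u - u, contracts the oscillation by a fixed factor
(`exists_oscDecay`), and iteration gives the Hölder estimate (`exists_holderEstimate`). In the
Cordes-Landis case A = λ𝕀 and μ = Λ/λ. For uniformly continuous coefficients A is a multiple of the
coefficient matrix frozen inside a small cylinder, and μ is as close to 1 as required. -/

noncomputable section

namespace Kolmogorov

variable {n : ℕ} {p : Fin (n + 1) → ℕ}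

/-! ### The one-parameter group and the dilations -/

/-- The generator `-Bᵀ` of the flow. -/
def drift (B : Matrix (Idx p) (Idx p) ℝ) : Space p →L[ℝ] Space p :=
  Matrix.toEuclideanCLM (n := Idx p) (𝕜 := ℝ) (-Bᵀ)

theorem continuous_toEuclideanCLM {ι : Type*} [Fintype ι] [DecidableEq ι] :
    Continuous (Matrix.toEuclideanCLM (n := ι) (𝕜 := ℝ)) :=
  LinearMap.continuous_of_finiteDimensional
    (Matrix.toEuclideanCLM (n := ι) (𝕜 := ℝ)).toAlgEquiv.toLinearEquiv.toLinearMap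

theorem flow_eq_exp (B : Matrix (Idx p) (Idx p) ℝ) (σ : ℝ) :
    flow B σ = NormedSpace.exp (σ • drift B) := by
  have h : ∀ M : Matrix (Idx p) (Idx p) ℝ,
      Matrix.toEuclideanCLM (n := Idx p) (𝕜 := ℝ) (NormedSpace.exp M) =
        NormedSpace.exp (Matrix.toEuclideanCLM (n := Idx p) (𝕜 := ℝ) M) := by
    intro M
    -- The matrix exponential depends only on the topology, so any submultiplicative norm may be
    -- installed locally.
    let : NormedRing (Matrix (Idx p) (Idx p) ℝ) := Matrix.linftyOpNormedRing
    let : NormedAlgebra ℝ (Matrix (Idx p) (Idx p) ℝ) := Matrix.linftyOpNormedAlgebra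
    let : NormedAlgebra ℚ (Matrix (Idx p) (Idx p) ℝ) := NormedAlgebra.restrictScalars ℚ ℝ _
    exact NormedSpace.map_exp (Matrix.toEuclideanCLM (n := Idx p) (𝕜 := ℝ))
      continuous_toEuclideanCLM M
  rw [flow, drift, h, ← smul_neg, map_smul]

theorem flow_zero (B : Matrix (Idx p) (Idx p) ℝ) : flow B 0 = 1 := by
  rw [flow_eq_exp, zero_smul ℝ (drift B), NormedSpace.exp_zero]

theorem flow_add (B : Matrix (Idx p) (Idx p) ℝ) (σ τ : ℝ) :
    flow B (σ + τ) = flow B σ * flow B τ := by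
  let : NormedAlgebra ℚ (Space p →L[ℝ] Space p) := NormedAlgebra.restrictScalars ℚ ℝ _
  simp only [flow_eq_exp, add_smul σ τ (drift B)]
  refine NormedSpace.exp_add_of_commute ?_
  ext1 y
  change σ • drift B (τ • drift B y) = τ • drift B (σ • drift B y)
  rw [map_smul, map_smul, smul_comm]

theorem flow_flow (B : Matrix (Idx p) (Idx p) ℝ) (σ τ : ℝ) (x : Space p) :
    flow B σ (flow B τ x) = flow B (σ + τ) x := by
  rw [flow_add]; rfl

theorem flow_zero_apply (B : Matrix (Idx p) (Idx p) ℝ) (x : Space p) : flow B 0 x = x := by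
  rw [flow_zero]; rfl

theorem hasDerivAt_flow (B : Matrix (Idx p) (Idx p) ℝ) (σ : ℝ) :
    HasDerivAt (flow B) (drift B * flow B σ) σ := by
  have h := hasDerivAt_exp_smul_const' (𝕂 := ℝ) (drift B) σ
  have e : flow B = fun u : ℝ => NormedSpace.exp (u • drift B) := funext (flow_eq_exp B)
  rw [e]; exact h

theorem contDiff_flow (B : Matrix (Idx p) (Idx p) ℝ) {m : WithTop ℕ∞} : ContDiff ℝ m (flow B) := by
  have e : flow B = fun u : ℝ => NormedSpace.exp (u • drift B) := funext (flow_eq_exp B)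
  have h : ContDiff ℝ m (NormedSpace.exp : (Space p →L[ℝ] Space p) → _) := by
    rw [contDiff_iff_contDiffAt]
    intro x
    exact (NormedSpace.exp_analytic (𝕂 := ℝ) x).contDiffAt
  rw [e]
  exact h.comp (contDiff_id.smul contDiff_const)

theorem drift_apply (B : Matrix (Idx p) (Idx p) ℝ) (x : Space p) (k : Idx p) :
    drift B x k = -∑ l, B l k * x l := by
  have : drift B x k = ((-Bᵀ) *ᵥ x.ofLp) k := rfl
  rw [this, Matrix.neg_mulVec]
  simp [Matrix.mulVec, dotProduct]

/-- The dilation `x^{(p_i)} ↦ r^{2i+1} x^{(p_i)}`. -/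
def dil (p : Fin (n + 1) → ℕ) (r : ℝ) : Space p →L[ℝ] Space p :=
  Matrix.toEuclideanCLM (n := Idx p) (𝕜 := ℝ)
    (Matrix.diagonal fun k : Idx p => r ^ (2 * (k.1 : ℕ) + 1))

@[simp] theorem dil_apply (r : ℝ) (x : Space p) (k : Idx p) :
    dil p r x k = r ^ (2 * (k.1 : ℕ) + 1) * x k := by
  have : dil p r x k =
    ((Matrix.diagonal fun k : Idx p => r ^ (2 * (k.1 : ℕ) + 1)) *ᵥ x.ofLp) k := rfl
  rw [this, Matrix.mulVec_diagonal]

theorem dil_dil (r s : ℝ) (x : Space p) : dil p r (dil p s x) = dil p (r * s) x := by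
  ext k; simp [mul_pow, mul_assoc]

theorem dil_one (x : Space p) : dil p 1 x = x := by
  ext k; simp

theorem dil_dil_inv {r : ℝ} (hr : r ≠ 0) (x : Space p) : dil p r (dil p r⁻¹ x) = x := by
  rw [dil_dil, mul_inv_cancel₀ hr, dil_one]

/-- `B` couples block `i` only with block `i + 1`, and consecutive weights `2i + 1` differ by two.
This produces the factor `r ^ 2`, which is the scaling of time. -/
theorem dil_drift {B : Matrix (Idx p) (Idx p) ℝ} (hB : IsDriftMatrix p B) (r : ℝ) (x : Space p) :
    dil p r (drift B x) = r ^ 2 • drift B (dil p r x) := by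
  ext k
  simp only [dil_apply, drift_apply, PiLp.smul_apply, smul_eq_mul, mul_neg, Finset.mul_sum]
  congr 1
  refine Finset.sum_congr rfl fun l _ => ?_
  by_cases h : (l.1 : ℕ) + 1 = k.1
  · rw [← h]; ring
  · rw [hB.off_block l k h]; ring

/-- The intertwining relation `dil_drift` passes to exponentials; hence dilations, with time scaled
by `r ^ 2`, are automorphisms of the group. -/
theorem dil_flow {B : Matrix (Idx p) (Idx p) ℝ} (hB : IsDriftMatrix p B) (r σ : ℝ) (x : Space p) :
    dil p r (flow B σ x) = flow B (r ^ 2 * σ) (dil p r x) := by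
  have h : SemiconjBy (dil p r) (σ • drift B) ((r ^ 2 * σ) • drift B) := by
    ext1 y
    change dil p r (σ • drift B y) = (r ^ 2 * σ) • drift B (dil p r y)
    rw [map_smul, dil_drift hB, smul_smul, mul_comm]
  let : NormedAlgebra ℚ (Space p →L[ℝ] Space p) := NormedAlgebra.restrictScalars ℚ ℝ _
  have h2 := h.exp_right
  rw [← flow_eq_exp, ← flow_eq_exp] at h2
  exact congrArg (fun T : Space p →L[ℝ] Space p => T x) h2.eq

/-! ### The homogeneous norm -/

theorem spaceNorm_nonneg (x : Space p) : 0 ≤ spaceNorm x :=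
  Finset.sum_nonneg fun _ _ => by positivity

theorem homNorm_nonneg (z : Pt p) : 0 ≤ homNorm z :=
  add_nonneg (spaceNorm_nonneg _) (by positivity)

theorem block_smul_of_dil (r : ℝ) (x : Space p) (i : Fin (n + 1)) :
    block (dil p r x) i = r ^ (2 * (i : ℕ) + 1) • block x i := by
  ext a; simp [block]

theorem exponent_pos (i : Fin (n + 1)) : 0 < 1 / (2 * (i : ℝ) + 1) := by positivity

theorem exponent_le_one (i : Fin (n + 1)) : 1 / (2 * (i : ℝ) + 1) ≤ 1 := by
  rw [div_le_one (by positivity)]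
  have : (0 : ℝ) ≤ (i : ℝ) := by positivity
  linarith

theorem pow_rpow_exponent {r : ℝ} (hr : 0 ≤ r) (i : Fin (n + 1)) :
    (r ^ (2 * (i : ℕ) + 1)) ^ (1 / (2 * (i : ℝ) + 1)) = r := by
  rw [← Real.rpow_natCast, ← Real.rpow_mul hr]
  have : ((2 * (i : ℕ) + 1 : ℕ) : ℝ) * (1 / (2 * (i : ℝ) + 1)) = 1 := by
    push_cast; field_simp
  rw [this, Real.rpow_one]

theorem spaceNorm_dil {r : ℝ} (hr : 0 ≤ r) (x : Space p) :
    spaceNorm (dil p r x) = r * spaceNorm x := by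
  simp only [spaceNorm, Finset.mul_sum]
  refine Finset.sum_congr rfl fun i _ => ?_
  rw [block_smul_of_dil, norm_smul, Real.norm_of_nonneg (by positivity),
    Real.mul_rpow (by positivity) (norm_nonneg _), pow_rpow_exponent hr]

theorem norm_block_le (x : Space p) (i : Fin (n + 1)) : ‖block x i‖ ≤ ‖x‖ := by
  rw [EuclideanSpace.norm_eq, EuclideanSpace.norm_eq]
  apply Real.sqrt_le_sqrt
  rw [Fintype.sum_sigma]
  exact Finset.single_le_sum (f := fun i => ∑ a, ‖x ⟨i, a⟩‖ ^ 2)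
    (fun i _ => Finset.sum_nonneg fun _ _ => by positivity) (Finset.mem_univ i)

theorem abs_apply_le_norm_block (x : Space p) (k : Idx p) : |x k| ≤ ‖block x k.1‖ := by
  have := PiLp.norm_apply_le (block x k.1) k.2
  simpa [block] using this

theorem continuous_block (i : Fin (n + 1)) : Continuous fun x : Space p => block x i := by
  unfold block
  fun_prop

theorem continuous_spaceNorm : Continuous (spaceNorm : Space p → ℝ) := by
  unfold spaceNorm
  refine continuous_finsetSum _ fun i _ => ?_
  exact (continuous_block i).norm.rpow_const fun _ => Or.inr (exponent_pos i).le

/-- Used only to fit a Euclidean ball into a homogeneous one when `K₀` is chosen, so a crude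
constant is enough. -/
theorem spaceNorm_le {R : ℝ} (hR : 1 ≤ R) {x : Space p} (hx : ‖x‖ ≤ R) :
    spaceNorm x ≤ (n + 1) * R := by
  calc spaceNorm x ≤ ∑ i : Fin (n + 1), R := by
        refine Finset.sum_le_sum fun i _ => ?_
        calc ‖block x i‖ ^ (1 / (2 * (i : ℝ) + 1)) ≤ R ^ (1 / (2 * (i : ℝ) + 1)) :=
              Real.rpow_le_rpow (norm_nonneg _) ((norm_block_le x i).trans hx) (exponent_pos i).le
          _ ≤ R ^ (1 : ℝ) := Real.rpow_le_rpow_of_exponent_le hR (exponent_le_one i)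
          _ = R := Real.rpow_one R
    _ = (n + 1) * R := by simp

theorem spaceNorm_zero : spaceNorm (0 : Space p) = 0 := by
  refine Finset.sum_eq_zero fun i _ => ?_
  have : block (0 : Space p) i = 0 := by ext a; simp [block]
  rw [this, norm_zero, Real.zero_rpow (exponent_pos i).ne']

theorem eq_zero_of_spaceNorm {x : Space p} (h : spaceNorm x = 0) : x = 0 := by
  have h2 := (Finset.sum_eq_zero_iff_of_nonneg (fun i _ => by positivity)).1 h
  ext k
  have h3 := h2 k.1 (Finset.mem_univ _)
  rw [Real.rpow_eq_zero (norm_nonneg _) (exponent_pos k.1).ne'] at h3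
  have := abs_apply_le_norm_block x k
  rw [h3] at this
  simpa using abs_nonpos_iff.1 this

theorem spaceNorm_neg (x : Space p) : spaceNorm (-x) = spaceNorm x := by
  refine Finset.sum_congr rfl fun i _ => ?_
  have : block (-x) i = -block x i := by ext a; simp [block]
  rw [this, norm_neg]

theorem norm_block_rpow_le_spaceNorm (x : Space p) (i : Fin (n + 1)) :
    ‖block x i‖ ^ (1 / (2 * (i : ℝ) + 1)) ≤ spaceNorm x :=
  Finset.single_le_sum (f := fun i : Fin (n + 1) => ‖block x i‖ ^ (1 / (2 * (i : ℝ) + 1)))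
    (fun i _ => by positivity) (Finset.mem_univ i)

theorem norm_block_le_one {x : Space p} (hx : spaceNorm x ≤ 1) (i : Fin (n + 1)) :
    ‖block x i‖ ≤ 1 := by
  by_contra! h
  have := Real.one_lt_rpow h (exponent_pos i)
  linarith [norm_block_rpow_le_spaceNorm x i]

theorem isCompact_homNorm_le_one : IsCompact {z : Pt p | homNorm z ≤ 1} := by
  have hc : IsClosed {z : Pt p | homNorm z ≤ 1} := by
    refine isClosed_le ?_ continuous_const
    refine (continuous_spaceNorm.comp continuous_fst).add ?_
    exact (continuous_snd.abs).rpow_const fun _ => Or.inr (by norm_num)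
  have hsub : {z : Pt p | homNorm z ≤ 1} ⊆
      (WithLp.toLp 2 '' (univ.pi fun _ : Idx p => Icc (-1 : ℝ) 1)) ×ˢ Icc (-1 : ℝ) 1 := by
    rintro ⟨x, t⟩ hz
    have hz' : spaceNorm x + |t| ^ (1 / 2 : ℝ) ≤ 1 := hz
    have h0 := spaceNorm_nonneg x
    have h1 : (0 : ℝ) ≤ |t| ^ (1 / 2 : ℝ) := by positivity
    refine ⟨⟨x.ofLp, fun k _ => ?_, rfl⟩, ?_⟩
    · exact abs_le.1 ((abs_apply_le_norm_block x k).trans (norm_block_le_one (by linarith) _))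
    · refine abs_le.1 ?_
      by_contra! h
      have := Real.one_lt_rpow h (show (0 : ℝ) < 1 / 2 by norm_num)
      linarith
  refine IsCompact.of_isClosed_subset ?_ hc hsub
  refine IsCompact.prod ?_ isCompact_Icc
  exact (isCompact_univ_pi fun _ => isCompact_Icc).image (PiLp.continuous_toLp 2 _)

/-- The dilations of `ℝ^{N+1}` are automorphisms for which `homNorm` is homogeneous, hence the norm
of the inverse is controlled by the norm. -/
theorem exists_spaceNorm_flow_le {B : Matrix (Idx p) (Idx p) ℝ} (hB : IsDriftMatrix p B) :
    ∃ C : ℝ, 1 ≤ C ∧ ∀ (x : Space p) (t : ℝ), spaceNorm (flow B (-t) x) ≤ C * homNorm (x, t) := by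
  have hcont : Continuous fun z : Pt p => spaceNorm (flow B (-z.2) z.1) := by
    refine continuous_spaceNorm.comp ?_
    exact ((contDiff_flow B (m := 0)).continuous.comp continuous_snd.neg).clm_apply continuous_fst
  obtain ⟨C, hC⟩ := isCompact_homNorm_le_one.bddAbove_image hcont.continuousOn
  refine ⟨max C 1, le_max_right _ _, fun x t => ?_⟩
  set d := homNorm (x, t) with hd
  have hd0 : 0 ≤ d := homNorm_nonneg _
  rcases hd0.eq_or_lt with h | h
  · have hx : spaceNorm x = 0 := by
      have h1 := spaceNorm_nonneg x
      have h2 : (0 : ℝ) ≤ |t| ^ (1 / 2 : ℝ) := by positivity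
      have : d = spaceNorm x + |t| ^ (1 / 2 : ℝ) := rfl
      linarith
    rw [eq_zero_of_spaceNorm hx, map_zero, spaceNorm_zero, ← h, mul_zero]
  · have hmem : ((dil p d⁻¹ x, d⁻¹ ^ 2 * t) : Pt p) ∈ {z : Pt p | homNorm z ≤ 1} := by
      change spaceNorm (dil p d⁻¹ x) + |d⁻¹ ^ 2 * t| ^ (1 / 2 : ℝ) ≤ 1
      rw [spaceNorm_dil (by positivity), abs_mul, abs_of_nonneg (by positivity),
        Real.mul_rpow (by positivity) (by positivity), ← Real.sqrt_eq_rpow, ← Real.sqrt_eq_rpow,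
        Real.sqrt_sq (by positivity), ← mul_add]
      have : spaceNorm x + √|t| = d := by rw [hd, homNorm, Real.sqrt_eq_rpow]
      rw [this, inv_mul_cancel₀ h.ne']
    have h1 := hC ⟨_, hmem, rfl⟩
    have h2 : flow B (-t) x = dil p d (flow B (-(d⁻¹ ^ 2 * t)) (dil p d⁻¹ x)) := by
      rw [dil_flow hB, dil_dil_inv h.ne']
      congr 2
      field_simp
    rw [h2, spaceNorm_dil hd0, mul_comm]
    exact mul_le_mul_of_nonneg_right (h1.trans (le_max_left _ _)) hd0

/-! ### The constants `σ₀`, `σ̄` and the time scale -/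

theorem bddAbove_spaceNorm_sphere :
    BddAbove (spaceNorm '' Metric.sphere (0 : Space p) 1) :=
  (isCompact_sphere _ _).bddAbove_image continuous_spaceNorm.continuousOn

theorem bddBelow_spaceNorm_sphere :
    BddBelow (spaceNorm '' Metric.sphere (0 : Space p) 1) :=
  ⟨0, by rintro _ ⟨x, -, rfl⟩; exact spaceNorm_nonneg x⟩

theorem sigmaMin_pos [Nonempty (Idx p)] : 0 < sigmaMin p := by
  have hne : (Metric.sphere (0 : Space p) 1).Nonempty := NormedSpace.sphere_nonempty.2 zero_le_one
  obtain ⟨x, hx, hx2⟩ := ((isCompact_sphere (0 : Space p) 1).image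
    continuous_spaceNorm).sInf_mem (hne.image _)
  rw [sigmaMin, ← hx2]
  refine (spaceNorm_nonneg x).lt_of_ne fun h => ?_
  rw [eq_zero_of_spaceNorm h.symm] at hx
  simp at hx

theorem IsTimeScale.le_one [Nonempty (Idx p)] {B : Matrix (Idx p) (Idx p) ℝ} {b : ℝ}
    (hb : IsTimeScale B b) : b ≤ 1 := by
  have hne : (Metric.sphere (0 : Space p) 1).Nonempty := NormedSpace.sphere_nonempty.2 zero_le_one
  have h1 : sigmaMin p ≤ sigmaMax p :=
    csInf_le_csSup (hne.image _) bddBelow_spaceNorm_sphere bddAbove_spaceNorm_sphere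
  have h2 := sigmaMin_pos (p := p)
  refine hb.le_sq.trans (pow_le_one₀ (div_nonneg h2.le (h2.le.trans h1)) ?_)
  exact (div_le_one (h2.trans_le h1)).2 h1

/-- Radial projection of a long vector to the unit sphere shrinks every block. This explains `θ = K
/ σ₀`: the cylinder of radius `r / θ` rescales into the Euclidean unit ball. -/
theorem norm_lt_one_of_spaceNorm_lt {x : Space p} (hx : spaceNorm x < sigmaMin p) :
    ‖x‖ < 1 := by
  by_contra! h
  have h0 : 0 < ‖x‖ := by linarith
  have h1 : sigmaMin p ≤ spaceNorm (‖x‖⁻¹ • x) := by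
    refine csInf_le bddBelow_spaceNorm_sphere ⟨_, ?_, rfl⟩
    rw [mem_sphere_zero_iff_norm, norm_smul, norm_inv, norm_norm, inv_mul_cancel₀ h0.ne']
  have h2 : spaceNorm (‖x‖⁻¹ • x) ≤ spaceNorm x := by
    refine Finset.sum_le_sum fun i _ => ?_
    refine Real.rpow_le_rpow (norm_nonneg _) ?_ (exponent_pos i).le
    have : block (‖x‖⁻¹ • x) i = ‖x‖⁻¹ • block x i := by ext a; simp [block]
    rw [this, norm_smul, norm_inv, norm_norm]
    exact mul_le_of_le_one_left (norm_nonneg _) (inv_le_one_of_one_le₀ h)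
  linarith

/-! ### The group law -/

theorem gmul_ginv_gmul (B : Matrix (Idx p) (Idx p) ℝ) (z w : Pt p) :
    gmul B z (gmul B (ginv B z) w) = w := by
  simp only [gmul, ginv, map_neg, flow_flow]
  ext1
  · simp only
    rw [add_assoc, add_comm w.2 (-z.2), add_comm (-z.2)]
    simp
  · simp

theorem gmul_ginv (B : Matrix (Idx p) (Idx p) ℝ) (z w : Pt p) :
    gmul B (ginv B z) w = (w.1 - flow B (w.2 - z.2) z.1, w.2 - z.2) := by
  simp only [gmul, ginv, map_neg, flow_flow]
  ext1
  · simp only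
    rw [sub_eq_add_neg w.1, sub_eq_add_neg w.2]
  · simp only; ring

theorem gmul_zero (B : Matrix (Idx p) (Idx p) ℝ) (z : Pt p) : gmul B z (0, 0) = z := by
  simp [gmul, flow_zero_apply]

/-- The map `(x, t) ↦ z₀ ∘ (δ_r x, r² t)`. -/
def chart (B : Matrix (Idx p) (Idx p) ℝ) (z₀ : Pt p) (r : ℝ) (z : Pt p) : Pt p :=
  gmul B z₀ (dil p r z.1, r ^ 2 * z.2)

theorem contDiff_chart (B : Matrix (Idx p) (Idx p) ℝ) (z₀ : Pt p) (r : ℝ) {m : WithTop ℕ∞} :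
    ContDiff ℝ m (chart B z₀ r) := by
  unfold chart gmul
  have h1 : ContDiff ℝ m fun z : Pt p => r ^ 2 * z.2 := contDiff_const.mul contDiff_snd
  refine ContDiff.prodMk ?_ (contDiff_const.add h1)
  exact ((dil p r).contDiff.comp contDiff_fst).add
    (((contDiff_flow B).comp h1).clm_apply contDiff_const)

theorem mem_cyl {B : Matrix (Idx p) (Idx p) ℝ} {r t₁ t₂ : ℝ} {z₀ z : Pt p} :
    z ∈ cyl B r t₁ t₂ z₀ ↔
      spaceNorm (gmul B (ginv B z₀) z).1 < r ∧ z.2 - z₀.2 ∈ Ioo t₁ t₂ := by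
  constructor
  · rintro ⟨w, ⟨hw1, hw2⟩, rfl⟩
    rw [gmul_ginv]
    simp only [gmul, add_sub_cancel_left]
    exact ⟨by simpa [hball] using hw1, hw2⟩
  · rintro ⟨h1, h2⟩
    refine ⟨gmul B (ginv B z₀) z, ⟨h1, ?_⟩, gmul_ginv_gmul B z₀ z⟩
    rw [gmul_ginv]; exact h2

theorem chart_mem_cylOne {B : Matrix (Idx p) (Idx p) ℝ} {b K r : ℝ} (hr : 0 < r) {z₀ z : Pt p}
    (h1 : spaceNorm z.1 < K) (h2 : -b < z.2) (h3 : z.2 < 0) :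
    chart B z₀ r z ∈ cylOne B b K r z₀ := by
  refine ⟨_, ⟨?_, ?_, ?_⟩, rfl⟩
  · change spaceNorm (dil p r z.1) < K * r
    rw [spaceNorm_dil hr.le, mul_comm]
    exact mul_lt_mul_of_pos_right h1 hr
  · change -(b * r ^ 2) < r ^ 2 * z.2
    have := mul_lt_mul_of_pos_left h2 (pow_pos hr 2)
    linarith
  · change r ^ 2 * z.2 < 0
    exact mul_neg_of_pos_of_neg (pow_pos hr 2) h3

theorem exists_chart_eq_of_mem_cylOne {B : Matrix (Idx p) (Idx p) ℝ} {b K r ρ : ℝ} (hr : 0 < r)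
    {z₀ w : Pt p} (hw : w ∈ cylOne B b K ρ z₀) :
    ∃ z : Pt p, spaceNorm z.1 < K * ρ / r ∧ -(b * ρ ^ 2) / r ^ 2 < z.2 ∧ z.2 < 0 ∧
      chart B z₀ r z = w := by
  obtain ⟨v, ⟨hv1, hv2, hv3⟩, rfl⟩ := hw
  refine ⟨(dil p r⁻¹ v.1, v.2 / r ^ 2), ?_, ?_, ?_, ?_⟩
  · change spaceNorm (dil p r⁻¹ v.1) < _
    rw [spaceNorm_dil (inv_nonneg.2 hr.le), div_eq_inv_mul]
    exact mul_lt_mul_of_pos_left hv1 (inv_pos.2 hr)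
  · exact div_lt_div_of_pos_right hv2 (pow_pos hr 2)
  · exact div_neg_of_neg_of_pos hv3 (pow_pos hr 2)
  · simp only [chart, dil_dil_inv hr.ne']
    congr 1
    ext1
    · rfl
    · simp only; field_simp

/-! ### Traces of products of nonnegative matrices -/

section Trace

open scoped MatrixOrder Matrix.Norms.L2Operator

/-- Factoring `A` as `star C * C` turns the trace into the sum of the values of the form of `H` at
the rows of `C`. -/
theorem trace_mul_nonneg_of_posSemidef {ι : Type*} [Fintype ι] [DecidableEq ι]
    {A H : Matrix ι ι ℝ} (hA : A.PosSemidef) (hH : ∀ v : ι → ℝ, 0 ≤ v ⬝ᵥ H *ᵥ v) :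
    0 ≤ (A * H).trace := by
  obtain ⟨C, rfl⟩ := CStarAlgebra.nonneg_iff_eq_star_mul_self.mp hA.nonneg
  have : (star C * C * H).trace = ∑ i, C i ⬝ᵥ H *ᵥ C i := by
    rw [Matrix.mul_assoc, Matrix.trace_mul_comm, Matrix.mul_assoc, Matrix.trace]
    refine Finset.sum_congr rfl fun i _ => ?_
    simp only [Matrix.diag_apply, Matrix.mul_apply, Matrix.mulVec, dotProduct,
      Matrix.star_apply, star_trivial]
  rw [this]
  exact Finset.sum_nonneg fun i _ => hH _

end Trace

/-! ### The operator under sums, scalar multiples and changes of variables -/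

theorem contDiffAt_two_differentiableAt {u : Pt p → ℝ} {z : Pt p} (hu : ContDiffAt ℝ 2 u z) :
    DifferentiableAt ℝ u z := hu.differentiableAt two_ne_zero

theorem contDiffAt_two_eventually_differentiableAt {u : Pt p → ℝ} {z : Pt p}
    (hu : ContDiffAt ℝ 2 u z) : ∀ᶠ w in 𝓝 z, DifferentiableAt ℝ u w := by
  filter_upwards [hu.eventually (by simp)] with w hw
  exact contDiffAt_two_differentiableAt hw

theorem contDiffAt_two_differentiableAt_fderiv {u : Pt p → ℝ} {z : Pt p}
    (hu : ContDiffAt ℝ 2 u z) (v : Pt p) : DifferentiableAt ℝ (fun w => fderiv ℝ u w v) z := by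
  have h : ContDiffAt ℝ 1 (fderiv ℝ u) z := hu.fderiv_right (by norm_num)
  exact (h.differentiableAt one_ne_zero).clm_apply (differentiableAt_const v)

theorem opL_add {B : Matrix (Idx p) (Idx p) ℝ} {A : Pt p → Matrix (Idx p) (Idx p) ℝ}
    {u v : Pt p → ℝ} {z : Pt p} (hu : ContDiffAt ℝ 2 u z) (hv : ContDiffAt ℝ 2 v z) :
    opL B A (fun w => u w + v w) z = opL B A u z + opL B A v z := by
  have h1 : ∀ᶠ w in 𝓝 z, fderiv ℝ (fun w => u w + v w) w = fderiv ℝ u w + fderiv ℝ v w := by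
    filter_upwards [contDiffAt_two_eventually_differentiableAt hu,
      contDiffAt_two_eventually_differentiableAt hv] with w h1 h2
    exact fderiv_fun_add h1 h2
  have hg : grad (fun w => u w + v w) z = grad u z + grad v z := by
    funext k; simp only [grad, Pi.add_apply]; rw [h1.self_of_nhds]; rfl
  have hh : hess (fun w => u w + v w) z = hess u z + hess v z := by
    ext k l
    simp only [hess, Matrix.of_apply, Matrix.add_apply]
    have h2 : (fun w => fderiv ℝ (fun w => u w + v w) w (spaceDir p l)) =ᶠ[𝓝 z]
        fun w => fderiv ℝ u w (spaceDir p l) + fderiv ℝ v w (spaceDir p l) := by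
      filter_upwards [h1] with w hw
      rw [hw]; rfl
    rw [h2.fderiv_eq, fderiv_fun_add (contDiffAt_two_differentiableAt_fderiv hu _)
      (contDiffAt_two_differentiableAt_fderiv hv _)]
    rfl
  simp only [opL, hg, hh, timeDeriv, h1.self_of_nhds, Matrix.mul_add, Matrix.trace_add,
    Matrix.mulVec_add, dotProduct_add, _root_.add_apply]
  ring

theorem opL_const_mul {B : Matrix (Idx p) (Idx p) ℝ} {A : Pt p → Matrix (Idx p) (Idx p) ℝ}
    {u : Pt p → ℝ} {z : Pt p} (hu : ContDiffAt ℝ 2 u z) (c : ℝ) :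
    opL B A (fun w => c * u w) z = c * opL B A u z := by
  have h1 : ∀ᶠ w in 𝓝 z, fderiv ℝ (fun w => c * u w) w = c • fderiv ℝ u w := by
    filter_upwards [contDiffAt_two_eventually_differentiableAt hu] with w h1
    exact fderiv_const_mul h1 c
  have hg : grad (fun w => c * u w) z = c • grad u z := by
    funext k; simp only [grad, Pi.smul_apply]; rw [h1.self_of_nhds]; rfl
  have hh : hess (fun w => c * u w) z = c • hess u z := by
    ext k l
    simp only [hess, Matrix.of_apply, Matrix.smul_apply]
    have h2 : (fun w => fderiv ℝ (fun w => c * u w) w (spaceDir p l)) =ᶠ[𝓝 z]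
        fun w => c * fderiv ℝ u w (spaceDir p l) := by
      filter_upwards [h1] with w hw
      rw [hw]; rfl
    rw [h2.fderiv_eq, fderiv_const_mul (contDiffAt_two_differentiableAt_fderiv hu _)]
    rfl
  simp only [opL, hg, hh, timeDeriv, h1.self_of_nhds, Matrix.mul_smul, Matrix.trace_smul,
    Matrix.mulVec_smul, dotProduct_smul, _root_.smul_apply, smul_eq_mul]
  ring

theorem opL_const {B : Matrix (Idx p) (Idx p) ℝ} {A : Pt p → Matrix (Idx p) (Idx p) ℝ}
    (c : ℝ) (z : Pt p) : opL B A (fun _ => c) z = 0 := by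
  have hg : grad (fun _ : Pt p => c) z = 0 := by
    funext k; simp [grad]
  have hh : hess (fun _ : Pt p => c) z = 0 := by
    ext k l; simp [hess]
  simp [opL, hg, hh, timeDeriv]

theorem opL_sum {B : Matrix (Idx p) (Idx p) ℝ} {A : Pt p → Matrix (Idx p) (Idx p) ℝ}
    {ι : Type*} (s : Finset ι) {u : ι → Pt p → ℝ} {z : Pt p}
    (hu : ∀ i ∈ s, ContDiffAt ℝ 2 (u i) z) :
    opL B A (fun w => ∑ i ∈ s, u i w) z = ∑ i ∈ s, opL B A (u i) z := by
  classical
  induction s using Finset.induction_on with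
  | empty => simpa using opL_const 0 z
  | insert a s ha ih =>
    simp only [Finset.sum_insert ha]
    rw [opL_add (hu a (Finset.mem_insert_self _ _))
      (ContDiffAt.sum fun i hi => hu i (Finset.mem_insert_of_mem hi)),
      ih fun i hi => hu i (Finset.mem_insert_of_mem hi)]

theorem fderiv_space_eq_sum (L : Pt p →L[ℝ] ℝ) (x : Space p) :
    L (x, 0) = ∑ k, x k * L (spaceDir p k) := by
  have : ((x, 0) : Pt p) = ∑ k, x k • spaceDir p k := by
    ext1
    · rw [Prod.fst_sum]
      ext k
      simp [spaceDir, Pi.single_apply]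
    · rw [Prod.snd_sum]
      simp [spaceDir]
  rw [this, map_sum]
  simp

theorem fderiv_chart_space {B : Matrix (Idx p) (Idx p) ℝ} (z₀ : Pt p) (r : ℝ) (z : Pt p)
    (k : Idx p) :
    fderiv ℝ (chart B z₀ r) z (spaceDir p k) = r ^ (2 * (k.1 : ℕ) + 1) • spaceDir p k := by
  have hd : HasFDerivAt (chart B z₀ r) (fderiv ℝ (chart B z₀ r) z) z :=
    ((contDiff_chart B z₀ r (m := 1)).differentiable one_ne_zero z).hasFDerivAt
  have h1 := (hd.hasLineDerivAt (spaceDir p k))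
  have h2 : HasDerivAt (fun s : ℝ => chart B z₀ r (z + s • spaceDir p k))
      (r ^ (2 * (k.1 : ℕ) + 1) • spaceDir p k) 0 := by
    have e : (fun s : ℝ => chart B z₀ r (z + s • spaceDir p k)) =
        fun s : ℝ => chart B z₀ r z + s • r ^ (2 * (k.1 : ℕ) + 1) • spaceDir p k := by
      funext s
      have : dil p r (EuclideanSpace.single k (1 : ℝ)) =
          r ^ (2 * (k.1 : ℕ) + 1) • EuclideanSpace.single k (1 : ℝ) := by
        ext l
        by_cases h : l = k
        · subst h; simp
        · simp [h]
      simp only [chart, gmul, spaceDir, Prod.smul_mk, Prod.fst_add, Prod.snd_add, smul_zero,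
        add_zero, map_add, map_smul, this, Prod.mk_add_mk]
      congr 1
      abel
    rw [e]
    simpa using ((hasDerivAt_id (0 : ℝ)).smul_const _).const_add (chart B z₀ r z)
  exact h1.unique h2

theorem fderiv_chart_time {B : Matrix (Idx p) (Idx p) ℝ} (z₀ : Pt p) (r : ℝ) (z : Pt p) :
    fderiv ℝ (chart B z₀ r) z (0, 1) =
      r ^ 2 • ((drift B (flow B (r ^ 2 * z.2) z₀.1), 1) : Pt p) := by
  have hd : HasFDerivAt (chart B z₀ r) (fderiv ℝ (chart B z₀ r) z) z :=
    ((contDiff_chart B z₀ r (m := 1)).differentiable one_ne_zero z).hasFDerivAt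
  have h1 := (hd.hasLineDerivAt ((0, 1) : Pt p))
  have h2 : HasDerivAt (fun s : ℝ => chart B z₀ r (z + s • ((0, 1) : Pt p)))
      (r ^ 2 • ((drift B (flow B (r ^ 2 * z.2) z₀.1), 1) : Pt p)) 0 := by
    have e : (fun s : ℝ => chart B z₀ r (z + s • ((0, 1) : Pt p))) =
        fun s : ℝ => ((dil p r z.1 + flow B (r ^ 2 * (z.2 + s)) z₀.1,
          z₀.2 + r ^ 2 * (z.2 + s)) : Pt p) := by
      funext s
      simp [chart, gmul]
    rw [e]
    have h3 : HasDerivAt (fun s : ℝ => r ^ 2 * (z.2 + s)) (r ^ 2) 0 := by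
      simpa using ((hasDerivAt_id (0 : ℝ)).const_add z.2).const_mul (r ^ 2)
    have h4 : HasDerivAt (fun s : ℝ => flow B (r ^ 2 * (z.2 + s)))
        (r ^ 2 • (drift B * flow B (r ^ 2 * z.2))) 0 := by
      have h5 := hasDerivAt_flow B (r ^ 2 * (z.2 + 0))
      have h6 := h5.scomp (0 : ℝ) h3
      rw [add_zero] at h6
      exact h6
    have h7 := h4.clm_apply (hasDerivAt_const (0 : ℝ) z₀.1)
    have h8 := (h7.const_add (dil p r z.1)).prodMk (h3.const_add z₀.2)
    convert h8 using 1
    simp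
  exact h1.unique h2

/-- Left translations are symmetries of the operator and dilations rescale it. -/
theorem opL_comp_chart {B : Matrix (Idx p) (Idx p) ℝ} (hB : IsDriftMatrix p B)
    {A : Pt p → Matrix (Idx p) (Idx p) ℝ} {u : Pt p → ℝ} {z₀ : Pt p} {r : ℝ} {z : Pt p}
    (hA : ∀ k l : Idx p, (k.1 ≠ 0 ∨ l.1 ≠ 0) → A (chart B z₀ r z) k l = 0)
    (hu : ContDiffAt ℝ 2 u (chart B z₀ r z)) :
    opL B (A ∘ chart B z₀ r) (u ∘ chart B z₀ r) z = r ^ 2 * opL B A u (chart B z₀ r z) := by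
  set φ := chart B z₀ r with hφ
  have hφd : Differentiable ℝ φ := (contDiff_chart B z₀ r (m := 1)).differentiable one_ne_zero
  have h1 : ∀ᶠ w in 𝓝 z, fderiv ℝ (u ∘ φ) w = (fderiv ℝ u (φ w)).comp (fderiv ℝ φ w) := by
    have := hφd.continuous.continuousAt.eventually (contDiffAt_two_eventually_differentiableAt hu)
    filter_upwards [this] with w hw
    exact fderiv_comp w hw (hφd w)
  have hgrad : ∀ k, grad (u ∘ φ) z k = r ^ (2 * (k.1 : ℕ) + 1) * grad u (φ z) k := by
    intro k
    simp only [grad, h1.self_of_nhds, ContinuousLinearMap.comp_apply]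
    rw [hφ, fderiv_chart_space, map_smul, smul_eq_mul]
  have hhess : ∀ k l, hess (u ∘ φ) z k l =
      r ^ (2 * (k.1 : ℕ) + 1) * r ^ (2 * (l.1 : ℕ) + 1) * hess u (φ z) k l := by
    intro k l
    simp only [hess, Matrix.of_apply]
    have h2 : (fun w => fderiv ℝ (u ∘ φ) w (spaceDir p l)) =ᶠ[𝓝 z]
        fun w => r ^ (2 * (l.1 : ℕ) + 1) * ((fun y => fderiv ℝ u y (spaceDir p l)) ∘ φ) w := by
      filter_upwards [h1] with w hw
      rw [hw, ContinuousLinearMap.comp_apply, hφ, fderiv_chart_space, map_smul, smul_eq_mul]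
      rfl
    have h3 := contDiffAt_two_differentiableAt_fderiv hu (spaceDir p l)
    rw [h2.fderiv_eq, fderiv_const_mul (h3.comp z (hφd z)), fderiv_comp z h3 (hφd z)]
    simp only [_root_.smul_apply, ContinuousLinearMap.comp_apply]
    rw [hφ, fderiv_chart_space, map_smul, smul_eq_mul, smul_eq_mul]
    ring
  -- Differentiating the transported centre in time gives a first-order term; it supplies the part
  -- of the drift at the image point that comes from `z₀` (see `hdr2`).
  have htime : timeDeriv (u ∘ φ) z = r ^ 2 * (timeDeriv u (φ z) -
      ∑ k, flow B (r ^ 2 * z.2) z₀.1 k * (B *ᵥ grad u (φ z)) k) := by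
    simp only [timeDeriv, h1.self_of_nhds, ContinuousLinearMap.comp_apply]
    rw [hφ, fderiv_chart_time, map_smul, smul_eq_mul]
    congr 1
    set y := flow B (r ^ 2 * z.2) z₀.1
    have : ((drift B y, 1) : Pt p) = (drift B y, 0) + (0, 1) := by simp
    rw [this, map_add, fderiv_space_eq_sum, add_comm, sub_eq_add_neg]
    congr 1
    simp only [drift_apply, Matrix.mulVec, dotProduct, grad, Finset.mul_sum, Finset.sum_mul,
      neg_mul, Finset.sum_neg_distrib]
    rw [Finset.sum_comm]
    congr 1
    refine Finset.sum_congr rfl fun l _ => Finset.sum_congr rfl fun k _ => ?_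
    ring
  -- Only the upper left block of `A` contributes, and there both derivatives scale by `r`.
  have htr : (A (φ z) * hess (u ∘ φ) z).trace = r ^ 2 * (A (φ z) * hess u (φ z)).trace := by
    simp only [Matrix.trace, Matrix.diag_apply, Matrix.mul_apply, Finset.mul_sum]
    refine Finset.sum_congr rfl fun k _ => Finset.sum_congr rfl fun l _ => ?_
    by_cases h : k.1 ≠ 0 ∨ l.1 ≠ 0
    · rw [hA k l h]; ring
    · push Not at h
      rw [hhess, h.1, h.2]
      simp only [Fin.val_zero]
      ring
  have hdr : (fun k => z.1 k) ⬝ᵥ (B *ᵥ grad (u ∘ φ) z) =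
      r ^ 2 * ∑ k, r ^ (2 * (k.1 : ℕ) + 1) * z.1 k * (B *ᵥ grad u (φ z)) k := by
    simp only [dotProduct, Matrix.mulVec, Finset.mul_sum]
    refine Finset.sum_congr rfl fun k _ => Finset.sum_congr rfl fun l _ => ?_
    by_cases h : (k.1 : ℕ) + 1 = l.1
    · rw [hgrad, ← h]; ring
    · rw [hB.off_block k l h]; ring
  have hdr2 : (fun k => (φ z).1 k) ⬝ᵥ (B *ᵥ grad u (φ z)) =
      ∑ k, r ^ (2 * (k.1 : ℕ) + 1) * z.1 k * (B *ᵥ grad u (φ z)) k +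
      ∑ k, flow B (r ^ 2 * z.2) z₀.1 k * (B *ᵥ grad u (φ z)) k := by
    rw [← Finset.sum_add_distrib]
    refine Finset.sum_congr rfl fun k _ => ?_
    have : (φ z).1 k = r ^ (2 * (k.1 : ℕ) + 1) * z.1 k + flow B (r ^ 2 * z.2) z₀.1 k := by
      simp [hφ, chart, gmul]
    simp only [this]; ring
  simp only [opL, Function.comp_apply]
  rw [htr, hdr, htime, hdr2]
  ring

/-! ### The maximum principle -/

/-- A negative second derivative would make the point a local maximum as well; the function would
then be locally constant, with second derivative zero. -/
theorem deriv_deriv_nonneg_of_isLocalMin {f : ℝ → ℝ} {a : ℝ} (hf : IsLocalMin f a)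
    (hc : ContinuousAt f a) : 0 ≤ deriv (deriv f) a := by
  by_contra! h
  have h1 := isLocalMax_of_deriv_deriv_neg h hf.deriv_eq_zero hc
  have h2 : f =ᶠ[𝓝 a] fun _ => f a := by
    filter_upwards [hf, h1] with x hx1 hx2
    exact le_antisymm hx2 hx1
  have h3 : deriv f =ᶠ[𝓝 a] fun _ => 0 := by
    filter_upwards [h2.deriv] with x hx
    rw [hx]; simp
  rw [h3.deriv_eq] at h
  simp at h

/-- At a minimum over earlier times, the operator is nonnegative. -/
theorem opL_nonneg_of_isLocalMinOn {B : Matrix (Idx p) (Idx p) ℝ}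
    {A : Pt p → Matrix (Idx p) (Idx p) ℝ} {F : Pt p → ℝ} {z : Pt p}
    (hA : (A z).PosSemidef) (hF : ContDiffAt ℝ 2 F z)
    (hmin : IsLocalMinOn F {w | w.2 ≤ z.2} z) : 0 ≤ opL B A F z := by
  have hd := (contDiffAt_two_differentiableAt hF).hasFDerivAt
  -- Directions not pointing into the future stay in the half-space, so the first-order condition
  -- applies. Spatial directions are allowed with both signs, time with one only.
  have hdir : ∀ v : Pt p, v.2 ≤ 0 → 0 ≤ fderiv ℝ F z v := by
    intro v hv
    refine hmin.hasFDerivWithinAt_nonneg hd.hasFDerivWithinAt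
      (mem_posTangentConeAt_of_segment_subset ?_)
    rintro w ⟨a, c, ha, hc, hac, rfl⟩
    change a * z.2 + c * (z.2 + v.2) ≤ z.2
    have : a * z.2 + c * (z.2 + v.2) = (a + c) * z.2 + c * v.2 := by ring
    rw [this, hac]
    nlinarith
  have hgrad : grad F z = 0 := by
    funext k
    refine le_antisymm ?_ (hdir _ (le_refl _))
    have := hdir (-spaceDir p k) (by simp [spaceDir])
    rw [map_neg] at this
    exact neg_nonneg.1 this
  have htime : timeDeriv F z ≤ 0 := by
    have := hdir (-((0 : Space p), (1 : ℝ))) (by simp)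
    rw [map_neg] at this
    exact neg_nonneg.1 this
  have hhess : ∀ v : Idx p → ℝ, 0 ≤ v ⬝ᵥ hess F z *ᵥ v := by
    intro v
    set V : Pt p := (WithLp.toLp 2 v, 0) with hV
    have hline : Continuous fun s : ℝ => z + s • V := by fun_prop
    have hz0 : z + (0 : ℝ) • V = z := by simp
    have hloc : IsLocalMin (fun s : ℝ => F (z + s • V)) 0 := by
      have h1 : Tendsto (fun s : ℝ => z + s • V) (𝓝 0) (𝓝[{w | w.2 ≤ z.2}] z) := by
        refine tendsto_nhdsWithin_iff.2 ⟨?_, Eventually.of_forall fun s => ?_⟩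
        · have := hline.tendsto 0
          rwa [hz0] at this
        · simp [hV]
      have h2 := h1.eventually hmin
      simpa [IsLocalMin, IsMinFilter] using h2
    have hder : ∀ᶠ s in 𝓝 (0 : ℝ),
        deriv (fun s : ℝ => F (z + s • V)) s = fderiv ℝ F (z + s • V) V := by
      have h1 := hline.continuousAt (x := 0)
      have h2 : ∀ᶠ w in 𝓝 (z + (0 : ℝ) • V), DifferentiableAt ℝ F w := by
        rw [hz0]; exact contDiffAt_two_eventually_differentiableAt hF
      filter_upwards [h1.eventually h2] with s hs
      have h3 : HasDerivAt (fun s : ℝ => z + s • V) V s := by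
        simpa using ((hasDerivAt_id s).smul_const V).const_add z
      exact (hs.hasFDerivAt.comp_hasDerivAt s h3).deriv
    have hder2 : deriv (deriv fun s : ℝ => F (z + s • V)) 0 =
        fderiv ℝ (fun w => fderiv ℝ F w V) z V := by
      have h0 : deriv (fun s : ℝ => F (z + s • V)) =ᶠ[𝓝 0]
        fun s => fderiv ℝ F (z + s • V) V := hder
      rw [h0.deriv_eq]
      have h3 : HasDerivAt (fun s : ℝ => z + s • V) V 0 := by
        simpa using ((hasDerivAt_id (0 : ℝ)).smul_const V).const_add z
      have h4 : HasFDerivAt (fun w => fderiv ℝ F w V) (fderiv ℝ (fun w => fderiv ℝ F w V) z)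
          (z + (0 : ℝ) • V) := by
        rw [hz0]; exact (contDiffAt_two_differentiableAt_fderiv hF V).hasFDerivAt
      exact (h4.comp_hasDerivAt (0 : ℝ) h3).deriv
    have hnn : 0 ≤ fderiv ℝ (fun w => fderiv ℝ F w V) z V := by
      rw [← hder2]
      refine deriv_deriv_nonneg_of_isLocalMin hloc ?_
      refine ContinuousAt.comp ?_ hline.continuousAt
      rw [hz0]; exact hF.continuousAt
    have hsum : fderiv ℝ (fun w => fderiv ℝ F w V) z V = v ⬝ᵥ hess F z *ᵥ v := by
      have e : (fun w => fderiv ℝ F w V) =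
          fun w => ∑ l, v l * fderiv ℝ F w (spaceDir p l) := by
        funext w; exact fderiv_space_eq_sum _ _
      rw [e, fderiv_fun_sum fun l _ =>
        (contDiffAt_two_differentiableAt_fderiv hF (spaceDir p l)).const_mul (v l)]
      rw [hV, fderiv_space_eq_sum]
      simp only [dotProduct, Matrix.mulVec, hess, Matrix.of_apply]
      refine Finset.sum_congr rfl fun k _ => ?_
      rw [_root_.sum_apply]
      congr 1
      refine Finset.sum_congr rfl fun l _ => ?_
      rw [fderiv_const_mul (contDiffAt_two_differentiableAt_fderiv hF (spaceDir p l))]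
      simp only [_root_.smul_apply, smul_eq_mul]
      ring
    rwa [hsum] at hnn
  have htr := trace_mul_nonneg_of_posSemidef hA hhess
  simp only [opL, hgrad, Matrix.mulVec_zero, dotProduct_zero]
  linarith

/-! ### The covariance matrix of the constant coefficient operator -/

/-- A constant symmetric coefficient matrix supported in the upper left block, with ellipticity
constants `lam` and `Lam` there. -/
structure IsModelMatrix (p : Fin (n + 1) → ℕ) (lam Lam : ℝ) (A : Matrix (Idx p) (Idx p) ℝ) :
    Prop where
  symm : A.IsSymm
  off_block : ∀ k l : Idx p, (k.1 ≠ 0 ∨ l.1 ≠ 0) → A k l = 0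
  lower : ∀ v : Idx p → ℝ, lam * ∑ a, v ⟨0, a⟩ ^ 2 ≤ v ⬝ᵥ A *ᵥ v
  upper : ∀ v : Idx p → ℝ, v ⬝ᵥ A *ᵥ v ≤ Lam * ∑ a, v ⟨0, a⟩ ^ 2

/-- The coefficients `∫₀¹ (-s)^{i+j} / (i! j!) ds`. -/
def covCoeff (i j : ℕ) : ℝ :=
  (-1) ^ (i + j) / (i.factorial * j.factorial * ((i : ℝ) + j + 1))

/-- The matrix `∫₀¹ E(s) A E(s)ᵀ ds`, written out. -/
def cov (B A : Matrix (Idx p) (Idx p) ℝ) : Matrix (Idx p) (Idx p) ℝ :=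
  Matrix.of fun k l => covCoeff k.1 l.1 * (Bᵀ ^ (k.1 : ℕ) * A * B ^ (l.1 : ℕ)) k l

theorem covCoeff_succ_zero (i : ℕ) :
    ((i : ℝ) + 2) * covCoeff (i + 1) 0 + covCoeff i 0 = 0 := by
  have h1 : ((i.factorial : ℕ) : ℝ) ≠ 0 := by positivity
  have h2 : (i : ℝ) + 1 ≠ 0 := by positivity
  have h3 : (i : ℝ) + 1 + 1 ≠ 0 := by positivity
  simp only [covCoeff, Nat.factorial_succ, Nat.factorial_zero]
  push_cast
  simp only [add_zero, mul_one, pow_succ]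
  field_simp
  ring

theorem covCoeff_comm (i j : ℕ) : covCoeff i j = covCoeff j i := by
  simp only [covCoeff]
  rw [add_comm i j, mul_comm (i.factorial : ℝ), add_comm (i : ℝ)]

/-- With f_{i,j}(s) = (-s)^{i+j}/(i! j!) one has f_{i+1,j+1}' = -(f_{i,j+1} + f_{i+1,j}). The
identity is the integral of this over [0, 1], the first term being the boundary value at 1. -/
theorem covCoeff_succ_succ (i j : ℕ) :
    ((i : ℝ) + j + 3) * covCoeff (i + 1) (j + 1) + covCoeff i (j + 1) + covCoeff (i + 1) j = 0 := by
  have h1 : ((i.factorial : ℕ) : ℝ) ≠ 0 := by positivity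
  have h1' : ((j.factorial : ℕ) : ℝ) ≠ 0 := by positivity
  have h2 : (i : ℝ) + 1 ≠ 0 := by positivity
  have h2' : (j : ℝ) + 1 ≠ 0 := by positivity
  have h3 : (i : ℝ) + j + 2 ≠ 0 := by positivity
  have h4 : (i : ℝ) + j + 3 ≠ 0 := by positivity
  have e1 : ((i + 1 : ℕ) : ℝ) + ((j + 1 : ℕ) : ℝ) + 1 = i + j + 3 := by push_cast; ring
  have e2 : (i : ℝ) + ((j + 1 : ℕ) : ℝ) + 1 = i + j + 2 := by push_cast; ring
  have e3 : ((i + 1 : ℕ) : ℝ) + (j : ℝ) + 1 = i + j + 2 := by push_cast; ring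
  simp only [covCoeff, Nat.factorial_succ, e1, e2, e3]
  push_cast
  have s1 : (-1 : ℝ) ^ (i + 1 + (j + 1)) = (-1) ^ (i + j) := by ring
  have s2 : (-1 : ℝ) ^ (i + (j + 1)) = -(-1) ^ (i + j) := by ring
  have s3 : (-1 : ℝ) ^ (i + 1 + j) = -(-1) ^ (i + j) := by ring
  rw [s1, s2, s3]
  field_simp
  ring

/-- Multiplication by `Bᵀ` raises the row block by one while the scalar coefficient keeps the old
index, so block `0` receives nothing. -/
theorem transpose_mul_cov_apply {B : Matrix (Idx p) (Idx p) ℝ} (hB : IsDriftMatrix p B)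
    (A : Matrix (Idx p) (Idx p) ℝ) (k l : Idx p) :
    (Bᵀ * cov B A) k l = if (k.1 : ℕ) = 0 then 0 else
      covCoeff ((k.1 : ℕ) - 1) l.1 * (Bᵀ ^ (k.1 : ℕ) * A * B ^ (l.1 : ℕ)) k l := by
  rw [Matrix.mul_apply]
  split_ifs with h
  · refine Finset.sum_eq_zero fun m _ => ?_
    rw [Matrix.transpose_apply, hB.off_block m k (by omega), zero_mul]
  · obtain ⟨i, hi⟩ := Nat.exists_eq_succ_of_ne_zero h
    rw [hi, Nat.succ_eq_add_one, Nat.add_sub_cancel, pow_succ', Matrix.mul_assoc, Matrix.mul_assoc,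
      Matrix.mul_apply, Finset.mul_sum]
    refine Finset.sum_congr rfl fun m _ => ?_
    by_cases hm : (m.1 : ℕ) + 1 = k.1
    · have hm' : (m.1 : ℕ) = i := by omega
      simp only [cov, Matrix.of_apply, hm', Matrix.mul_assoc]
      ring
    · rw [Matrix.transpose_apply, hB.off_block m k hm, zero_mul, zero_mul, mul_zero]

theorem cov_transpose {B A : Matrix (Idx p) (Idx p) ℝ} (hA : A.IsSymm) :
    (cov B A)ᵀ = cov B A := by
  ext k l
  simp only [cov, Matrix.transpose_apply, Matrix.of_apply]
  rw [covCoeff_comm]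
  congr 1
  have : (Bᵀ ^ (l.1 : ℕ) * A * B ^ (k.1 : ℕ))ᵀ = Bᵀ ^ (k.1 : ℕ) * A * B ^ (l.1 : ℕ) := by
    rw [Matrix.transpose_mul, Matrix.transpose_mul, Matrix.transpose_pow, Matrix.transpose_pow,
      Matrix.transpose_transpose, hA.eq, Matrix.mul_assoc]
  rw [← this, Matrix.transpose_apply]

theorem cov_mul_apply {B : Matrix (Idx p) (Idx p) ℝ} (hB : IsDriftMatrix p B)
    {A : Matrix (Idx p) (Idx p) ℝ} (hA : A.IsSymm) (k l : Idx p) :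
    (cov B A * B) k l = if (l.1 : ℕ) = 0 then 0 else
      covCoeff k.1 ((l.1 : ℕ) - 1) * (Bᵀ ^ (k.1 : ℕ) * A * B ^ (l.1 : ℕ)) k l := by
  have h1 : (cov B A * B) k l = (Bᵀ * cov B A) l k := by
    rw [← Matrix.transpose_apply (cov B A * B), Matrix.transpose_mul, cov_transpose hA]
  rw [h1, transpose_mul_cov_apply hB, covCoeff_comm]
  congr 2
  have : (Bᵀ ^ (l.1 : ℕ) * A * B ^ (k.1 : ℕ))ᵀ = Bᵀ ^ (k.1 : ℕ) * A * B ^ (l.1 : ℕ) := by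
    rw [Matrix.transpose_mul, Matrix.transpose_mul, Matrix.transpose_pow, Matrix.transpose_pow,
      Matrix.transpose_transpose, hA.eq, Matrix.mul_assoc]
  rw [← this, Matrix.transpose_apply]

/-- The Lyapunov equation of the covariance matrix. -/
theorem lyapunov {B : Matrix (Idx p) (Idx p) ℝ} (hB : IsDriftMatrix p B) {lam Lam : ℝ}
    {A : Matrix (Idx p) (Idx p) ℝ} (hA : IsModelMatrix p lam Lam A) (k l : Idx p) :
    ((k.1 : ℕ) + (l.1 : ℕ) + 1 : ℝ) * cov B A k l + (Bᵀ * cov B A) k l + (cov B A * B) k l =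
      A k l := by
  rw [transpose_mul_cov_apply hB, cov_mul_apply hB hA.symm]
  simp only [cov, Matrix.of_apply]
  have hoff : (k.1 : ℕ) ≠ 0 ∨ (l.1 : ℕ) ≠ 0 → A k l = 0 := fun h =>
    hA.off_block k l (h.imp (fun h h' => h (by rw [h']; rfl)) (fun h h' => h (by rw [h']; rfl)))
  generalize hi : (k.1 : ℕ) = i at *
  generalize hj : (l.1 : ℕ) = j at *
  rcases i with _ | i <;> rcases j with _ | j
  · simp [covCoeff]
  · rw [hoff (by simp)]
    have := covCoeff_succ_zero j
    rw [covCoeff_comm, covCoeff_comm j] at this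
    simp only [Nat.add_sub_cancel, if_true, Nat.add_eq_zero_iff, one_ne_zero, and_false, if_false]
    push_cast
    linear_combination this * (Bᵀ ^ 0 * A * B ^ (j + 1)) k l
  · rw [hoff (by simp)]
    have := covCoeff_succ_zero i
    simp only [Nat.add_sub_cancel, if_true, Nat.add_eq_zero_iff, one_ne_zero, and_false, if_false]
    push_cast
    linear_combination this * (Bᵀ ^ (i + 1) * A * B ^ 0) k l
  · rw [hoff (by simp)]
    have := covCoeff_succ_succ i j
    simp only [Nat.add_sub_cancel, Nat.add_eq_zero_iff, one_ne_zero, and_false, if_false]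
    push_cast
    linear_combination this * (Bᵀ ^ (i + 1) * A * B ^ (j + 1)) k l

/-- The vector `E(s)ᵀ x`, restricted to the entries that interact with the upper left block. -/
def covFlow (B : Matrix (Idx p) (Idx p) ℝ) (x : Idx p → ℝ) (s : ℝ) : Idx p → ℝ :=
  fun a => ∑ l : Idx p, (-s) ^ (l.1 : ℕ) / (l.1 : ℕ).factorial * (B ^ (l.1 : ℕ)) a l * x l

theorem continuous_covFlow (B : Matrix (Idx p) (Idx p) ℝ) (x : Idx p → ℝ) (a : Idx p) :
    Continuous fun s => covFlow B x s a := by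
  unfold covFlow
  fun_prop

/-- The entrywise formula for `cov` serves the Lyapunov equation; positivity and the comparison with
the ellipticity constants need this integral form. -/
theorem dotProduct_cov_mulVec (B A : Matrix (Idx p) (Idx p) ℝ) (x : Idx p → ℝ) :
    x ⬝ᵥ cov B A *ᵥ x = ∫ s in (0 : ℝ)..1, covFlow B x s ⬝ᵥ A *ᵥ covFlow B x s := by
  have h1 : ∀ s : ℝ, covFlow B x s ⬝ᵥ A *ᵥ covFlow B x s = ∑ k : Idx p, ∑ l : Idx p,
      s ^ ((k.1 : ℕ) + (l.1 : ℕ)) * ((-1) ^ ((k.1 : ℕ) + (l.1 : ℕ)) /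
        ((k.1 : ℕ).factorial * (l.1 : ℕ).factorial) *
        (Bᵀ ^ (k.1 : ℕ) * A * B ^ (l.1 : ℕ)) k l * x k * x l) := by
    intro s
    have e1 : covFlow B x s ⬝ᵥ A *ᵥ covFlow B x s =
        ∑ a, ∑ b, ∑ k : Idx p, ∑ l : Idx p, ((-s) ^ (k.1 : ℕ) / (k.1 : ℕ).factorial *
          (B ^ (k.1 : ℕ)) a k * x k) * (A a b * ((-s) ^ (l.1 : ℕ) / (l.1 : ℕ).factorial *
          (B ^ (l.1 : ℕ)) b l * x l)) := by
      simp only [dotProduct, Matrix.mulVec, covFlow, Finset.mul_sum, Finset.sum_mul]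
      refine Finset.sum_congr rfl fun a _ => Finset.sum_congr rfl fun b _ => ?_
      rw [Finset.sum_comm]
    have e2 : ∀ k l : Idx p, (Bᵀ ^ (k.1 : ℕ) * A * B ^ (l.1 : ℕ)) k l =
        ∑ a, ∑ b, (B ^ (k.1 : ℕ)) a k * A a b * (B ^ (l.1 : ℕ)) b l := by
      intro k l
      simp only [Matrix.mul_apply, Finset.sum_mul, ← Matrix.transpose_pow, Matrix.transpose_apply]
      rw [Finset.sum_comm]
    rw [e1]
    simp only [e2, Finset.mul_sum, Finset.sum_mul]
    have e3 : ∀ f : Idx p → Idx p → Idx p → Idx p → ℝ,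
        ∑ a, ∑ b, ∑ k, ∑ l, f a b k l = ∑ k, ∑ l, ∑ a, ∑ b, f a b k l := by
      intro f
      calc ∑ a, ∑ b, ∑ k, ∑ l, f a b k l = ∑ a, ∑ k, ∑ l, ∑ b, f a b k l := by
            refine Finset.sum_congr rfl fun a _ => ?_
            rw [Finset.sum_comm]
            refine Finset.sum_congr rfl fun k _ => ?_
            rw [Finset.sum_comm]
        _ = _ := by
            rw [Finset.sum_comm]
            refine Finset.sum_congr rfl fun k _ => ?_
            rw [Finset.sum_comm]
    rw [e3]
    refine Finset.sum_congr rfl fun k _ => Finset.sum_congr rfl fun l _ =>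
      Finset.sum_congr rfl fun a _ => Finset.sum_congr rfl fun b _ => ?_
    have h1 : (-s) ^ (k.1 : ℕ) = (-1) ^ (k.1 : ℕ) * s ^ (k.1 : ℕ) := by rw [← mul_pow]; simp
    have h2 : (-s) ^ (l.1 : ℕ) = (-1) ^ (l.1 : ℕ) * s ^ (l.1 : ℕ) := by rw [← mul_pow]; simp
    rw [h1, h2, pow_add, pow_add]
    field_simp
  simp only [h1]
  rw [intervalIntegral.integral_finsetSum fun k _ =>
    (Continuous.intervalIntegrable (by fun_prop) _ _)]
  simp only [dotProduct, Matrix.mulVec, Finset.mul_sum]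
  refine Finset.sum_congr rfl fun k _ => ?_
  rw [intervalIntegral.integral_finsetSum fun l _ =>
    (Continuous.intervalIntegrable (by fun_prop) _ _)]
  refine Finset.sum_congr rfl fun l _ => ?_
  rw [intervalIntegral.integral_mul_const, integral_pow]
  simp only [cov, Matrix.of_apply, covCoeff]
  push_cast
  have : ((k.1 : ℕ) : ℝ) + ((l.1 : ℕ) : ℝ) + 1 ≠ 0 := by positivity
  simp only [one_pow, ne_eq, Nat.add_eq_zero_iff, one_ne_zero, and_false, not_false_eq_true,
    zero_pow, sub_zero]
  field_simp

/-- `∫₀¹ |(E(s)ᵀ x)^{(p₀)}|² ds`. -/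
def covForm (B : Matrix (Idx p) (Idx p) ℝ) (x : Idx p → ℝ) : ℝ :=
  ∫ s in (0 : ℝ)..1, ∑ a : Fin (p 0), covFlow B x s ⟨0, a⟩ ^ 2

theorem IsModelMatrix.cov_bounds {B : Matrix (Idx p) (Idx p) ℝ} {lam Lam : ℝ}
    {A : Matrix (Idx p) (Idx p) ℝ} (hA : IsModelMatrix p lam Lam A) (x : Idx p → ℝ) :
    lam * covForm B x ≤ x ⬝ᵥ cov B A *ᵥ x ∧ x ⬝ᵥ cov B A *ᵥ x ≤ Lam * covForm B x := by
  have hc := continuous_covFlow B x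
  have h1 : Continuous fun s => ∑ a : Fin (p 0), covFlow B x s ⟨0, a⟩ ^ 2 :=
    continuous_finsetSum _ fun a _ => (hc _).pow 2
  have h2 : Continuous fun s => covFlow B x s ⬝ᵥ A *ᵥ covFlow B x s := by
    simp only [dotProduct, Matrix.mulVec]
    exact continuous_finsetSum _ fun a _ => (hc _).mul
      (continuous_finsetSum _ fun b _ => continuous_const.mul (hc _))
  rw [dotProduct_cov_mulVec, covForm, ← intervalIntegral.integral_const_mul,
    ← intervalIntegral.integral_const_mul]
  constructor
  · exact intervalIntegral.integral_mono_on zero_le_one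
      ((continuous_const.mul h1).intervalIntegrable _ _) (h2.intervalIntegrable _ _)
      fun s _ => hA.lower _
  · exact intervalIntegral.integral_mono_on zero_le_one (h2.intervalIntegrable _ _)
      ((continuous_const.mul h1).intervalIntegrable _ _) fun s _ => hA.upper _

theorem drift_pow_apply_eq_zero {B : Matrix (Idx p) (Idx p) ℝ} (hB : IsDriftMatrix p B) (m : ℕ)
    (k l : Idx p) (h : (k.1 : ℕ) + m ≠ l.1) : (B ^ m) k l = 0 := by
  induction m generalizing k with
  | zero =>
    rw [pow_zero, Matrix.one_apply_ne]
    rintro rfl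
    simp at h
  | succ m ih =>
    rw [pow_succ', Matrix.mul_apply]
    refine Finset.sum_eq_zero fun a _ => ?_
    by_cases ha : (k.1 : ℕ) + 1 = a.1
    · rw [ih a (by omega), mul_zero]
    · rw [hB.off_block k a ha, zero_mul]

theorem IsDriftMatrix.block_injective {B : Matrix (Idx p) (Idx p) ℝ} (hB : IsDriftMatrix p B)
    (j : Fin n) (y : Fin (p j.succ) → ℝ)
    (h : (B.submatrix (fun a : Fin (p j.castSucc) => (⟨j.castSucc, a⟩ : Idx p))
      (fun c : Fin (p j.succ) => (⟨j.succ, c⟩ : Idx p))) *ᵥ y = 0) : y = 0 := by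
  set T := B.submatrix (fun a : Fin (p j.castSucc) => (⟨j.castSucc, a⟩ : Idx p))
      (fun c : Fin (p j.succ) => (⟨j.succ, c⟩ : Idx p))
  have h1 := LinearMap.finrank_range_add_finrank_ker T.mulVecLin
  have h2 : Module.finrank ℝ (LinearMap.range T.mulVecLin) = p j.succ := hB.block_rank j
  rw [h2, Module.finrank_fin_fun, Nat.add_eq_left, Submodule.finrank_eq_zero] at h1
  have h3 : y ∈ LinearMap.ker T.mulVecLin := h
  rw [h1] at h3
  exact h3

/-- The Kalman rank condition. Block `j` of `B ^ (m + 1) x` is 𝔹_{j+1} applied to block `j + 1` of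
`B ^ m x`, and 𝔹_{j+1} is injective; hence the vanishing propagates from block to block. -/
theorem eq_zero_of_top_pow_mulVec {B : Matrix (Idx p) (Idx p) ℝ} (hB : IsDriftMatrix p B)
    (x : Idx p → ℝ) (h : ∀ (m : ℕ) (a : Fin (p 0)), (B ^ m *ᵥ x) ⟨0, a⟩ = 0) : x = 0 := by
  have key : ∀ (i : Fin (n + 1)) (m : ℕ) (a : Fin (p i)), (B ^ m *ᵥ x) ⟨i, a⟩ = 0 := by
    intro i
    induction i using Fin.induction with
    | zero => exact h
    | succ j ih =>
      intro m
      have h1 := hB.block_injective j (fun c => (B ^ m *ᵥ x) ⟨j.succ, c⟩) (by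
        funext a
        have h2 := ih (m + 1) a
        rw [pow_succ', ← Matrix.mulVec_mulVec, Matrix.mulVec, dotProduct, Fintype.sum_sigma,
          Finset.sum_eq_single j.succ] at h2
        · exact h2
        · intro i _ hi
          refine Finset.sum_eq_zero fun c _ => ?_
          have h3 : ((j.castSucc : Fin (n + 1)) : ℕ) + 1 ≠ (i : ℕ) := fun h3 =>
            hi (Fin.ext (by simpa using h3.symm))
          rw [hB.off_block _ _ h3, zero_mul]
        · simp)
      exact fun a => congrFun h1 a
  funext k
  simpa using key k.1 0 k.2

theorem covForm_nonneg (B : Matrix (Idx p) (Idx p) ℝ) (x : Idx p → ℝ) : 0 ≤ covForm B x :=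
  intervalIntegral.integral_nonneg zero_le_one fun _ _ =>
    Finset.sum_nonneg fun _ _ => sq_nonneg _

/-- If the integral vanishes, so does its continuous integrand. Its entries are polynomials in `s`
whose coefficients are, up to nonzero factors, the entries of the top blocks of `B ^ m x`. -/
theorem covForm_pos {B : Matrix (Idx p) (Idx p) ℝ} (hB : IsDriftMatrix p B) {x : Idx p → ℝ}
    (hx : x ≠ 0) : 0 < covForm B x := by
  have hc : Continuous fun s => ∑ a : Fin (p 0), covFlow B x s ⟨0, a⟩ ^ 2 :=
    continuous_finsetSum _ fun a _ => (continuous_covFlow B x _).pow 2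
  refine (covForm_nonneg B x).lt_of_ne fun h0 => hx ?_
  have hzero : ∀ s ∈ Icc (0 : ℝ) 1, ∀ a : Fin (p 0), covFlow B x s ⟨0, a⟩ = 0 := by
    intro s hs a
    by_contra hne
    refine h0.not_lt ?_
    refine intervalIntegral.integral_pos zero_lt_one hc.continuousOn
      (fun s _ => Finset.sum_nonneg fun _ _ => sq_nonneg _) ⟨s, hs, ?_⟩
    exact Finset.sum_pos' (fun _ _ => sq_nonneg _) ⟨a, Finset.mem_univ _, by positivity⟩
  refine eq_zero_of_top_pow_mulVec hB x fun m a => ?_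
  set P : Polynomial ℝ := ∑ l : Idx p, Polynomial.monomial (l.1 : ℕ)
    ((-1) ^ (l.1 : ℕ) / (l.1 : ℕ).factorial * (B ^ (l.1 : ℕ)) ⟨0, a⟩ l * x l) with hP
  have hPeval : ∀ s, P.eval s = covFlow B x s ⟨0, a⟩ := by
    intro s
    rw [hP, Polynomial.eval_finsetSum, covFlow]
    refine Finset.sum_congr rfl fun l _ => ?_
    have h2 : (-s) ^ (l.1 : ℕ) = (-1) ^ (l.1 : ℕ) * s ^ (l.1 : ℕ) := by rw [← mul_pow]; simp
    rw [Polynomial.eval_monomial, h2]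
    ring
  have hP0 : P = 0 := by
    refine Polynomial.eq_zero_of_infinite_isRoot P ((Icc_infinite (zero_lt_one' ℝ)).mono ?_)
    intro s hs
    change P.eval s = 0
    rw [hPeval, hzero s hs a]
  have hcoeff : P.coeff m = (-1) ^ m / m.factorial * (B ^ m *ᵥ x) ⟨0, a⟩ := by
    rw [hP, Polynomial.finsetSum_coeff, Matrix.mulVec, dotProduct, Finset.mul_sum]
    refine Finset.sum_congr rfl fun l _ => ?_
    rw [Polynomial.coeff_monomial]
    split_ifs with hl
    · rw [hl]; ring
    · rw [drift_pow_apply_eq_zero hB m _ l (by simpa using Ne.symm hl)]; ring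
  rw [hP0, Polynomial.coeff_zero] at hcoeff
  have h4 : ((-1 : ℝ) ^ m / m.factorial) ≠ 0 :=
    div_ne_zero (pow_ne_zero _ (by norm_num)) (by positivity)
  exact (mul_eq_zero.1 hcoeff.symm).resolve_left h4

/-- The covariance form is comparable to the Euclidean one. -/
theorem exists_covForm_bounds {B : Matrix (Idx p) (Idx p) ℝ} (hB : IsDriftMatrix p B) :
    ∃ c C : ℝ, 0 < c ∧ 0 < C ∧ ∀ x : Space p,
      c * ‖x‖ ^ 2 ≤ covForm B x ∧ covForm B x ≤ C * ‖x‖ ^ 2 := by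
  -- `covForm` is the covariance form for the identity in the upper block, hence continuous and
  -- homogeneous of degree two, and the unit sphere decides.
  set T : Matrix (Idx p) (Idx p) ℝ := Matrix.diagonal fun k => if k.1 = 0 then 1 else 0 with hT
  have hform : ∀ x : Idx p → ℝ, covForm B x = x ⬝ᵥ cov B T *ᵥ x := by
    intro x
    rw [dotProduct_cov_mulVec, covForm]
    congr 1
    funext s
    rw [dotProduct, Fintype.sum_sigma, Finset.sum_eq_single (0 : Fin (n + 1))]
    · refine Finset.sum_congr rfl fun a _ => ?_
      rw [hT, Matrix.mulVec_diagonal]; simp [sq]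
    · intro i _ hi
      refine Finset.sum_eq_zero fun a _ => ?_
      rw [hT, Matrix.mulVec_diagonal]; simp [hi]
    · simp
  have hcont : Continuous fun x : Space p => covForm B x := by
    simp only [hform, dotProduct, Matrix.mulVec]
    fun_prop
  have hhom : ∀ (a : ℝ) (x : Space p), covForm B (a • x) = a ^ 2 * covForm B x := by
    intro a x
    rw [hform, hform, Matrix.mulVec_smul, dotProduct_smul, smul_dotProduct]
    simp only [smul_eq_mul]; ring
  have hscale : ∀ x : Space p, x ≠ 0 →
      covForm B x = ‖x‖ ^ 2 * covForm B (‖x‖⁻¹ • x : Space p) := by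
    intro x hx
    have := hhom ‖x‖⁻¹ x
    rw [← WithLp.ofLp_smul] at this
    rw [this]
    field_simp [norm_ne_zero_iff.2 hx]
  have hsph : ∀ x : Space p, x ≠ 0 → ‖x‖⁻¹ • x ∈ Metric.sphere (0 : Space p) 1 := by
    intro x hx
    rw [mem_sphere_zero_iff_norm, norm_smul, norm_inv, norm_norm,
      inv_mul_cancel₀ (norm_ne_zero_iff.2 hx)]
  have hzero : covForm B (0 : Space p) = 0 := by
    rw [hform]; simp
  rcases (Metric.sphere (0 : Space p) 1).eq_empty_or_nonempty with he | hne
  · have h0 : ∀ x : Space p, x = 0 := by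
      intro x
      by_contra hx
      have := hsph x hx
      rw [he] at this
      exact this
    refine ⟨1, 1, one_pos, one_pos, fun x => ?_⟩
    rw [h0 x, hzero]; simp
  · obtain ⟨y, hy, hmin⟩ := (isCompact_sphere (0 : Space p) 1).exists_isMinOn hne hcont.continuousOn
    obtain ⟨C, hC⟩ := (isCompact_sphere (0 : Space p) 1).bddAbove_image hcont.continuousOn
    have hy0 : y.ofLp ≠ 0 := by
      intro h
      have : y = 0 := by ext k; exact congrFun h k
      rw [this] at hy; simp at hy
    refine ⟨covForm B y, max C 1, covForm_pos hB hy0, by positivity, fun x => ?_⟩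
    by_cases hx : x = 0
    · rw [hx, hzero]; simp
    · rw [hscale x hx, mul_comm, mul_comm (max C 1)]
      exact ⟨mul_le_mul_of_nonneg_left (hmin (hsph x hx)) (by positivity),
        mul_le_mul_of_nonneg_left ((hC ⟨_, hsph x hx, rfl⟩).trans (le_max_left _ _))
          (by positivity)⟩

/-! ### Inverses of positive matrices -/

theorem isUnit_det_of_form_bound {ι : Type*} [Fintype ι] [DecidableEq ι] {P : Matrix ι ι ℝ}
    {α : ℝ} (hα : 0 < α) (h : ∀ x : ι → ℝ, α * (x ⬝ᵥ x) ≤ x ⬝ᵥ P *ᵥ x) : IsUnit P.det := by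
  rw [isUnit_iff_ne_zero]
  intro hdet
  obtain ⟨v, hv, hv2⟩ := Matrix.exists_mulVec_eq_zero_iff.2 hdet
  have h1 := h v
  rw [hv2, dotProduct_zero] at h1
  have h2 : 0 ≤ v ⬝ᵥ v := Finset.sum_nonneg fun i _ => mul_self_nonneg (v i)
  exact hv (dotProduct_self_eq_zero.1 (le_antisymm (by nlinarith) h2))

theorem dotProduct_mulVec_comm_of_isSymm {ι : Type*} [Fintype ι] {P : Matrix ι ι ℝ}
    (hP : P.IsSymm) (x y : ι → ℝ) : x ⬝ᵥ P *ᵥ y = y ⬝ᵥ P *ᵥ x := by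
  rw [Matrix.dotProduct_mulVec, ← Matrix.mulVec_transpose, hP.eq, dotProduct_comm]

/-- Let `x = P⁻¹ y`. The lower bound is the nonnegativity of the form of `P` at `x - β⁻¹ y`. The
upper bound is that of `|y - α x|²`, combined with the lower bound for `P` at `x`. -/
theorem inv_form_bounds {ι : Type*} [Fintype ι] [DecidableEq ι] {P : Matrix ι ι ℝ}
    (hP : P.IsSymm) {α β : ℝ} (hα : 0 < α) (hβ : 0 < β)
    (h1 : ∀ x : ι → ℝ, α * (x ⬝ᵥ x) ≤ x ⬝ᵥ P *ᵥ x)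
    (h2 : ∀ x : ι → ℝ, x ⬝ᵥ P *ᵥ x ≤ β * (x ⬝ᵥ x)) (y : ι → ℝ) :
    β⁻¹ * (y ⬝ᵥ y) ≤ y ⬝ᵥ P⁻¹ *ᵥ y ∧ y ⬝ᵥ P⁻¹ *ᵥ y ≤ α⁻¹ * (y ⬝ᵥ y) := by
  have hu := isUnit_det_of_form_bound hα h1
  set x := P⁻¹ *ᵥ y with hx
  have hPx : P *ᵥ x = y := by
    rw [hx, Matrix.mulVec_mulVec, Matrix.mul_nonsing_inv _ hu, Matrix.one_mulVec]
  have e1 : x ⬝ᵥ P *ᵥ x = y ⬝ᵥ x := by rw [hPx, dotProduct_comm]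
  constructor
  · have h3 : 0 ≤ (x - β⁻¹ • y) ⬝ᵥ P *ᵥ (x - β⁻¹ • y) := by
      refine le_trans ?_ (h1 _)
      exact mul_nonneg hα.le (Finset.sum_nonneg fun i _ => mul_self_nonneg _)
    have h4 : (x - β⁻¹ • y) ⬝ᵥ P *ᵥ (x - β⁻¹ • y) =
        y ⬝ᵥ x - 2 * β⁻¹ * (y ⬝ᵥ y) + β⁻¹ ^ 2 * (y ⬝ᵥ P *ᵥ y) := by
      rw [Matrix.mulVec_sub, Matrix.mulVec_smul, sub_dotProduct, dotProduct_sub, dotProduct_sub,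
        e1, smul_dotProduct, smul_dotProduct, dotProduct_smul, dotProduct_smul, hPx,
        dotProduct_mulVec_comm_of_isSymm hP x y, hPx]
      simp only [smul_eq_mul]; ring
    have h5 := mul_le_mul_of_nonneg_left (h2 y) (sq_nonneg β⁻¹)
    have h6 : β⁻¹ ^ 2 * (β * (y ⬝ᵥ y)) = β⁻¹ * (y ⬝ᵥ y) := by field_simp
    linarith
  · have h3 : 0 ≤ (y - α • x) ⬝ᵥ (y - α • x) := Finset.sum_nonneg fun i _ => mul_self_nonneg _
    have h4 : (y - α • x) ⬝ᵥ (y - α • x) = y ⬝ᵥ y - 2 * α * (y ⬝ᵥ x) + α ^ 2 * (x ⬝ᵥ x) := by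
      rw [sub_dotProduct, dotProduct_sub, dotProduct_sub, smul_dotProduct, smul_dotProduct,
        dotProduct_smul, dotProduct_smul, dotProduct_comm x y]
      simp only [smul_eq_mul]; ring
    have h5 := mul_le_mul_of_nonneg_left (h1 x) hα.le
    rw [e1] at h5
    have h6 : y ⬝ᵥ x = α⁻¹ * (α * (y ⬝ᵥ x)) := by field_simp
    rw [h6]
    refine mul_le_mul_of_nonneg_left ?_ (inv_nonneg.2 hα.le)
    linarith

/-! ### The precision matrix and the barrier -/

/-- The inverse of `∫₀ᵗ E(s) A E(s)ᵀ ds`. -/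
def prec (B A : Matrix (Idx p) (Idx p) ℝ) (t : ℝ) : Matrix (Idx p) (Idx p) ℝ :=
  Matrix.of fun k l => (cov B A)⁻¹ k l * (t ^ ((k.1 : ℕ) + (l.1 : ℕ) + 1))⁻¹

/-- The matrix `∫₀ᵗ E(s) A E(s)ᵀ ds`. -/
def covAt (B A : Matrix (Idx p) (Idx p) ℝ) (t : ℝ) : Matrix (Idx p) (Idx p) ℝ :=
  Matrix.of fun k l => cov B A k l * t ^ ((k.1 : ℕ) + (l.1 : ℕ) + 1)

/-- The diagonal matrix of the homogeneities. -/
def weights (p : Fin (n + 1) → ℕ) : Matrix (Idx p) (Idx p) ℝ :=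
  Matrix.diagonal fun k => 2 * ((k.1 : ℕ) : ℝ) + 1

/-- The quadratic form of the precision matrix at time `t`, evaluated at `x`. -/
def precForm (B A : Matrix (Idx p) (Idx p) ℝ) (z : Pt p) : ℝ :=
  z.1.ofLp ⬝ᵥ prec B A z.2 *ᵥ z.1.ofLp

/-- The first term is C'(t): an entry in block `(i, j)` of C(t) is a multiple of `t ^ (i + j + 1)`,
and `i + j + 1` is half the sum of the two weights. -/
theorem lyapunov_at {B : Matrix (Idx p) (Idx p) ℝ} (hB : IsDriftMatrix p B) {lam Lam : ℝ}
    {A : Matrix (Idx p) (Idx p) ℝ} (hA : IsModelMatrix p lam Lam A) {t : ℝ} (ht : t ≠ 0) :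
    (2 * t)⁻¹ • (weights p * covAt B A t + covAt B A t * weights p) + Bᵀ * covAt B A t +
      covAt B A t * B = A := by
  ext k l
  have h1 : (Bᵀ * covAt B A t) k l = t ^ ((k.1 : ℕ) + (l.1 : ℕ)) * (Bᵀ * cov B A) k l := by
    rw [Matrix.mul_apply, Matrix.mul_apply, Finset.mul_sum]
    refine Finset.sum_congr rfl fun m _ => ?_
    by_cases h : (m.1 : ℕ) + 1 = k.1
    · rw [covAt, Matrix.of_apply, ← h]; ring
    · rw [Matrix.transpose_apply, hB.off_block m k h]; ring
  have h2 : (covAt B A t * B) k l = t ^ ((k.1 : ℕ) + (l.1 : ℕ)) * (cov B A * B) k l := by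
    rw [Matrix.mul_apply, Matrix.mul_apply, Finset.mul_sum]
    refine Finset.sum_congr rfl fun m _ => ?_
    by_cases h : (m.1 : ℕ) + 1 = l.1
    · rw [covAt, Matrix.of_apply, ← h]; ring
    · rw [hB.off_block m l h]; ring
  have h3 : A k l = t ^ ((k.1 : ℕ) + (l.1 : ℕ)) * A k l := by
    by_cases h : k.1 ≠ 0 ∨ l.1 ≠ 0
    · rw [hA.off_block k l h, mul_zero]
    · push Not at h
      rw [h.1, h.2]; simp
  rw [Matrix.add_apply, Matrix.add_apply, h1, h2, Matrix.smul_apply, Matrix.add_apply, weights,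
    Matrix.diagonal_mul, Matrix.mul_diagonal, h3, ← lyapunov hB hA k l, covAt, Matrix.of_apply,
    smul_eq_mul, pow_succ]
  field_simp
  ring

/-- Uniform two-sided bounds for the covariance matrix of a model matrix. -/
structure HasCovBounds (B A : Matrix (Idx p) (Idx p) ℝ) (α β : ℝ) : Prop where
  pos : 0 < α
  pos' : 0 < β
  symm : (cov B A).IsSymm
  lower : ∀ x : Idx p → ℝ, α * (x ⬝ᵥ x) ≤ x ⬝ᵥ cov B A *ᵥ x
  upper : ∀ x : Idx p → ℝ, x ⬝ᵥ cov B A *ᵥ x ≤ β * (x ⬝ᵥ x)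

theorem norm_sq_eq_dotProduct {ι : Type*} [Fintype ι] (x : EuclideanSpace ℝ ι) :
    ‖x‖ ^ 2 = x.ofLp ⬝ᵥ x.ofLp := by
  rw [EuclideanSpace.real_norm_sq_eq, dotProduct]
  exact Finset.sum_congr rfl fun i _ => sq _

/-- `covForm` does not involve `A`, so the ellipticity constants enter only as factors. The
uniformity matters when the coefficients are frozen at varying points. -/
theorem exists_hasCovBounds {B : Matrix (Idx p) (Idx p) ℝ} (hB : IsDriftMatrix p B)
    {lam Lam : ℝ} (hlam : 0 < lam) (hLam : 0 < Lam) :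
    ∃ α β : ℝ, 0 < α ∧ 0 < β ∧ ∀ A, IsModelMatrix p lam Lam A → HasCovBounds B A α β := by
  obtain ⟨c, C, hc, hC, h⟩ := exists_covForm_bounds hB
  refine ⟨lam * c, Lam * C, by positivity, by positivity, fun A hA =>
    ⟨by positivity, by positivity, cov_transpose hA.symm, fun x => ?_, fun x => ?_⟩⟩
  · have h1 := (h (WithLp.toLp 2 x)).1
    rw [norm_sq_eq_dotProduct] at h1
    rw [mul_assoc]
    exact (mul_le_mul_of_nonneg_left h1 hlam.le).trans (hA.cov_bounds x).1
  · have h1 := (h (WithLp.toLp 2 x)).2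
    rw [norm_sq_eq_dotProduct] at h1
    rw [mul_assoc]
    exact (hA.cov_bounds x).2.trans (mul_le_mul_of_nonneg_left h1 hLam.le)

section

variable {B A : Matrix (Idx p) (Idx p) ℝ} {α β : ℝ}

theorem HasCovBounds.isUnit (h : HasCovBounds B A α β) : IsUnit (cov B A).det :=
  isUnit_det_of_form_bound h.pos h.lower

theorem HasCovBounds.prec_symm (h : HasCovBounds B A α β) (t : ℝ) : (prec B A t).IsSymm := by
  have h1 : (cov B A)⁻¹.IsSymm := by
    rw [Matrix.IsSymm, Matrix.transpose_nonsing_inv, h.symm.eq]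
  ext k l
  simp only [prec, Matrix.transpose_apply, Matrix.of_apply]
  rw [h1.apply k l, add_comm (l.1 : ℕ)]

theorem HasCovBounds.prec_mul_covAt (h : HasCovBounds B A α β) {t : ℝ} (ht : t ≠ 0) :
    prec B A t * covAt B A t = 1 := by
  have h1 := Matrix.nonsing_inv_mul _ h.isUnit
  ext k l
  have h2 : (prec B A t * covAt B A t) k l =
      (t ^ ((k.1 : ℕ)))⁻¹ * t ^ (l.1 : ℕ) * ((cov B A)⁻¹ * cov B A) k l := by
    rw [Matrix.mul_apply, Matrix.mul_apply, Finset.mul_sum]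
    refine Finset.sum_congr rfl fun m _ => ?_
    simp only [prec, covAt, Matrix.of_apply, pow_add, pow_one]
    field_simp
  rw [h2, h1]
  by_cases hkl : k = l
  · subst hkl
    rw [Matrix.one_apply_eq]
    field_simp
  · rw [Matrix.one_apply_ne hkl, mul_zero]

theorem HasCovBounds.covAt_mul_prec (h : HasCovBounds B A α β) {t : ℝ} (ht : t ≠ 0) :
    covAt B A t * prec B A t = 1 :=
  mul_eq_one_comm.1 (h.prec_mul_covAt ht)

theorem precForm_eq (z : Pt p) (ht : 0 < z.2) :
    precForm B A z = (dil p (√z.2)⁻¹ z.1).ofLp ⬝ᵥ (cov B A)⁻¹ *ᵥ (dil p (√z.2)⁻¹ z.1).ofLp := by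
  simp only [precForm, dotProduct, Matrix.mulVec, Finset.mul_sum, prec, Matrix.of_apply, dil_apply]
  refine Finset.sum_congr rfl fun k _ => Finset.sum_congr rfl fun l _ => ?_
  have h1 : z.2 ^ ((k.1 : ℕ) + (l.1 : ℕ) + 1) =
      √z.2 ^ (2 * (k.1 : ℕ) + 1) * √z.2 ^ (2 * (l.1 : ℕ) + 1) := by
    conv_lhs => rw [← Real.sq_sqrt ht.le]
    ring
  rw [h1, mul_inv, inv_pow, inv_pow]
  ring

theorem HasCovBounds.precForm_bounds (h : HasCovBounds B A α β) (z : Pt p) (ht : 0 < z.2) :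
    β⁻¹ * ‖dil p (√z.2)⁻¹ z.1‖ ^ 2 ≤ precForm B A z ∧
      precForm B A z ≤ α⁻¹ * ‖dil p (√z.2)⁻¹ z.1‖ ^ 2 := by
  rw [precForm_eq z ht, norm_sq_eq_dotProduct]
  exact inv_form_bounds h.symm h.pos h.pos' h.lower h.upper _

theorem HasCovBounds.precForm_nonneg (h : HasCovBounds B A α β) (z : Pt p) (ht : 0 < z.2) :
    0 ≤ precForm B A z :=
  le_trans (mul_nonneg (inv_nonneg.2 h.pos'.le) (sq_nonneg _)) (h.precForm_bounds z ht).1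

/-- The Lyapunov equation multiplied by C(t)⁻¹ on both sides. It links the squared gradient of the
Gaussian exponent to the time derivative and the drift of that exponent. -/
theorem HasCovBounds.prec_mul_mul_prec {lam Lam : ℝ} (h : HasCovBounds B A α β)
    (hB : IsDriftMatrix p B) (hA : IsModelMatrix p lam Lam A) {t : ℝ} (ht : t ≠ 0) :
    prec B A t * A * prec B A t = (2 * t)⁻¹ • (prec B A t * weights p + weights p * prec B A t) +
      prec B A t * Bᵀ + B * prec B A t := by
  have h1 := h.prec_mul_covAt ht
  have h2 := h.covAt_mul_prec ht
  have h3 := lyapunov_at hB hA ht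
  generalize prec B A t = M at *
  generalize covAt B A t = C at *
  conv_lhs => rw [← h3]
  have e1 : M * (weights p * C) * M = M * weights p := by
    rw [Matrix.mul_assoc, Matrix.mul_assoc, h2, Matrix.mul_one]
  have e2 : M * (C * weights p) * M = weights p * M := by
    rw [← Matrix.mul_assoc, h1, Matrix.one_mul]
  have e3 : M * (Bᵀ * C) * M = M * Bᵀ := by
    rw [Matrix.mul_assoc, Matrix.mul_assoc, h2, Matrix.mul_one]
  have e4 : M * (C * B) * M = B * M := by
    rw [← Matrix.mul_assoc, h1, Matrix.one_mul]
  rw [Matrix.mul_add, Matrix.mul_add, Matrix.add_mul, Matrix.add_mul, e3, e4, Matrix.mul_smul,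
    Matrix.smul_mul, Matrix.mul_add, Matrix.add_mul, e1, e2]

theorem trace_weights : (weights p).trace = hdim p := by
  rw [weights, Matrix.trace_diagonal, Fintype.sum_sigma, hdim]
  push_cast
  refine Finset.sum_congr rfl fun i _ => ?_
  rw [Finset.sum_const, Finset.card_univ, Fintype.card_fin, nsmul_eq_mul, mul_comm]

/-- Multiply the Lyapunov equation by C(t)⁻¹ and take traces: the drift terms give twice the trace
of `B`, which is zero, and the weights have trace `Q`. -/
theorem HasCovBounds.trace_mul_prec {lam Lam : ℝ} (h : HasCovBounds B A α β)
    (hB : IsDriftMatrix p B) (hA : IsModelMatrix p lam Lam A) {t : ℝ} (ht : t ≠ 0) :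
    (A * prec B A t).trace = hdim p / t := by
  have hBtr : B.trace = 0 :=
    Finset.sum_eq_zero fun k _ => hB.off_block k k (by omega)
  have h1 := h.prec_mul_covAt ht
  have h2 := h.covAt_mul_prec ht
  have h3 := lyapunov_at hB hA ht
  generalize prec B A t = M at *
  generalize covAt B A t = C at *
  rw [← h3, Matrix.add_mul, Matrix.add_mul, Matrix.trace_add, Matrix.trace_add, Matrix.smul_mul,
    Matrix.trace_smul, Matrix.add_mul, Matrix.trace_add, Matrix.mul_assoc, h2, Matrix.mul_one,
    Matrix.mul_assoc Bᵀ, h2, Matrix.mul_one, Matrix.trace_transpose, hBtr,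
    Matrix.trace_mul_comm, ← Matrix.mul_assoc, h1, Matrix.one_mul,
    Matrix.trace_mul_comm, ← Matrix.mul_assoc, h1, Matrix.one_mul, hBtr, trace_weights,
    smul_eq_mul]
  field_simp
  ring

end

/-- The barrier `t^{-s} exp (-⟨C(t)⁻¹ x, x⟩ / 4)`, extended by zero to `t ≤ 0`. -/
def barrier (B A : Matrix (Idx p) (Idx p) ℝ) (s : ℝ) (z : Pt p) : ℝ :=
  if 0 < z.2 then z.2 ^ (-s) * Real.exp (-precForm B A z / 4) else 0

section

variable {B A : Matrix (Idx p) (Idx p) ℝ} {α β : ℝ} {s : ℝ}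

theorem barrier_of_pos {z : Pt p} (ht : 0 < z.2) :
    barrier B A s z = z.2 ^ (-s) * Real.exp (-precForm B A z / 4) := if_pos ht

theorem barrier_of_nonpos {z : Pt p} (ht : z.2 ≤ 0) : barrier B A s z = 0 := if_neg ht.not_gt

theorem barrier_pos {z : Pt p} (ht : 0 < z.2) : 0 < barrier B A s z := by
  rw [barrier_of_pos ht]
  exact mul_pos (Real.rpow_pos_of_pos ht _) (Real.exp_pos _)

theorem barrier_nonneg (z : Pt p) : 0 ≤ barrier B A s z := by
  rcases lt_or_ge 0 z.2 with h | h
  · exact (barrier_pos h).le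
  · rw [barrier_of_nonpos h]

theorem contDiffAt_precForm {m : WithTop ℕ∞} {z : Pt p} (ht : 0 < z.2) :
    ContDiffAt ℝ m (precForm B A) z := by
  unfold precForm
  simp only [dotProduct, Matrix.mulVec, prec, Matrix.of_apply]
  have h0 : ∀ k, ContDiffAt ℝ m (fun w : Pt p => w.1.ofLp k) z := by
    intro k
    fun_prop
  refine ContDiffAt.sum fun k _ => (h0 k).mul (ContDiffAt.sum fun l _ =>
    (contDiffAt_const.mul (ContDiffAt.inv (contDiffAt_snd.pow _) ?_)).mul (h0 l))
  positivity

theorem barrier_eventuallyEq {z : Pt p} (ht : 0 < z.2) :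
    barrier B A s =ᶠ[𝓝 z] fun w => w.2 ^ (-s) * Real.exp (-precForm B A w / 4) := by
  filter_upwards [(isOpen_lt continuous_const continuous_snd).mem_nhds ht] with w hw
  exact barrier_of_pos hw

theorem contDiffAt_barrier {m : WithTop ℕ∞} {z : Pt p} (ht : 0 < z.2) :
    ContDiffAt ℝ m (barrier B A s) z := by
  refine ContDiffAt.congr_of_eventuallyEq ?_ (barrier_eventuallyEq ht)
  exact (contDiffAt_snd.rpow_const_of_ne ht.ne').mul
    (((contDiffAt_precForm ht).neg.div_const 4).exp)

/-- `C(t)⁻¹ x`. -/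
def precVec (B A : Matrix (Idx p) (Idx p) ℝ) (z : Pt p) : Idx p → ℝ :=
  prec B A z.2 *ᵥ z.1.ofLp

theorem precVec_line (z : Pt p) (k l : Idx p) (a : ℝ) :
    precVec B A (z + a • spaceDir p k) l = precVec B A z l + a * prec B A z.2 l k := by
  have h1 : (z + a • spaceDir p k).1.ofLp = z.1.ofLp + a • Pi.single k 1 := by
    funext j; simp [spaceDir, Pi.single_apply]
  have h2 : (z + a • spaceDir p k).2 = z.2 := by simp [spaceDir]
  rw [precVec, h1, h2, Matrix.mulVec_add, Matrix.mulVec_smul, Matrix.mulVec_single_one]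
  simp [precVec]

theorem HasCovBounds.precForm_line (h : HasCovBounds B A α β) (z : Pt p) (k : Idx p) (a : ℝ) :
    precForm B A (z + a • spaceDir p k) =
      precForm B A z + 2 * a * precVec B A z k + a ^ 2 * prec B A z.2 k k := by
  have h1 : (z + a • spaceDir p k).1.ofLp = z.1.ofLp + a • Pi.single k 1 := by
    funext j; simp [spaceDir, Pi.single_apply]
  have h2 : (z + a • spaceDir p k).2 = z.2 := by simp [spaceDir]
  rw [precForm, h1, h2, Matrix.mulVec_add, add_dotProduct, dotProduct_add, dotProduct_add,
    Matrix.mulVec_smul, dotProduct_smul, smul_dotProduct, smul_dotProduct, dotProduct_smul,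
    dotProduct_mulVec_comm_of_isSymm (h.prec_symm z.2) z.1.ofLp, Matrix.mulVec_single_one,
    single_one_dotProduct, single_one_dotProduct]
  have h3 : z.1.ofLp ⬝ᵥ (prec B A z.2).col k = (prec B A z.2 *ᵥ z.1.ofLp) k := by
    rw [Matrix.mulVec, dotProduct_comm]
    exact Finset.sum_congr rfl fun l _ => by
      rw [Matrix.col_apply, (h.prec_symm z.2).apply]
  simp only [smul_eq_mul, precForm, precVec, h3, Matrix.col_apply]
  ring

theorem hasDerivAt_line {f : Pt p → ℝ} {z : Pt p} (hf : DifferentiableAt ℝ f z) (v : Pt p) :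
    HasDerivAt (fun a : ℝ => f (z + a • v)) (fderiv ℝ f z v) 0 :=
  hf.hasFDerivAt.hasLineDerivAt v

theorem HasCovBounds.hasDerivAt_barrier_line (h : HasCovBounds B A α β) {z : Pt p} (ht : 0 < z.2)
    (k : Idx p) :
    HasDerivAt (fun a : ℝ => barrier B A s (z + a • spaceDir p k))
      (-(1 / 2) * barrier B A s z * precVec B A z k) 0 := by
  have e : (fun a : ℝ => barrier B A s (z + a • spaceDir p k)) = fun a : ℝ =>
      z.2 ^ (-s) * Real.exp (-(precForm B A z + 2 * a * precVec B A z k +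
        a ^ 2 * prec B A z.2 k k) / 4) := by
    funext a
    have h2 : (z + a • spaceDir p k).2 = z.2 := by simp [spaceDir]
    rw [barrier_of_pos (by rw [h2]; exact ht), h.precForm_line, h2]
  rw [e, barrier_of_pos ht]
  have h1 : HasDerivAt (fun a : ℝ => precForm B A z + 2 * a * precVec B A z k +
        a ^ 2 * prec B A z.2 k k) (2 * precVec B A z k) 0 := by
    have := (((hasDerivAt_id (0 : ℝ)).const_mul 2).mul_const (precVec B A z k)).const_add
      (precForm B A z)
    have h3 := this.add (((hasDerivAt_id (0 : ℝ)).pow 2).mul_const (prec B A z.2 k k))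
    exact h3.congr_deriv (by simp)
  have h2 := ((h1.neg.div_const 4).exp).const_mul (z.2 ^ (-s))
  refine h2.congr_deriv ?_
  simp
  ring

theorem HasCovBounds.grad_barrier (h : HasCovBounds B A α β) {z : Pt p} (ht : 0 < z.2)
    (k : Idx p) :
    fderiv ℝ (barrier B A s) z (spaceDir p k) = -(1 / 2) * barrier B A s z * precVec B A z k :=
  (hasDerivAt_line ((contDiffAt_barrier (m := 1) ht).differentiableAt one_ne_zero) _).unique
    (h.hasDerivAt_barrier_line ht k)

theorem HasCovBounds.hess_barrier (h : HasCovBounds B A α β) {z : Pt p} (ht : 0 < z.2)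
    (k l : Idx p) :
    hess (barrier B A s) z k l = barrier B A s z *
      (1 / 4 * precVec B A z k * precVec B A z l - 1 / 2 * prec B A z.2 k l) := by
  have e : (fun w => fderiv ℝ (barrier B A s) w (spaceDir p l)) =ᶠ[𝓝 z]
      fun w => -(1 / 2) * barrier B A s w * precVec B A w l := by
    filter_upwards [(isOpen_lt continuous_const continuous_snd).mem_nhds ht] with w hw
    exact h.grad_barrier hw l
  have hd := contDiffAt_two_differentiableAt_fderiv
    (contDiffAt_barrier (B := B) (A := A) (s := s) (m := 2) ht) (spaceDir p l)
  rw [hess, Matrix.of_apply, e.fderiv_eq]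
  have h1 := hasDerivAt_line (hd.congr_of_eventuallyEq e.symm) (spaceDir p k)
  have h2 : HasDerivAt (fun a : ℝ => precVec B A (z + a • spaceDir p k) l) (prec B A z.2 l k)
      0 := by
    simp only [precVec_line]
    simpa using ((hasDerivAt_id (0 : ℝ)).mul_const (prec B A z.2 l k)).const_add
      (precVec B A z l)
  have h3 := ((h.hasDerivAt_barrier_line (s := s) ht k).const_mul (-(1 / 2))).mul h2
  have h4 := h1.unique h3
  rw [h4, (h.prec_symm z.2).apply]
  simp only [zero_smul, add_zero]
  ring

theorem timeDeriv_barrier {z : Pt p} (ht : 0 < z.2) :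
    timeDeriv (barrier B A s) z = barrier B A s z * (-s / z.2 + (4 * z.2)⁻¹ *
      ∑ k : Idx p, ∑ l : Idx p, ((k.1 : ℕ) + (l.1 : ℕ) + 1 : ℝ) *
        (z.1 k * prec B A z.2 k l * z.1 l)) := by
  have h1 := hasDerivAt_line ((contDiffAt_barrier (B := B) (A := A) (s := s) (m := 1)
    ht).differentiableAt one_ne_zero) ((0 : Space p), (1 : ℝ))
  have h2 : HasDerivAt (fun a : ℝ => z.2 + a) 1 0 := by
    simpa using (hasDerivAt_id (0 : ℝ)).const_add z.2
  have hq : HasDerivAt (fun a : ℝ => precForm B A (z + a • ((0 : Space p), (1 : ℝ))))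
      (-(z.2)⁻¹ * ∑ k : Idx p, ∑ l : Idx p, ((k.1 : ℕ) + (l.1 : ℕ) + 1 : ℝ) *
        (z.1 k * prec B A z.2 k l * z.1 l)) 0 := by
    have e : (fun a : ℝ => precForm B A (z + a • ((0 : Space p), (1 : ℝ)))) = fun a : ℝ =>
        ∑ k : Idx p, ∑ l : Idx p, z.1 k * (cov B A)⁻¹ k l * z.1 l *
          ((z.2 + a) ^ ((k.1 : ℕ) + (l.1 : ℕ) + 1))⁻¹ := by
      funext a
      simp only [precForm, dotProduct, Matrix.mulVec, Finset.mul_sum, prec, Matrix.of_apply]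
      refine Finset.sum_congr rfl fun k _ => Finset.sum_congr rfl fun l _ => ?_
      simp
      ring
    rw [e, Finset.mul_sum]
    refine HasDerivAt.fun_sum fun k _ => ?_
    rw [Finset.mul_sum]
    refine HasDerivAt.fun_sum fun l _ => ?_
    have h3 := ((h2.pow ((k.1 : ℕ) + (l.1 : ℕ) + 1)).inv (by simp; positivity)).const_mul
      (z.1 k * (cov B A)⁻¹ k l * z.1 l)
    refine h3.congr_deriv ?_
    simp only [prec, Matrix.of_apply, Pi.pow_apply, add_zero, Nat.add_sub_cancel, mul_one]
    push_cast
    field_simp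
    ring
  have hb : HasDerivAt (fun a : ℝ => barrier B A s (z + a • ((0 : Space p), (1 : ℝ))))
      (barrier B A s z * (-s / z.2 + (4 * z.2)⁻¹ *
      ∑ k : Idx p, ∑ l : Idx p, ((k.1 : ℕ) + (l.1 : ℕ) + 1 : ℝ) *
        (z.1 k * prec B A z.2 k l * z.1 l))) 0 := by
    have e : (fun a : ℝ => barrier B A s (z + a • ((0 : Space p), (1 : ℝ)))) =ᶠ[𝓝 0]
        fun a : ℝ => (z.2 + a) ^ (-s) *
          Real.exp (-precForm B A (z + a • ((0 : Space p), (1 : ℝ))) / 4) := by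
      have hc : ContinuousAt (fun a : ℝ => z.2 + a) 0 := by fun_prop
      filter_upwards [hc.eventually (lt_mem_nhds (show 0 < z.2 + 0 by simpa using ht))] with a ha
      have h5 : (z + a • ((0 : Space p), (1 : ℝ))).2 = z.2 + a := by simp
      rw [barrier_of_pos (by rw [h5]; exact ha), h5]
    refine HasDerivAt.congr_of_eventuallyEq ?_ e
    have h3 := (h2.rpow_const (p := -s) (Or.inl (by simpa using ht.ne'))).mul
      (hq.neg.div_const 4).exp
    refine h3.congr_deriv ?_
    rw [barrier_of_pos ht]
    simp only [Pi.neg_apply, add_zero, zero_smul, Real.rpow_sub_one ht.ne']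
    field_simp
  exact h1.unique hb

/-- The barrier is a strict subsolution of every operator whose coefficients are pinched between
`A` and `μ A`, provided `s > μ Q / 2`. -/
theorem HasCovBounds.opL_barrier_pos {lam Lam μ : ℝ} (h : HasCovBounds B A α β)
    (hB : IsDriftMatrix p B) (hA : IsModelMatrix p lam Lam A) (hs : μ * hdim p / 2 < s)
    {a : Pt p → Matrix (Idx p) (Idx p) ℝ} {z : Pt p} (ht : 0 < z.2)
    (ha1 : (a z - A).PosSemidef) (ha2 : (μ • A - a z).PosSemidef) :
    0 < opL B a (barrier B A s) z := by
  set M := prec B A z.2 with hM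
  set m := precVec B A z with hm
  set g := barrier B A s z with hg
  set x := z.1.ofLp with hx
  have htr : (a z * hess (barrier B A s) z).trace =
      g * (1 / 4 * (m ⬝ᵥ a z *ᵥ m) - 1 / 2 * (a z * M).trace) := by
    have e : hess (barrier B A s) z =
        g • ((1 / 4 : ℝ) • Matrix.vecMulVec m m - (1 / 2 : ℝ) • M) := by
      ext k l
      rw [h.hess_barrier ht]
      simp only [Matrix.smul_apply, Matrix.sub_apply, Matrix.vecMulVec_apply, smul_eq_mul, hg, hm,
        hM]
      ring
    rw [e, Matrix.mul_smul, Matrix.trace_smul, Matrix.mul_sub, Matrix.trace_sub, Matrix.mul_smul,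
      Matrix.mul_smul, Matrix.trace_smul, Matrix.trace_smul, Matrix.mul_vecMulVec,
      Matrix.trace_vecMulVec, dotProduct_comm]
    simp only [smul_eq_mul]
  have hgrad : grad (barrier B A s) z = (-(1 / 2) * g) • m := by
    funext k; exact h.grad_barrier ht k
  have hsum : ∑ k : Idx p, ∑ l : Idx p, ((k.1 : ℕ) + (l.1 : ℕ) + 1 : ℝ) *
      (z.1 k * M k l * z.1 l) = 1 / 2 * (x ⬝ᵥ (M * weights p + weights p * M) *ᵥ x) := by
    simp only [dotProduct, Matrix.mulVec, Finset.mul_sum, weights, Matrix.add_apply,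
      Matrix.diagonal_mul, Matrix.mul_diagonal]
    refine Finset.sum_congr rfl fun k _ => Finset.sum_congr rfl fun l _ => ?_
    ring
  have hid : m ⬝ᵥ A *ᵥ m =
      (2 * z.2)⁻¹ * (x ⬝ᵥ (M * weights p + weights p * M) *ᵥ x) + 2 * (x ⬝ᵥ B *ᵥ m) := by
    have h1 := h.prec_mul_mul_prec hB hA ht.ne'
    rw [← hM] at h1
    have hMs : M.IsSymm := h.prec_symm z.2
    have h2 : m ⬝ᵥ A *ᵥ m = x ⬝ᵥ (M * A * M) *ᵥ x := by
      rw [← Matrix.mulVec_mulVec, ← Matrix.mulVec_mulVec,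
        dotProduct_mulVec_comm_of_isSymm hMs, dotProduct_comm]
      rfl
    have h3 : x ⬝ᵥ (M * Bᵀ) *ᵥ x = x ⬝ᵥ B *ᵥ m := by
      rw [← Matrix.mulVec_mulVec, dotProduct_mulVec_comm_of_isSymm hMs, Matrix.mulVec_transpose,
        ← Matrix.dotProduct_mulVec]
      rfl
    have h4 : x ⬝ᵥ (B * M) *ᵥ x = x ⬝ᵥ B *ᵥ m := by
      rw [← Matrix.mulVec_mulVec]; rfl
    rw [h2, h1, Matrix.add_mulVec, Matrix.add_mulVec, dotProduct_add, dotProduct_add, h3, h4,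
      Matrix.smul_mulVec, dotProduct_smul, smul_eq_mul]
    ring
  -- By `hid` the drift and the time derivative of the exponent absorb the part of the quadratic
  -- term belonging to `A`. The remainder vanishes for `a = A` and `s = Q / 2`, the fundamental
  -- solution.
  have hmain : opL B a (barrier B A s) z = g * (1 / 4 * (m ⬝ᵥ (a z - A) *ᵥ m) +
      (s / z.2 - 1 / 2 * (a z * M).trace)) := by
    have h5 : (fun k => z.1 k) ⬝ᵥ (B *ᵥ grad (barrier B A s) z) =
        -(1 / 2) * g * (x ⬝ᵥ B *ᵥ m) := by
      rw [hgrad, Matrix.mulVec_smul, dotProduct_smul, smul_eq_mul]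
    rw [opL, htr, h5, timeDeriv_barrier ht, hsum, Matrix.sub_mulVec, dotProduct_sub, hid]
    field_simp
    ring
  have htrace : (a z * M).trace ≤ μ * (hdim p / z.2) := by
    have hform : ∀ v : Idx p → ℝ, 0 ≤ v ⬝ᵥ M *ᵥ v := fun v =>
      h.precForm_nonneg (WithLp.toLp 2 v, z.2) ht
    have := trace_mul_nonneg_of_posSemidef ha2 hform
    rw [Matrix.sub_mul, Matrix.trace_sub, Matrix.smul_mul, Matrix.trace_smul,
      h.trace_mul_prec hB hA ht.ne', smul_eq_mul] at this
    linarith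
  have hpsd : 0 ≤ m ⬝ᵥ (a z - A) *ᵥ m := by
    simpa using ha1.dotProduct_mulVec_nonneg m
  rw [hmain]
  refine mul_pos (barrier_pos ht) ?_
  have h6 : 1 / 2 * (μ * (hdim p / z.2)) < s / z.2 := by
    have : 1 / 2 * (μ * (hdim p / z.2)) = (μ * hdim p / 2) / z.2 := by ring
    rw [this]
    exact div_lt_div_of_pos_right hs ht
  linarith

end

/-! ### Estimates for the barrier -/

theorem inv_sqrt_pow_sq {T : ℝ} (hT : 0 < T) (i : ℕ) : ((√T)⁻¹ ^ i) ^ 2 = T⁻¹ ^ i := by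
  rw [← pow_mul, mul_comm, pow_mul, inv_pow, Real.sq_sqrt hT.le]

/-- For `T ≤ 1` the weakest dilation factor is that of block `0`; the strongest, that of block `n`,
gives the next lemma. -/
theorem norm_sq_le_mul_norm_dil_sq {T : ℝ} (hT : 0 < T) (hT1 : T ≤ 1) (y : Space p) :
    ‖y‖ ^ 2 ≤ T * ‖dil p (√T)⁻¹ y‖ ^ 2 := by
  rw [EuclideanSpace.real_norm_sq_eq, EuclideanSpace.real_norm_sq_eq, Finset.mul_sum]
  refine Finset.sum_le_sum fun k _ => ?_
  rw [dil_apply, mul_pow, inv_sqrt_pow_sq hT, pow_succ T⁻¹, ← mul_assoc]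
  have h1 : 1 ≤ T⁻¹ ^ (2 * (k.1 : ℕ)) := one_le_pow₀ ((one_le_inv₀ hT).2 hT1)
  have h2 : T * (T⁻¹ ^ (2 * (k.1 : ℕ)) * T⁻¹) = T⁻¹ ^ (2 * (k.1 : ℕ)) := by field_simp
  rw [h2]
  exact le_mul_of_one_le_left (sq_nonneg _) h1

theorem norm_dil_sq_le {T : ℝ} (hT : 0 < T) (hT1 : T ≤ 1) (y : Space p) :
    ‖dil p (√T)⁻¹ y‖ ^ 2 ≤ T⁻¹ ^ (2 * n + 1) * ‖y‖ ^ 2 := by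
  rw [EuclideanSpace.real_norm_sq_eq, EuclideanSpace.real_norm_sq_eq, Finset.mul_sum]
  refine Finset.sum_le_sum fun k _ => ?_
  rw [dil_apply, mul_pow, inv_sqrt_pow_sq hT]
  refine mul_le_mul_of_nonneg_right ?_ (sq_nonneg _)
  exact pow_le_pow_right₀ ((one_le_inv₀ hT).2 hT1) (by omega)

theorem exp_neg_le_factorial_div {u : ℝ} (hu : 0 < u) (N : ℕ) :
    Real.exp (-u) ≤ N.factorial / u ^ N := by
  rw [Real.exp_neg, inv_le_comm₀ (Real.exp_pos _) (by positivity), inv_div]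
  exact Real.pow_div_factorial_le_exp u hu.le N

section

variable {B A : Matrix (Idx p) (Idx p) ℝ} {α β : ℝ} {s : ℝ}

theorem HasCovBounds.barrier_le_exp (h : HasCovBounds B A α β) {z : Pt p} (ht : 0 < z.2) :
    barrier B A s z ≤ z.2 ^ (-s) * Real.exp (-(β⁻¹ / 4 * ‖dil p (√z.2)⁻¹ z.1‖ ^ 2)) := by
  rw [barrier_of_pos ht]
  refine mul_le_mul_of_nonneg_left (Real.exp_le_exp.2 ?_) (Real.rpow_nonneg ht.le _)
  linarith [(h.precForm_bounds z ht).1]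

/-- The Gaussian absorbs the singular power through exp(-u) ≤ N!/u^N with `u` proportional to
|x|²/t. Since `N ≥ s + 1`, a factor `t` is left over, which gives continuity at `t = 0` away from
the pole. -/
theorem HasCovBounds.barrier_le (h : HasCovBounds B A α β) {N : ℕ} (hN : s + 1 ≤ N) {z : Pt p}
    (ht : 0 < z.2) (ht1 : z.2 ≤ 1) (hz : z.1 ≠ 0) :
    barrier B A s z ≤ N.factorial * z.2 / (β⁻¹ / 4 * ‖z.1‖ ^ 2) ^ N := by
  have hβ := h.pos'
  have hn : 0 < ‖z.1‖ := norm_pos_iff.2 hz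
  set c := β⁻¹ / 4 * ‖z.1‖ ^ 2 with hc
  have hc0 : 0 < c := by positivity
  have h1 : z.2 ^ (-s) ≤ z.2 * (z.2 ^ N)⁻¹ := by
    calc z.2 ^ (-s) ≤ z.2 ^ (1 - (N : ℝ)) :=
          Real.rpow_le_rpow_of_exponent_ge ht ht1 (by linarith)
      _ = z.2 * (z.2 ^ N)⁻¹ := by
          rw [Real.rpow_sub ht, Real.rpow_one, Real.rpow_natCast, div_eq_mul_inv]
  have h2 : Real.exp (-(β⁻¹ / 4 * ‖dil p (√z.2)⁻¹ z.1‖ ^ 2)) ≤ N.factorial / (c / z.2) ^ N := by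
    refine le_trans (Real.exp_le_exp.2 (neg_le_neg ?_))
      (exp_neg_le_factorial_div (div_pos hc0 ht) N)
    rw [div_le_iff₀ ht, hc, mul_assoc]
    refine mul_le_mul_of_nonneg_left ?_ (by positivity)
    rw [mul_comm]
    exact norm_sq_le_mul_norm_dil_sq ht ht1 z.1
  calc barrier B A s z ≤ _ := h.barrier_le_exp ht
    _ ≤ (z.2 * (z.2 ^ N)⁻¹) * (N.factorial / (c / z.2) ^ N) := by gcongr
    _ = N.factorial * z.2 / c ^ N := by
      rw [div_pow]
      field_simp

theorem HasCovBounds.le_barrier (h : HasCovBounds B A α β) (hs : 0 ≤ s) {z : Pt p} {T₀ ρ : ℝ}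
    (hT₀ : 0 < T₀) (ht : T₀ ≤ z.2) (ht1 : z.2 ≤ 1) (hz : ‖z.1‖ ≤ ρ) :
    Real.exp (-(α⁻¹ * (T₀⁻¹ ^ (2 * n + 1) * ρ ^ 2) / 4)) ≤ barrier B A s z := by
  have h0 : 0 < z.2 := hT₀.trans_le ht
  have hα := h.pos
  rw [barrier_of_pos h0]
  have h1 : 1 ≤ z.2 ^ (-s) := Real.one_le_rpow_of_pos_of_le_one_of_nonpos h0 ht1 (by linarith)
  refine le_trans (Real.exp_le_exp.2 ?_) (le_mul_of_one_le_left (Real.exp_pos _).le h1)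
  have h2 : precForm B A z ≤ α⁻¹ * (T₀⁻¹ ^ (2 * n + 1) * ρ ^ 2) := by
    refine (h.precForm_bounds z h0).2.trans ?_
    refine mul_le_mul_of_nonneg_left ((norm_dil_sq_le h0 ht1 z.1).trans ?_) (by positivity)
    gcongr
  linarith

theorem HasCovBounds.continuousAt_barrier (h : HasCovBounds B A α β) {z : Pt p} (hz : z ≠ 0) :
    ContinuousAt (barrier B A s) z := by
  rcases lt_trichotomy z.2 0 with ht | ht | ht
  · have : barrier B A s =ᶠ[𝓝 z] fun _ => 0 := by
      filter_upwards [(isOpen_lt continuous_snd continuous_const).mem_nhds ht] with w hw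
      exact barrier_of_nonpos (le_of_lt hw)
    exact continuousAt_const.congr this.symm
  · have hz1 : z.1 ≠ 0 := fun h' => hz (Prod.ext h' ht)
    obtain ⟨N, hN⟩ := exists_nat_ge (s + 1)
    have hβ := h.pos'
    have hn : 0 < ‖z.1‖ := norm_pos_iff.2 hz1
    rw [ContinuousAt, barrier_of_nonpos ht.le]
    have hub : Tendsto (fun w : Pt p => N.factorial * |w.2| / (β⁻¹ / 4 * ‖w.1‖ ^ 2) ^ N) (𝓝 z)
        (𝓝 0) := by
      have hc : ContinuousAt (fun w : Pt p => N.factorial * |w.2| / (β⁻¹ / 4 * ‖w.1‖ ^ 2) ^ N)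
          z := by
        refine ContinuousAt.div (by fun_prop) (by fun_prop) (by positivity)
      have h2 := hc.tendsto
      simpa [ht] using h2
    refine tendsto_of_tendsto_of_tendsto_of_le_of_le' tendsto_const_nhds hub
      (Eventually.of_forall barrier_nonneg) ?_
    have e1 : ∀ᶠ w : Pt p in 𝓝 z, w.2 < 1 :=
      continuous_snd.continuousAt.eventually (gt_mem_nhds (by rw [ht]; exact one_pos))
    have e2 : ∀ᶠ w : Pt p in 𝓝 z, w.1 ≠ 0 := continuous_fst.continuousAt.eventually_ne hz1
    filter_upwards [e1, e2] with w hw1 hw2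
    rcases le_or_gt w.2 0 with hw | hw
    · rw [barrier_of_nonpos hw]; positivity
    · rw [abs_of_pos hw]
      exact h.barrier_le hN hw hw1.le hw2
  · exact (contDiffAt_barrier (m := 0) ht).continuousAt

end

/-! ### The kernel -/

/-- The barrier with pole `ζ`. -/
def kernel (B A : Matrix (Idx p) (Idx p) ℝ) (s : ℝ) (ζ z : Pt p) : ℝ :=
  barrier B A s (z.1 - flow B (z.2 - ζ.2) ζ.1, z.2 - ζ.2)

section

variable {B A : Matrix (Idx p) (Idx p) ℝ} {α β : ℝ} {s : ℝ}

theorem kernel_eq_chart (ζ : Pt p) : kernel B A s ζ = barrier B A s ∘ chart B (ginv B ζ) 1 := by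
  funext z
  simp only [kernel, Function.comp_apply, chart, dil_one, one_pow, one_mul, Prod.mk.eta]
  rw [gmul_ginv]

theorem chart_ginv_snd (ζ z : Pt p) : (chart B (ginv B ζ) 1 z).2 = z.2 - ζ.2 := by
  simp [chart, gmul, ginv]; ring

theorem kernel_nonneg (ζ z : Pt p) : 0 ≤ kernel B A s ζ z := barrier_nonneg _

theorem kernel_eq_zero {ζ z : Pt p} (h : z.2 ≤ ζ.2) : kernel B A s ζ z = 0 :=
  barrier_of_nonpos (sub_nonpos.2 h)

theorem contDiffAt_kernel {ζ z : Pt p} (h : ζ.2 < z.2) : ContDiffAt ℝ 2 (kernel B A s ζ) z := by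
  rw [kernel_eq_chart]
  refine ContDiffAt.comp z (contDiffAt_barrier ?_) (contDiff_chart _ _ _).contDiffAt
  rw [chart_ginv_snd]; linarith

/-- At `z` the operator sees only the value `a z`, so the coefficients may be made constant before
translating the pole to the origin. -/
theorem HasCovBounds.opL_kernel_pos {lam Lam μ : ℝ} (h : HasCovBounds B A α β)
    (hB : IsDriftMatrix p B) (hA : IsModelMatrix p lam Lam A) (hs : μ * hdim p / 2 < s)
    {a : Pt p → Matrix (Idx p) (Idx p) ℝ} {ζ z : Pt p} (ht : ζ.2 < z.2)
    (ha0 : ∀ k l : Idx p, (k.1 ≠ 0 ∨ l.1 ≠ 0) → a z k l = 0)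
    (ha1 : (a z - A).PosSemidef) (ha2 : (μ • A - a z).PosSemidef) :
    0 < opL B a (kernel B A s ζ) z := by
  have ht' : 0 < (chart B (ginv B ζ) 1 z).2 := by rw [chart_ginv_snd]; linarith
  have h1 := opL_comp_chart hB (A := fun _ => a z) (u := barrier B A s) (z₀ := ginv B ζ) (r := 1)
    (z := z) ha0 (contDiffAt_barrier ht')
  rw [one_pow, one_mul, ← kernel_eq_chart] at h1
  have h2 := h.opL_barrier_pos hB hA hs (a := fun _ => a z) ht' ha1 ha2
  rw [← h1] at h2
  exact h2

/-- Continuity jointly in pole and variable, off the diagonal, is what allows the potential to be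
approximated by finite sums. -/
theorem HasCovBounds.continuousAt_kernel (h : HasCovBounds B A α β) {ζ z : Pt p} (hne : ζ ≠ z) :
    ContinuousAt (fun w : Pt p × Pt p => kernel B A s w.1 w.2) (ζ, z) := by
  have hc : Continuous fun w : Pt p × Pt p =>
      ((w.2.1 - flow B (w.2.2 - w.1.2) w.1.1, w.2.2 - w.1.2) : Pt p) := by
    refine Continuous.prodMk ?_ (by fun_prop)
    refine (by fun_prop : Continuous fun w : Pt p × Pt p => w.2.1).sub ?_
    exact (((contDiff_flow B (m := 0)).continuous).comp (by fun_prop)).clm_apply (by fun_prop)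
  unfold kernel
  refine ContinuousAt.comp (f := fun w : Pt p × Pt p =>
      ((w.2.1 - flow B (w.2.2 - w.1.2) w.1.1, w.2.2 - w.1.2) : Pt p)) (g := barrier B A s)
      (h.continuousAt_barrier ?_) hc.continuousAt
  intro h0
  have h2 : z.2 - ζ.2 = 0 := congrArg Prod.snd h0
  have h1 : z.1 - flow B (z.2 - ζ.2) ζ.1 = 0 := congrArg Prod.fst h0
  rw [h2, flow_zero_apply] at h1
  exact hne (Prod.ext (sub_eq_zero.1 h1).symm (sub_eq_zero.1 h2).symm)

/-! ### Total mass of the kernel over its poles -/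

theorem det_dil (r : ℝ) : LinearMap.det (dil p r : Space p →ₗ[ℝ] Space p) = r ^ hdim p := by
  have : (dil p r : Space p →ₗ[ℝ] Space p) =
    Matrix.toLin (EuclideanSpace.basisFun (Idx p) ℝ).toBasis
      (EuclideanSpace.basisFun (Idx p) ℝ).toBasis
      (Matrix.diagonal fun k : Idx p => r ^ (2 * (k.1 : ℕ) + 1)) := by
    rw [← Matrix.toEuclideanLin_eq_toLin_orthonormal]
    rfl
  rw [this, LinearMap.det_toLin, Matrix.det_diagonal, Finset.prod_pow_eq_pow_sum, hdim,
    Fintype.sum_sigma]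
  simp [mul_comm]

theorem lintegral_comp_dil {r : ℝ} (hr : 0 < r) {f : Space p → ℝ≥0∞} (hf : Measurable f) :
    ∫⁻ x, f (dil p r x) = ENNReal.ofReal ((r ^ hdim p)⁻¹) * ∫⁻ x, f x := by
  have hdet : LinearMap.det (dil p r : Space p →ₗ[ℝ] Space p) ≠ 0 := by
    rw [det_dil]; positivity
  have h1 := Measure.map_linearMap_addHaar_eq_smul_addHaar (volume : Measure (Space p)) hdet
  rw [det_dil, abs_of_pos (by positivity)] at h1
  have h2 : ∫⁻ x, f (dil p r x) =
      ∫⁻ x, f x ∂(Measure.map (dil p r : Space p →ₗ[ℝ] Space p) volume) :=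
    (lintegral_map hf (dil p r).continuous.measurable).symm
  rw [h2, h1, lintegral_smul_measure]
  rfl

theorem lintegral_gaussian_lt_top {c : ℝ} (hc : 0 < c) :
    ∫⁻ x : Space p, ENNReal.ofReal (Real.exp (-(c * ‖x‖ ^ 2))) < ∞ := by
  have h1 := GaussianFourier.integrable_cexp_neg_mul_sq_norm_add (V := Space p) (b := (c : ℂ))
    (by simpa using hc) 0 0
  have h2 := h1.norm
  have h3 : (fun x : Space p => ‖Complex.exp (-(c : ℂ) * ‖x‖ ^ 2 + 0 * (inner ℝ 0 x : ℝ))‖) =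
      fun x => Real.exp (-(c * ‖x‖ ^ 2)) := by
    funext x
    rw [Complex.norm_exp]
    congr 1
    have : (-(c : ℂ) * ‖x‖ ^ 2 + 0 * (inner ℝ 0 x : ℝ)) = ((-(c * ‖x‖ ^ 2) : ℝ) : ℂ) := by
      push_cast; ring
    rw [this, Complex.ofReal_re]
  rw [h3] at h2
  exact h2.lintegral_lt_top

theorem setLIntegral_rpow_sub (a t : ℝ) :
    ∫⁻ τ in Ico (t - 1) t, ENNReal.ofReal ((t - τ) ^ a) =
      ∫⁻ T in Ioc (0 : ℝ) 1, ENNReal.ofReal (T ^ a) := by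
  rw [← lintegral_indicator measurableSet_Ico, ← lintegral_indicator measurableSet_Ioc,
    ← lintegral_sub_left_eq_self _ t]
  congr 1
  funext τ
  simp only [indicator, sub_sub_cancel]
  congr 1
  simp only [mem_Ico, mem_Ioc, eq_iff_iff]
  constructor
  · rintro ⟨h1, h2⟩; constructor <;> linarith
  · rintro ⟨h1, h2⟩; constructor <;> linarith

/-- The potential of the unit density is bounded, uniformly in the coefficients. -/
theorem exists_lintegral_kernel_le (hB : IsDriftMatrix p B) (hβ : 0 < β)
    (hs : s < hdim p / 2 + 1) :
    ∃ C : ℝ, 0 ≤ C ∧ ∀ A, HasCovBounds B A α β → ∀ z : Pt p,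
      ∫⁻ ζ in {ζ : Pt p | z.2 - 1 ≤ ζ.2}, ENNReal.ofReal (kernel B A s ζ z) ≤
        ENNReal.ofReal C := by
  set c := β⁻¹ / 4 with hc
  have hc0 : 0 < c := by positivity
  -- Dilation by `1 / √T` turns the flow over time `-T` into the flow over time `-1`, so one
  -- operator norm serves all lags. The summand `1` keeps `L` positive.
  set L := ‖flow B (-1)‖ + 1 with hL
  have hL0 : 0 < L := by positivity
  set c' := c / L ^ 2 with hc'
  have hc0' : 0 < c' := by positivity
  set I₁ := ∫⁻ x : Space p, ENNReal.ofReal (Real.exp (-(c' * ‖x‖ ^ 2))) with hI₁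
  set I₂ := ∫⁻ T in Ioc (0 : ℝ) 1, ENNReal.ofReal (T ^ (-s + hdim p / 2)) with hI₂
  have hI₁fin : I₁ < ∞ := lintegral_gaussian_lt_top hc0'
  -- The hypothesis `s < Q / 2 + 1` is exactly integrability at zero lag.
  have hI₂fin : I₂ < ∞ := by
    have := (intervalIntegral.intervalIntegrable_rpow' (a := 0) (b := 1)
      (show -1 < -s + hdim p / 2 by linarith)).1
    exact this.lintegral_lt_top
  refine ⟨(I₂ * I₁).toReal, ENNReal.toReal_nonneg, fun A h z => ?_⟩
  rw [ENNReal.ofReal_toReal (ENNReal.mul_lt_top hI₂fin hI₁fin).ne,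
    ← lintegral_indicator (measurableSet_le measurable_const measurable_snd)]
  have hslice : ∀ τ : ℝ, ∫⁻ ξ : Space p, ({ζ : Pt p | z.2 - 1 ≤ ζ.2}.indicator
      (fun ζ => ENNReal.ofReal (kernel B A s ζ z))) (ξ, τ) ≤
      (Ico (z.2 - 1) z.2).indicator
        (fun τ => ENNReal.ofReal ((z.2 - τ) ^ (-s + hdim p / 2 : ℝ)) * I₁) τ := by
    intro τ
    by_cases hτ : τ ∈ Ico (z.2 - 1) z.2
    · rw [indicator_of_mem hτ]
      set T := z.2 - τ with hT
      have hT0 : 0 < T := by have := hτ.2; linarith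
      have hT1 : T ≤ 1 := by have := hτ.1; linarith
      set r := (√T)⁻¹ with hr
      have hr0 : 0 < r := by positivity
      have hpt : ∀ ξ : Space p, ({ζ : Pt p | z.2 - 1 ≤ ζ.2}.indicator
          (fun ζ => ENNReal.ofReal (kernel B A s ζ z))) (ξ, τ) ≤ ENNReal.ofReal (T ^ (-s)) *
            ENNReal.ofReal (Real.exp (-(c' * ‖dil p r (flow B (-T) z.1 - ξ)‖ ^ 2))) := by
        intro ξ
        have hmem : ((ξ, τ) : Pt p) ∈ {ζ : Pt p | z.2 - 1 ≤ ζ.2} := hτ.1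
        rw [indicator_of_mem hmem, ← ENNReal.ofReal_mul (by positivity)]
        refine ENNReal.ofReal_le_ofReal ((h.barrier_le_exp (by exact hT0)).trans ?_)
        refine mul_le_mul_of_nonneg_left (Real.exp_le_exp.2 (neg_le_neg ?_)) (by positivity)
        change c' * ‖dil p r (flow B (-T) z.1 - ξ)‖ ^ 2 ≤
          c * ‖dil p r (z.1 - flow B T ξ)‖ ^ 2
        have e1 : dil p r (flow B (-T) z.1 - ξ) =
            flow B (-1) (dil p r (z.1 - flow B T ξ)) := by
          have e2 : flow B (-T) z.1 - ξ = flow B (-T) (z.1 - flow B T ξ) := by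
            rw [map_sub, flow_flow]; simp [flow_zero_apply]
          rw [e2, dil_flow hB]
          congr 2
          rw [hr, inv_pow, Real.sq_sqrt hT0.le]
          field_simp
        have e3 : ‖dil p r (flow B (-T) z.1 - ξ)‖ ≤ L * ‖dil p r (z.1 - flow B T ξ)‖ := by
          rw [e1]
          refine ((flow B (-1)).le_opNorm _).trans ?_
          exact mul_le_mul_of_nonneg_right (by linarith) (norm_nonneg _)
        calc c' * ‖dil p r (flow B (-T) z.1 - ξ)‖ ^ 2
            ≤ c' * (L * ‖dil p r (z.1 - flow B T ξ)‖) ^ 2 := by gcongr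
          _ = c * ‖dil p r (z.1 - flow B T ξ)‖ ^ 2 := by rw [hc']; field_simp
      refine (lintegral_mono hpt).trans ?_
      rw [lintegral_const_mul' _ _ ENNReal.ofReal_ne_top]
      have h4 := lintegral_sub_left_eq_self (μ := (volume : Measure (Space p)))
        (fun y => ENNReal.ofReal (Real.exp (-(c' * ‖dil p r y‖ ^ 2)))) (flow B (-T) z.1)
      rw [h4, lintegral_comp_dil hr0
        (f := fun y => ENNReal.ofReal (Real.exp (-(c' * ‖y‖ ^ 2)))) (by fun_prop),
        ← mul_assoc, ← ENNReal.ofReal_mul (by positivity)]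
      refine mul_le_mul_left (ENNReal.ofReal_le_ofReal (le_of_eq ?_)) _
      rw [Real.rpow_add hT0, hr, inv_pow, inv_inv, Real.sqrt_eq_rpow, ← Real.rpow_natCast,
        ← Real.rpow_mul hT0.le]
      congr 2
      ring
    · rw [indicator_of_notMem hτ]
      refine le_of_eq ?_
      rw [lintegral_eq_zero_of_ae_eq_zero]
      refine Eventually.of_forall fun ξ => ?_
      by_cases hm : z.2 - 1 ≤ τ
      · have : z.2 ≤ τ := by
          by_contra! h'
          exact hτ ⟨hm, h'⟩
        have h5 : kernel B A s (ξ, τ) z = 0 := kernel_eq_zero this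
        simp [indicator, h5]
      · exact indicator_of_notMem (s := {ζ : Pt p | z.2 - 1 ≤ ζ.2}) hm _
  calc ∫⁻ ζ, ({ζ : Pt p | z.2 - 1 ≤ ζ.2}.indicator
          (fun ζ => ENNReal.ofReal (kernel B A s ζ z))) ζ
      ≤ ∫⁻ τ : ℝ, ∫⁻ ξ : Space p, ({ζ : Pt p | z.2 - 1 ≤ ζ.2}.indicator
          (fun ζ => ENNReal.ofReal (kernel B A s ζ z))) (ξ, τ) := by
        -- The swap makes time the outer variable. Only an inequality is needed, so no measurability
        -- of the kernel has to be shown.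
        rw [Measure.volume_eq_prod, ← lintegral_prod_swap]
        exact lintegral_prod_le _
    _ ≤ ∫⁻ τ : ℝ, (Ico (z.2 - 1) z.2).indicator
          (fun τ => ENNReal.ofReal ((z.2 - τ) ^ (-s + hdim p / 2 : ℝ)) * I₁) τ :=
        lintegral_mono hslice
    _ = I₂ * I₁ := by
        rw [lintegral_indicator measurableSet_Ico, lintegral_mul_const' _ _ hI₁fin.ne,
          setLIntegral_rpow_sub]

end

/-! ### Approximation of potentials by finite sums -/

/-- The integral of a continuous kernel over a compact set dominates, up to a small error and
uniformly in the parameter, a finite sum with the same total mass. -/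
theorem exists_riemann_sum {X Z : Type*} [MetricSpace X] [MeasurableSpace X] [BorelSpace X]
    [PseudoMetricSpace Z] (ν : Measure X) [IsFiniteMeasureOnCompacts ν] {E : Set X} {K : Set Z}
    (hE : IsCompact E) (hEm : MeasurableSet E) (hK : IsCompact K) {f : X → Z → ℝ}
    (hf : ContinuousOn (fun w : X × Z => f w.1 w.2) (E ×ˢ K)) {ε : ℝ} (hε : 0 < ε) :
    ∃ (s : Finset X) (m : X → ℝ), (∀ y ∈ s, y ∈ E) ∧ (∀ y, 0 ≤ m y) ∧
      ∑ y ∈ s, m y = ν.real E ∧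
      ∀ z ∈ K, ∑ y ∈ s, m y * f y z ≤ ∫ ζ in E, f ζ z ∂ν + ε * ν.real E := by
  classical
  rcases E.eq_empty_or_nonempty with rfl | ⟨x₀, hx₀⟩
  · exact ⟨∅, 0, by simp, by simp, by simp, by simp⟩
  have hu := (hE.prod hK).uniformContinuousOn_of_continuous hf
  obtain ⟨δ, hδ, hδf⟩ := Metric.uniformContinuousOn_iff.1 hu ε hε
  obtain ⟨t, htE, htfin, htcov⟩ := hE.finite_cover_balls hδ
  set l := htfin.toFinset.toList with hl
  -- `nearestPt e l.length` also inspects the index `l.length`, where the lookup returns its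
  -- default; hence the default `x₀` has to lie in `E`.
  set e : ℕ → X := fun k => l.getD k x₀ with he
  have heE : ∀ k, e k ∈ E := by
    intro k
    rcases lt_or_ge k l.length with hk | hk
    · have h1 : e k = l[k] := List.getD_eq_getElem l x₀ hk
      have h2 : l[k] ∈ l := List.getElem_mem hk
      rw [h1]
      exact htE (by simpa only [hl, Finset.mem_toList, Set.Finite.mem_toFinset] using h2)
    · have h1 : e k = x₀ := List.getD_eq_default l x₀ hk
      rw [h1]; exact hx₀
  set φ := SimpleFunc.nearestPt e l.length with hφ
  have hφE : ∀ x, φ x ∈ E := fun x => heE _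
  have hφd : ∀ x ∈ E, dist (φ x) x < δ := by
    intro x hx
    obtain ⟨y, hy, hxy⟩ := mem_iUnion₂.1 (htcov hx)
    have hyl : y ∈ l := by simpa [hl] using hy
    obtain ⟨k, hk, hky⟩ := List.getElem_of_mem hyl
    have h1 := SimpleFunc.edist_nearestPt_le e x hk.le
    have h2 : e k = y := (List.getD_eq_getElem l x₀ hk).trans hky
    rw [h2, edist_dist, edist_dist] at h1
    have h3 := (ENNReal.ofReal_le_ofReal_iff dist_nonneg).1 h1
    refine h3.trans_lt ?_
    rw [dist_comm]; exact hxy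
  set P : X → Set X := fun y => E ∩ φ ⁻¹' {y} with hP
  have hPm : ∀ y, MeasurableSet (P y) := fun y => hEm.inter (φ.measurableSet_fiber y)
  have hPd : Set.Pairwise (φ.range : Set X) (Function.onFun Disjoint P) := by
    intro y _ y' _ hne
    refine Set.disjoint_left.2 fun x hx hx' => hne ?_
    rw [← hx.2, ← hx'.2]
  have hPU : ⋃ y ∈ φ.range, P y = E := by
    ext x
    simp only [hP, mem_iUnion, mem_inter_iff, mem_preimage, mem_singleton_iff, exists_prop]
    constructor
    · rintro ⟨y, -, h, -⟩; exact h
    · exact fun h => ⟨φ x, φ.mem_range_self x, h, rfl⟩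
  have hEfin : ν E ≠ ∞ := hE.measure_lt_top.ne
  refine ⟨φ.range, fun y => ν.real (P y), ?_, fun y => measureReal_nonneg, ?_, ?_⟩
  · intro y hy
    obtain ⟨x, rfl⟩ := SimpleFunc.mem_range.1 hy
    exact hφE x
  · rw [← measureReal_biUnion_finset hPd (fun y _ => hPm y)
      (fun y _ => ((measure_mono inter_subset_left).trans_lt hE.measure_lt_top).ne), hPU]
  · intro z hz
    have hcont : ContinuousOn (fun ζ => f ζ z) E :=
      hf.comp (f := fun ζ => (ζ, z)) (by fun_prop) fun ζ hζ => ⟨hζ, hz⟩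
    have hint : IntegrableOn (fun ζ => f ζ z) E ν := hcont.integrableOn_compact hE
    have hint2 : IntegrableOn (fun ζ => f ζ z + ε) E ν :=
      hint.add (integrableOn_const hEfin)
    have h1 : ∫ ζ in E, f ζ z ∂ν + ε * ν.real E = ∫ ζ in E, (f ζ z + ε) ∂ν := by
      rw [integral_add hint (integrableOn_const hEfin), setIntegral_const, smul_eq_mul, mul_comm]
    rw [h1, ← hPU, integral_biUnion_finset _ (fun y _ => hPm y) hPd
      (fun y _ => hint2.mono_set inter_subset_left)]
    refine Finset.sum_le_sum fun y _ => ?_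
    rw [← smul_eq_mul, ← setIntegral_const]
    have hPfin : ν (P y) ≠ ∞ := ((measure_mono inter_subset_left).trans_lt hE.measure_lt_top).ne
    refine setIntegral_mono_on (integrableOn_const hPfin) (hint2.mono_set inter_subset_left)
      (hPm y) ?_
    rintro ζ ⟨hζE, hζy⟩
    have hζy' : φ ζ = y := hζy
    have h2 := hδf (y, z) ⟨hζy' ▸ hφE ζ, hz⟩ (ζ, z) ⟨hζE, hz⟩ (by
      rw [Prod.dist_eq, dist_self, max_eq_left dist_nonneg, ← hζy']
      exact hφd ζ hζE)
    have h3 := (abs_lt.1 h2).2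
    simp only at h3
    linarith

/-! ### The growth estimate at unit scale -/

/-- The coefficient matrix `a` is supported in the upper left block and pinched between `A` and
`μ A`. -/
structure IsPinched (A : Matrix (Idx p) (Idx p) ℝ) (μ : ℝ) (a : Matrix (Idx p) (Idx p) ℝ) :
    Prop where
  off_block : ∀ k l : Idx p, (k.1 ≠ 0 ∨ l.1 ≠ 0) → a k l = 0
  lower : (a - A).PosSemidef
  upper : (μ • A - a).PosSemidef

theorem IsModelMatrix.posSemidef {lam Lam : ℝ} {A : Matrix (Idx p) (Idx p) ℝ}
    (hA : IsModelMatrix p lam Lam A) (hlam : 0 < lam) : A.PosSemidef := by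
  refine Matrix.PosSemidef.of_dotProduct_mulVec_nonneg ?_ fun x => ?_
  · rw [Matrix.IsHermitian, Matrix.conjTranspose_eq_transpose_of_trivial, hA.symm.eq]
  · rw [star_trivial]
    exact le_trans (mul_nonneg hlam.le (Finset.sum_nonneg fun _ _ => sq_nonneg _)) (hA.lower x)

theorem IsPinched.posSemidef {lam Lam μ : ℝ} {A a : Matrix (Idx p) (Idx p) ℝ}
    (ha : IsPinched A μ a) (hA : IsModelMatrix p lam Lam A) (hlam : 0 < lam) :
    a.PosSemidef := by
  have := ha.lower.add (hA.posSemidef hlam)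
  simpa using this

/-- The cylinder in which the density of a level set is measured. -/
def testCyl (p : Fin (n + 1) → ℕ) (b : ℝ) : Set (Pt p) :=
  Metric.closedBall 0 1 ×ˢ Icc (-(3 * b / 4)) (-(b / 2))

theorem isCompact_testCyl (b : ℝ) : IsCompact (testCyl p b) :=
  (isCompact_closedBall _ _).prod isCompact_Icc

theorem volume_testCyl_pos {b : ℝ} (hb : 0 < b) : 0 < volume (testCyl p b) := by
  refine lt_of_lt_of_le ?_ (measure_mono (Set.prod_mono Metric.ball_subset_closedBall
    Ioo_subset_Icc_self))
  refine IsOpen.measure_pos _ (Metric.isOpen_ball.prod isOpen_Ioo) ?_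
  exact (Metric.nonempty_ball.2 one_pos).prod (nonempty_Ioo.2 (by linarith))

theorem hdim_pos [Nonempty (Idx p)] : 0 < hdim p := by
  obtain ⟨k⟩ := ‹Nonempty (Idx p)›
  refine Finset.sum_pos' (fun _ _ => Nat.zero_le _) ⟨k.1, Finset.mem_univ _, ?_⟩
  have : 0 < p k.1 := k.2.pos
  positivity

theorem exists_radius {c g : ℝ} (hc : 0 < c) (hg : 0 < g) {N : ℕ} (hN : N ≠ 0) :
    ∃ R : ℝ, 3 ≤ R ∧ ∀ r : ℝ, R - 2 ≤ r → N.factorial / (c * r ^ 2) ^ N ≤ g := by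
  have h0 := le_max_left (1 : ℝ) (N.factorial / (c ^ N * g))
  refine ⟨2 + max 1 (N.factorial / (c ^ N * g)), by linarith, fun r hr => ?_⟩
  have h1 : 1 ≤ r := by linarith [le_max_left (1 : ℝ) (N.factorial / (c ^ N * g))]
  have h2 : N.factorial / (c ^ N * g) ≤ r := by
    linarith [le_max_right (1 : ℝ) (N.factorial / (c ^ N * g))]
  have h3 : r ≤ (r ^ 2) ^ N := by
    calc r ≤ r ^ 2 := by nlinarith
      _ ≤ (r ^ 2) ^ N := le_self_pow₀ (one_le_pow₀ h1) hN
  rw [div_le_iff₀ (by positivity), mul_pow]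
  rw [div_le_iff₀ (by positivity)] at h2
  calc (N.factorial : ℝ) ≤ r * (c ^ N * g) := h2
    _ ≤ (r ^ 2) ^ N * (c ^ N * g) := by gcongr
    _ = g * (c ^ N * (r ^ 2) ^ N) := by ring

/-- A nonnegative solution that is at least `h` on half of the test cylinder is bounded below by a
fixed multiple of `h` at later times. -/
theorem exists_lower_bound [Nonempty (Idx p)] {B : Matrix (Idx p) (Idx p) ℝ}
    (hB : IsDriftMatrix p B) {lam Lam μ b : ℝ} (hlam : 0 < lam) (hLam : 0 < Lam)
    (hμ : μ < 1 + 2 / hdim p) (hb : 0 < b) (hb1 : b ≤ 1)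
    (hflow : ∀ σ : ℝ, |σ| ≤ b → ‖flow B σ‖ ≤ 2) :
    ∃ R κ : ℝ, 1 ≤ R ∧ 0 < κ ∧ κ ≤ 1 / 2 ∧
      ∀ A, IsModelMatrix p lam Lam A → ∀ (a : Pt p → Matrix (Idx p) (Idx p) ℝ) (w : Pt p → ℝ),
        (∀ z : Pt p, ‖z.1‖ ≤ R → -b < z.2 → z.2 < 0 →
          ContDiffAt ℝ 2 w z ∧ opL B a w z = 0 ∧ 0 ≤ w z ∧ IsPinched A μ (a z)) →
        ∀ h : ℝ, 0 < h → volume (testCyl p b) ≤ 2 * volume (testCyl p b ∩ {z | h ≤ w z}) →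
        ∀ z : Pt p, ‖z.1‖ ≤ 1 → -(b / 4) ≤ z.2 → z.2 < 0 → κ * h ≤ w z := by
  have hQ : (0 : ℝ) < hdim p := by exact_mod_cast hdim_pos (p := p)
  have hμ' : μ * hdim p / 2 < hdim p / 2 + 1 := by
    have h1 := mul_lt_mul_of_pos_right hμ hQ
    have h2 : (1 + 2 / (hdim p : ℝ)) * hdim p = hdim p + 2 := by field_simp
    linarith
  -- The bound on `μ` leaves room between the subsolution condition and the integrability condition.
  -- The maximum with `0` ensures `s > 0` whatever the sign of `μ`.
  obtain ⟨s, hs1, hs2⟩ := exists_between (max_lt hμ' (show (0 : ℝ) < hdim p / 2 + 1 by positivity))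
  have hsμ : μ * hdim p / 2 < s := (le_max_left _ _).trans_lt hs1
  have hs0 : 0 < s := (le_max_right _ _).trans_lt hs1
  obtain ⟨N, hN⟩ := exists_nat_ge (s + 1)
  have hN0 : N ≠ 0 := by
    rintro rfl
    simp at hN; linarith
  obtain ⟨α, β, hα, hβ, hcov⟩ := exists_hasCovBounds hB hlam hLam
  obtain ⟨CU, hCU0, hCU⟩ := exists_lintegral_kernel_le (s := s) hB hβ hs2
  -- Lower bound of the kernel at lag at least `b / 4` and distance at most 3 from the transported
  -- pole: the point has norm at most 1, the transported pole at most 2.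
  set g₀ := Real.exp (-(α⁻¹ * ((b / 4)⁻¹ ^ (2 * n + 1) * 3 ^ 2) / 4)) with hg₀
  have hg₀0 : 0 < g₀ := Real.exp_pos _
  -- A point of norm `R` is at distance at least `R - 2` from every transported pole; there the
  -- kernel is at most half of `g₀`.
  obtain ⟨R, hR3, hR⟩ := exists_radius (show 0 < β⁻¹ / 4 by positivity)
    (show 0 < g₀ / 2 by positivity) hN0
  set S := testCyl p b with hS
  have hScomp : IsCompact S := isCompact_testCyl b
  set vS := volume.real S with hvS
  have hvS0 : 0 < vS :=
    ENNReal.toReal_pos (volume_testCyl_pos hb).ne' hScomp.measure_lt_top.ne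
  set κ := min (1 / 2) (g₀ * vS / (8 * (CU + 1))) with hκ
  refine ⟨R, κ, by linarith, lt_min (by norm_num) (by positivity), min_le_left _ _, ?_⟩
  intro A hA a w hw h hh hdens z₁ hz₁R hz₁t hz₁0
  have hcb := hcov A hA
  -- If `w z₁` is already large, `κ ≤ 1 / 2` suffices. Otherwise `z₁` belongs to the sublevel set
  -- `K` on which the comparison is made.
  by_cases hbig : h / 2 ≤ w z₁
  · refine le_trans ?_ hbig
    have : κ * h ≤ 1 / 2 * h := mul_le_mul_of_nonneg_right (min_le_left _ _) hh.le
    linarith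
  push Not at hbig
  have hwc : ∀ z : Pt p, ‖z.1‖ ≤ R → -b < z.2 → z.2 < 0 → ContinuousAt w z :=
    fun z h1 h2 h3 => (hw z h1 h2 h3).1.continuousAt
  have hSbox : ∀ z ∈ S, ‖z.1‖ ≤ 1 ∧ -(3 * b / 4) ≤ z.2 ∧ z.2 ≤ -(b / 2) := by
    rintro z ⟨h1, h2⟩
    exact ⟨by simpa using h1, h2.1, h2.2⟩
  have hwS : ContinuousOn w S := fun z hz => (hwc z (by linarith [(hSbox z hz).1])
    (by linarith [(hSbox z hz).2.1]) (by linarith [(hSbox z hz).2.2])).continuousWithinAt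
  set E := S ∩ {z | h ≤ w z} with hE
  have hEclosed : IsClosed E := hwS.preimage_isClosed_of_isClosed hScomp.isClosed isClosed_Ici
  have hEcomp : IsCompact E := hScomp.of_isClosed_subset hEclosed inter_subset_left
  set e := volume.real E with he
  have he1 : vS ≤ 2 * e := by
    have h1 := ENNReal.toReal_mono (ENNReal.mul_ne_top (by simp) hEcomp.measure_lt_top.ne) hdens
    rwa [ENNReal.toReal_mul] at h1
  have he2 : e ≤ vS := measureReal_mono inter_subset_left hScomp.measure_lt_top.ne
  have he0 : 0 < e := by linarith
  -- The bottom time lies strictly between `-b` and the earliest possible pole time `-3b/4`: the box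
  -- stays in the domain of `w`, and the potential vanishes on its bottom.
  set Z : Set (Pt p) := Metric.closedBall 0 R ×ˢ Icc (-(7 * b / 8)) z₁.2 with hZ
  have hZcomp : IsCompact Z := (isCompact_closedBall _ _).prod isCompact_Icc
  have hZbox : ∀ z ∈ Z, ‖z.1‖ ≤ R ∧ -(7 * b / 8) ≤ z.2 ∧ z.2 ≤ z₁.2 := by
    rintro z ⟨h1, h2⟩
    exact ⟨by simpa using h1, h2.1, h2.2⟩
  have hwZ : ContinuousOn w Z := fun z hz => (hwc z (hZbox z hz).1
    (by linarith [(hZbox z hz).2.1]) (by linarith [(hZbox z hz).2.2])).continuousWithinAt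
  -- The values of `w` separate `K` from `E`, so the kernel is continuous on `E ×ˢ K`.
  set K := Z ∩ {z | w z ≤ h / 2} with hK
  have hKcomp : IsCompact K := hZcomp.of_isClosed_subset
    (hwZ.preimage_isClosed_of_isClosed hZcomp.isClosed isClosed_Iic) inter_subset_left
  have hker : ContinuousOn (fun v : Pt p × Pt p => kernel B A s v.1 v.2) (E ×ˢ K) := by
    rintro ⟨ζ, z⟩ ⟨hζ, hz⟩
    refine (hcb.continuousAt_kernel ?_).continuousWithinAt
    rintro rfl
    have h1 : h ≤ w ζ := hζ.2
    have h2 : w ζ ≤ h / 2 := hz.2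
    linarith
  -- With this tolerance the total error is at most 1, because `E` has measure at most `vS`.
  obtain ⟨F, m, hFE, hm, hmsum, hsum⟩ := exists_riemann_sum (volume : Measure (Pt p)) hEcomp
    hEclosed.measurableSet hKcomp hker (show 0 < 1 / (vS + 1) by positivity)
  set U : Pt p → ℝ := fun z => ∑ ζ ∈ F, m ζ * kernel B A s ζ z with hU
  have hFS : ∀ ζ ∈ F, ‖ζ.1‖ ≤ 1 ∧ -(3 * b / 4) ≤ ζ.2 ∧ ζ.2 ≤ -(b / 2) :=
    fun ζ hζ => hSbox ζ (hFE ζ hζ).1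
  have hUle : ∀ z ∈ K, U z ≤ CU + 1 := by
    intro z hz
    refine (hsum z hz).trans (add_le_add ?_ ?_)
    · have hint : IntegrableOn (fun ζ => kernel B A s ζ z) E volume :=
        (hker.comp (f := fun ζ => (ζ, z)) (by fun_prop)
          fun ζ hζ => ⟨hζ, hz⟩).integrableOn_compact hEcomp
      rw [← ENNReal.ofReal_le_ofReal_iff hCU0, ofReal_integral_eq_lintegral_ofReal hint
        (Eventually.of_forall fun ζ => kernel_nonneg _ _)]
      refine (lintegral_mono_set ?_).trans (hCU A hcb z)
      intro ζ hζ
      have h1 := (hSbox ζ hζ.1).2.1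
      have h2 := (hZbox z hz.1).2.2
      change z.2 - 1 ≤ ζ.2
      linarith
    · rw [div_mul_eq_mul_div, one_mul, div_le_one (by positivity)]
      linarith
  have hflowdist : ∀ ζ ∈ F, ∀ z : Pt p, ζ.2 < z.2 → z.2 < 0 →
      ‖flow B (z.2 - ζ.2) ζ.1‖ ≤ 2 := by
    intro ζ hζ z h1 h2
    obtain ⟨h3, h4, h5⟩ := hFS ζ hζ
    have h6 := hflow (z.2 - ζ.2) (by rw [abs_of_pos (by linarith)]; linarith)
    calc _ ≤ ‖flow B (z.2 - ζ.2)‖ * ‖ζ.1‖ := (flow B (z.2 - ζ.2)).le_opNorm _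
      _ ≤ 2 * 1 := by gcongr
      _ = 2 := by norm_num
  have hlow : g₀ * e ≤ U z₁ := by
    rw [he, ← hmsum, Finset.mul_sum]
    refine Finset.sum_le_sum fun ζ hζ => ?_
    rw [mul_comm]
    refine mul_le_mul_of_nonneg_left ?_ (hm ζ)
    obtain ⟨h3, h4, h5⟩ := hFS ζ hζ
    refine hcb.le_barrier hs0.le (z := (z₁.1 - flow B (z₁.2 - ζ.2) ζ.1, z₁.2 - ζ.2))
      (show 0 < b / 4 by positivity) ?_ ?_ ?_
    · change b / 4 ≤ z₁.2 - ζ.2; linarith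
    · change z₁.2 - ζ.2 ≤ 1; linarith
    · change ‖z₁.1 - flow B (z₁.2 - ζ.2) ζ.1‖ ≤ 3
      have h6 := hflowdist ζ hζ z₁ (by linarith) hz₁0
      have h7 := norm_sub_le z₁.1 (flow B (z₁.2 - ζ.2) ζ.1)
      linarith
  have hlat : ∀ z ∈ Z, ‖z.1‖ = R → U z ≤ g₀ / 2 * e := by
    intro z hz hzR
    rw [he, ← hmsum, Finset.mul_sum]
    refine Finset.sum_le_sum fun ζ hζ => ?_
    rw [mul_comm]
    refine mul_le_mul_of_nonneg_right ?_ (hm ζ)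
    obtain ⟨h3, h4, h5⟩ := hFS ζ hζ
    obtain ⟨h6, h7, h8⟩ := hZbox z hz
    rcases le_or_gt z.2 ζ.2 with hle | hlt
    · rw [kernel_eq_zero hle]; positivity
    · have h9 := hflowdist ζ hζ z hlt (by linarith)
      have h10 : R - 2 ≤ ‖z.1 - flow B (z.2 - ζ.2) ζ.1‖ := by
        have := norm_sub_norm_le z.1 (flow B (z.2 - ζ.2) ζ.1)
        linarith
      have h11 : z.1 - flow B (z.2 - ζ.2) ζ.1 ≠ 0 := by
        intro h0
        rw [h0, norm_zero] at h10
        linarith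
      refine (hcb.barrier_le hN (z := (z.1 - flow B (z.2 - ζ.2) ζ.1, z.2 - ζ.2))
        (sub_pos.2 hlt) (show z.2 - ζ.2 ≤ 1 by linarith) h11).trans ?_
      refine le_trans ?_ (hR _ h10)
      have h12 : 0 < ‖z.1 - flow B (z.2 - ζ.2) ζ.1‖ := by linarith
      refine div_le_div_of_nonneg_right ?_ (by positivity)
      exact mul_le_of_le_one_right (by positivity) (show z.2 - ζ.2 ≤ 1 by linarith)
  have hUcont : ContinuousOn U K := by
    refine continuousOn_finsetSum _ fun ζ hζ => continuousOn_const.mul ?_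
    exact hker.comp (f := fun z => (ζ, z)) (by fun_prop) fun z hz => ⟨hFE ζ hζ, hz⟩
  -- This `c` gives `c * U ≤ h / 2` on `K`, so the difference cannot be negative where `w = h / 2`.
  -- The constant `ℓ` below bounds `U` on the lateral boundary, and is half of its lower bound at
  -- `z₁`.
  set c := h / (2 * (CU + 1)) with hc
  have hc0 : 0 < c := by positivity
  have hcle : c * (CU + 1) = h / 2 := by rw [hc]; field_simp
  set ℓ := g₀ / 2 * e with hℓ
  have hℓ0 : 0 < ℓ := by positivity
  have hz₁K : z₁ ∈ K := ⟨⟨by simpa using (by linarith : ‖z₁.1‖ ≤ R),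
    ⟨by linarith, le_rfl⟩⟩, hbig.le⟩
  obtain ⟨y, hyK, hymin⟩ := hKcomp.exists_isMinOn ⟨z₁, hz₁K⟩
    ((hwZ.mono inter_subset_left).sub (continuousOn_const.mul
      (hUcont.sub (continuousOn_const (c := ℓ)))) : ContinuousOn (fun z => w z - c * (U z - ℓ)) K)
  -- A negative minimum avoids the lateral boundary, the bottom and the level `w = h / 2`. It is
  -- thus a local minimum over earlier times, where the minimum principle contradicts the strict
  -- subsolution property of the kernels.
  have hpos : 0 ≤ w y - c * (U y - ℓ) := by
    by_contra! hneg
    obtain ⟨hyR, hyb, hyt⟩ := hZbox y hyK.1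
    have hy0 : y.2 < 0 := by linarith
    obtain ⟨hwy, hLy, hwy0, hpin⟩ := hw y hyR (by linarith) hy0
    have hUy : ℓ < U y := by
      by_contra! hle
      have : c * (U y - ℓ) ≤ 0 := mul_nonpos_of_nonneg_of_nonpos hc0.le (by linarith)
      linarith
    have hyR' : ‖y.1‖ < R := by
      refine hyR.lt_of_ne fun h1 => ?_
      have := hlat y hyK.1 h1
      linarith
    have hyb' : -(7 * b / 8) < y.2 := by
      refine hyb.lt_of_ne fun h1 => ?_
      have : U y = 0 := by
        refine Finset.sum_eq_zero fun ζ hζ => ?_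
        rw [kernel_eq_zero (by linarith [(hFS ζ hζ).2.1]), mul_zero]
      linarith
    have hyw : w y < h / 2 := by
      have h1 : w y ≤ h / 2 := hyK.2
      refine h1.lt_of_ne fun h2 => ?_
      have h3 : c * (U y - ℓ) ≤ c * (CU + 1) :=
        mul_le_mul_of_nonneg_left (by linarith [hUle y hyK]) hc0.le
      linarith
    -- Kernels with poles not earlier than `y` vanish up to the time of `y` but need not be smooth
    -- there. Dropping them changes nothing in the past, which is why a one-sided minimum is used.
    set F' := F.filter fun ζ => ζ.2 < y.2 with hF'
    have hUF' : ∀ z : Pt p, z.2 ≤ y.2 → U z = ∑ ζ ∈ F', m ζ * kernel B A s ζ z := by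
      intro z hz
      rw [hU, hF', Finset.sum_filter]
      refine Finset.sum_congr rfl fun ζ _ => ?_
      split_ifs with h1
      · rfl
      · rw [kernel_eq_zero (by linarith [not_lt.1 h1]), mul_zero]
    set G : Pt p → ℝ := fun z =>
      w z + -c * ∑ ζ ∈ F', m ζ * kernel B A s ζ z with hG
    have hGmin : IsLocalMinOn G {v | v.2 ≤ y.2} y := by
      have e1 : ∀ᶠ z : Pt p in 𝓝[{v | v.2 ≤ y.2}] y, ‖z.1‖ < R :=
        nhdsWithin_le_nhds ((by fun_prop : Continuous fun z : Pt p => ‖z.1‖).continuousAt.eventually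
          (gt_mem_nhds hyR'))
      have e2 : ∀ᶠ z : Pt p in 𝓝[{v | v.2 ≤ y.2}] y, -(7 * b / 8) < z.2 :=
        nhdsWithin_le_nhds (continuous_snd.continuousAt.eventually (lt_mem_nhds hyb'))
      have e3 : ∀ᶠ z : Pt p in 𝓝[{v | v.2 ≤ y.2}] y, w z < h / 2 :=
        nhdsWithin_le_nhds (hwy.continuousAt.eventually (gt_mem_nhds hyw))
      filter_upwards [e1, e2, e3, self_mem_nhdsWithin] with z h1 h2 h3 h4
      have h4' : z.2 ≤ y.2 := h4
      have hzK : z ∈ K := ⟨⟨by simpa using h1.le, ⟨h2.le, by linarith⟩⟩, h3.le⟩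
      have h5 : w y - c * (U y - ℓ) ≤ w z - c * (U z - ℓ) := hymin hzK
      rw [hUF' y le_rfl, hUF' z h4'] at h5
      simp only [hG]
      linarith
    have hkerC : ∀ ζ ∈ F', ContDiffAt ℝ 2 (fun z => m ζ * kernel B A s ζ z) y := fun ζ hζ =>
      contDiffAt_const.mul (contDiffAt_kernel (Finset.mem_filter.1 hζ).2)
    have hsumC : ContDiffAt ℝ 2 (fun z => ∑ ζ ∈ F', m ζ * kernel B A s ζ z) y :=
      ContDiffAt.sum hkerC
    have hGC : ContDiffAt ℝ 2 G y := hwy.add (contDiffAt_const.mul hsumC)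
    have hLG := opL_nonneg_of_isLocalMinOn (B := B) (hpin.posSemidef hA hlam) hGC hGmin
    have hLG2 : opL B a G y = -c * ∑ ζ ∈ F', m ζ * opL B a (kernel B A s ζ) y := by
      rw [hG, opL_add hwy (contDiffAt_const.mul hsumC), hLy, zero_add, opL_const_mul hsumC,
        opL_sum F' hkerC]
      congr 1
      exact Finset.sum_congr rfl fun ζ hζ =>
        opL_const_mul (contDiffAt_kernel (Finset.mem_filter.1 hζ).2) _
    have hterm : ∀ ζ ∈ F', 0 < opL B a (kernel B A s ζ) y := fun ζ hζ =>
      hcb.opL_kernel_pos hB hA hsμ (Finset.mem_filter.1 hζ).2 hpin.off_block hpin.lower hpin.upper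
    -- Since `U y > ℓ > 0`, some earlier pole carries positive weight, and its term makes the sum
    -- strictly positive.
    have hsumpos : 0 < ∑ ζ ∈ F', m ζ * opL B a (kernel B A s ζ) y := by
      have h1 : 0 < ∑ ζ ∈ F', m ζ * kernel B A s ζ y := by
        rw [← hUF' y le_rfl]; linarith
      obtain ⟨ζ, hζ, hζpos⟩ : ∃ ζ ∈ F', 0 < m ζ * kernel B A s ζ y := by
        by_contra! h2
        exact h1.not_ge (Finset.sum_nonpos h2)
      exact Finset.sum_pos' (fun ζ hζ => mul_nonneg (hm ζ) (hterm ζ hζ).le)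
        ⟨ζ, hζ, mul_pos (pos_of_mul_pos_left hζpos (kernel_nonneg _ _)) (hterm ζ hζ)⟩
    rw [hLG2] at hLG
    have := mul_pos hc0 hsumpos
    linarith
  have hfin : 0 ≤ w z₁ - c * (U z₁ - ℓ) := hpos.trans (hymin hz₁K)
  have h1 : c * (g₀ * e - ℓ) ≤ c * (U z₁ - ℓ) :=
    mul_le_mul_of_nonneg_left (by linarith) hc0.le
  have h2 : κ * h ≤ c * (g₀ * e - ℓ) := by
    have h3 : κ * h ≤ g₀ * vS / (8 * (CU + 1)) * h :=
      mul_le_mul_of_nonneg_right (min_le_right _ _) hh.le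
    have h4 : g₀ * vS / (8 * (CU + 1)) * h = c * (g₀ * vS / 4) := by
      rw [hc]; field_simp; norm_num
    have h5 : c * (g₀ * vS / 4) ≤ c * (g₀ * e - ℓ) := by
      refine mul_le_mul_of_nonneg_left ?_ hc0.le
      rw [hℓ]
      nlinarith
    linarith
  linarith

/-! ### Decay of the oscillation -/

/-- `u` contracts oscillations by the factor `q` from `𝒬¹_r(z₀)` to `𝒬¹_{r/θ}(z₀)`. -/
def OscDecay (B : Matrix (Idx p) (Idx p) ℝ) (b K θ q : ℝ) (u : Pt p → ℝ) (z₀ : Pt p) (r : ℝ) :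
    Prop :=
  ∀ V : ℝ, (∀ z ∈ cylOne B b K r z₀, ∀ w ∈ cylOne B b K r z₀, u z - u w ≤ V) →
    ∀ z ∈ cylOne B b K (r / θ) z₀, ∀ w ∈ cylOne B b K (r / θ) z₀, u z - u w ≤ q * V

theorem exists_oscDecay [Nonempty (Idx p)] {B : Matrix (Idx p) (Idx p) ℝ}
    (hB : IsDriftMatrix p B) {lam Lam μ b : ℝ} (hlam : 0 < lam) (hLam : 0 < Lam)
    (hμ : μ < 1 + 2 / hdim p) (hb : IsTimeScale B b) :
    ∃ K₀ κ : ℝ, 0 < κ ∧ κ < 1 ∧ ∀ K : ℝ, K₀ < K → 1 ≤ K ∧ 1 < K / sigmaMin p ∧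
      ∀ A, IsModelMatrix p lam Lam A → ∀ (a : Pt p → Matrix (Idx p) (Idx p) ℝ) (D : Set (Pt p))
        (u : Pt p → ℝ), IsOpen D → IsClassicalSolution B a D u →
        ∀ (z₀ : Pt p) (r : ℝ), 0 < r → cylOne B b K r z₀ ⊆ D →
          (∀ z ∈ cylOne B b K r z₀, IsPinched A μ (a z)) →
          OscDecay B b K (K / sigmaMin p) (1 - κ) u z₀ r := by
  obtain ⟨R, κ, hR, hκ, hκ1, hmain⟩ :=
    exists_lower_bound hB hlam hLam hμ hb.pos hb.le_one hb.flow_le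
  have hσ := sigmaMin_pos (p := p)
  have hb0 := hb.pos
  -- The first bound puts the ball of radius `R` inside the rescaled cylinder. The second gives `θ >
  -- 2`, so the smaller cylinder rescales to times after `-b / 4`. The factor `κ` is halved because
  -- the growth lemma is applied with half of the oscillation as level.
  refine ⟨max ((n + 1) * R) (2 * sigmaMin p), κ / 2, by positivity, by linarith, fun K hK => ?_⟩
  have hK1 : (n + 1) * R < K := (le_max_left _ _).trans_lt hK
  have hK2 : 2 * sigmaMin p < K := (le_max_right _ _).trans_lt hK
  have hθ : 2 < K / sigmaMin p := by rwa [lt_div_iff₀ hσ]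
  have hn : (0 : ℝ) ≤ n := by positivity
  refine ⟨by nlinarith, by linarith, ?_⟩
  intro A hA a D u hD hu z₀ r hr hcyl hpin V hV
  set θ := K / sigmaMin p with hθdef
  set v := u ∘ chart B z₀ r with hv
  set W : Set (Pt p) := {z | ‖z.1‖ ≤ R ∧ -b < z.2 ∧ z.2 < 0} with hW
  have hWc : ∀ z ∈ W, chart B z₀ r z ∈ cylOne B b K r z₀ := fun z hz =>
    chart_mem_cylOne hr ((spaceNorm_le hR hz.1).trans_lt hK1) hz.2.1 hz.2.2
  have hVW : ∀ z ∈ W, ∀ w ∈ W, v z - v w ≤ V := fun z hz w hw =>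
    hV _ (hWc z hz) _ (hWc w hw)
  have hWne : W.Nonempty := ⟨(0, -(b / 2)), by simp; linarith, by simp; linarith,
    by simp; linarith⟩
  obtain ⟨y₀, hy₀⟩ := hWne
  have hbelow : BddBelow (v '' W) := ⟨v y₀ - V, by
    rintro _ ⟨z, hz, rfl⟩
    linarith [hVW y₀ hy₀ z hz]⟩
  have habove : BddAbove (v '' W) := ⟨v y₀ + V, by
    rintro _ ⟨z, hz, rfl⟩
    linarith [hVW z hz y₀ hy₀]⟩
  set m := sInf (v '' W) with hm
  set M := sSup (v '' W) with hM
  have hmle : ∀ z ∈ W, m ≤ v z := fun z hz => csInf_le hbelow ⟨z, hz, rfl⟩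
  have hleM : ∀ z ∈ W, v z ≤ M := fun z hz => le_csSup habove ⟨z, hz, rfl⟩
  have hMm : M - m ≤ V := by
    have h1 : M ≤ V + m := by
      refine csSup_le ⟨_, y₀, hy₀, rfl⟩ ?_
      rintro _ ⟨z, hz, rfl⟩
      have h2 : v z - V ≤ m := by
        refine le_csInf ⟨_, y₀, hy₀, rfl⟩ ?_
        rintro _ ⟨w, hw, rfl⟩
        linarith [hVW z hz w hw]
      linarith
    linarith
  have hvC : ∀ z ∈ W, ContDiffAt ℝ 2 v z := fun z hz =>
    (hu.1.contDiffAt (hD.mem_nhds (hcyl (hWc z hz)))).comp z (contDiff_chart _ _ _).contDiffAt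
  have hvL : ∀ z ∈ W, opL B (a ∘ chart B z₀ r) v z = 0 := by
    intro z hz
    rw [hv, opL_comp_chart hB (hpin _ (hWc z hz)).off_block
      (hu.1.contDiffAt (hD.mem_nhds (hcyl (hWc z hz)))), hu.2 _ (hcyl (hWc z hz)), mul_zero]
  have hinner : ∀ w ∈ cylOne B b K (r / θ) z₀, ∃ z : Pt p, ‖z.1‖ ≤ 1 ∧ -(b / 4) ≤ z.2 ∧ z.2 < 0 ∧
      z ∈ W ∧ v z = u w := by
    intro w hw
    obtain ⟨z, h1, h2, h3, h4⟩ := exists_chart_eq_of_mem_cylOne hr hw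
    have e1 : K * (r / θ) / r = sigmaMin p := by
      rw [hθdef]
      have : K ≠ 0 := by linarith
      field_simp
    rw [e1] at h1
    have h5 := (norm_lt_one_of_spaceNorm_lt h1).le
    have h6 : -(b / 4) ≤ -(b * (r / θ) ^ 2) / r ^ 2 := by
      have e2 : -(b * (r / θ) ^ 2) / r ^ 2 = -(b / θ ^ 2) := by field_simp
      rw [e2]
      refine neg_le_neg (div_le_div_of_nonneg_left hb0.le (by norm_num) ?_)
      nlinarith
    exact ⟨z, h5, by linarith, h3, ⟨by linarith, by linarith, h3⟩, congrArg u h4⟩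
  set h := (M - m) / 2 with hh
  have hh0 : 0 ≤ h := by
    have := (hmle y₀ hy₀).trans (hleM y₀ hy₀)
    rw [hh]; linarith
  have hSW : ∀ z ∈ testCyl p b, z ∈ W := by
    rintro z ⟨h1, h2, h3⟩
    have h1' : ‖z.1‖ ≤ 1 := by simpa using h1
    exact ⟨by linarith, by linarith, by linarith⟩
  intro z hz w hw
  obtain ⟨z', hz1, hz2, hz3, hzW, hzu⟩ := hinner z hz
  obtain ⟨w', hw1, hw2, hw3, hwW, hwu⟩ := hinner w hw
  rw [← hzu, ← hwu]
  have hfin : v z' - v w' ≤ 2 * h - κ * h → v z' - v w' ≤ (1 - κ / 2) * V := by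
    intro h1
    have h2 : 2 * h - κ * h = (1 - κ / 2) * (M - m) := by rw [hh]; ring
    rw [h2] at h1
    exact h1.trans (mul_le_mul_of_nonneg_left hMm (by linarith))
  apply hfin
  rcases hh0.eq_or_lt with h0 | hpos
  · rw [← h0]
    have h1 := hleM z' hzW
    have h2 := hmle w' hwW
    linarith
  -- The part above or the part below the middle level fills at least half of the test cylinder.
  -- Subadditivity of the measure is enough here.
  have hcover : testCyl p b ⊆ (testCyl p b ∩ {z | h ≤ v z + -m}) ∪
      (testCyl p b ∩ {z | h ≤ -1 * v z + M}) := by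
    intro y hy
    rcases le_total h (v y + -m) with h1 | h1
    · exact Or.inl ⟨hy, h1⟩
    · refine Or.inr ⟨hy, ?_⟩
      change h ≤ -1 * v y + M
      linarith
  have hmeas := (measure_mono (μ := (volume : Measure (Pt p))) hcover).trans
    (measure_union_le _ _)
  rcases le_total (volume (testCyl p b ∩ {z | h ≤ -1 * v z + M}))
    (volume (testCyl p b ∩ {z | h ≤ v z + -m})) with hc | hc
  · have h1 := hmain A hA (a ∘ chart B z₀ r) (fun z => v z + -m) (fun z hz1 hz2 hz3 => by
      have hzW : z ∈ W := ⟨hz1, hz2, hz3⟩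
      refine ⟨(hvC z hzW).add contDiffAt_const, ?_, by linarith [hmle z hzW], hpin _ (hWc z hzW)⟩
      rw [opL_add (hvC z hzW) contDiffAt_const, hvL z hzW, opL_const, add_zero]) h hpos
      (hmeas.trans (by rw [two_mul]; exact add_le_add_right hc _)) w' hw1 hw2 hw3
    have h2 := hleM z' hzW
    linarith
  · have h1 := hmain A hA (a ∘ chart B z₀ r) (fun z => -1 * v z + M) (fun z hz1 hz2 hz3 => by
      have hzW : z ∈ W := ⟨hz1, hz2, hz3⟩
      refine ⟨(contDiffAt_const.mul (hvC z hzW)).add contDiffAt_const, ?_,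
        by linarith [hleM z hzW], hpin _ (hWc z hzW)⟩
      rw [opL_add (contDiffAt_const.mul (hvC z hzW)) contDiffAt_const, opL_const_mul (hvC z hzW),
        hvL z hzW, opL_const, add_zero, mul_zero]) h hpos
      (hmeas.trans (by rw [two_mul]; exact add_le_add_left hc _)) z' hz1 hz2 hz3
    have h2 := hmle w' hwW
    linarith

/-- Contraction of real oscillations, rewritten for the extended real oscillation. -/
theorem osc_le_of_forall {X : Type*} {S T : Set X} {u : X → ℝ} {κ : ℝ} (hκ : 0 ≤ κ)
    (hS : S.Nonempty)
    (h : ∀ V : ℝ, (∀ z ∈ S, ∀ w ∈ S, u z - u w ≤ V) → ∀ z ∈ T, ∀ w ∈ T,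
      u z - u w ≤ (1 - κ) * V) :
    ((1 + κ : ℝ) : EReal) * osc T u ≤ osc S u := by
  by_cases htop : osc S u = ⊤
  · rw [htop]; exact le_top
  obtain ⟨y, hy⟩ := hS
  set P : EReal := ⨆ z ∈ S, (u z : EReal) with hP
  set I : EReal := ⨅ z ∈ S, (u z : EReal) with hI
  have hyP : (u y : EReal) ≤ P := le_iSup₂ (f := fun z (_ : z ∈ S) => (u z : EReal)) y hy
  have hIy : I ≤ (u y : EReal) := iInf₂_le (f := fun z (_ : z ∈ S) => (u z : EReal)) y hy
  have hosc : osc S u = P - I := rfl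
  have hPbot : P ≠ ⊥ := fun h0 => by rw [h0] at hyP; simp at hyP
  have hItop : I ≠ ⊤ := fun h0 => by rw [h0] at hIy; simp at hIy
  have hPtop : P ≠ ⊤ := by
    intro h0
    rw [hosc, h0, EReal.top_sub hItop] at htop
    exact htop rfl
  have hIbot : I ≠ ⊥ := by
    intro h0
    rw [hosc, h0, sub_eq_add_neg, EReal.neg_bot, EReal.add_top_of_ne_bot hPbot] at htop
    exact htop rfl
  lift P to ℝ using ⟨hPtop, hPbot⟩ with M hM
  lift I to ℝ using ⟨hItop, hIbot⟩ with m hm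
  have hV : ∀ z ∈ S, ∀ w ∈ S, u z - u w ≤ M - m := by
    intro z hz w hw
    have h1 : (u z : EReal) ≤ M := by
      rw [hP]; exact le_iSup₂ (f := fun z (_ : z ∈ S) => (u z : EReal)) z hz
    have h2 : (m : EReal) ≤ u w := by
      rw [hI]; exact iInf₂_le (f := fun z (_ : z ∈ S) => (u z : EReal)) w hw
    have h1' := EReal.coe_le_coe_iff.1 h1
    have h2' := EReal.coe_le_coe_iff.1 h2
    linarith
  have hV0 : 0 ≤ M - m := by simpa using hV y hy y hy
  have hT := h _ hV
  have hoscT : osc T u ≤ (((1 - κ) * (M - m) : ℝ) : EReal) := by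
    unfold osc
    refine EReal.sub_le_of_le_add (iSup₂_le fun z hz => ?_)
    have h1 : ((u z - (1 - κ) * (M - m) : ℝ) : EReal) ≤ ⨅ w ∈ T, (u w : EReal) := by
      refine le_iInf₂ fun w hw => EReal.coe_le_coe_iff.2 ?_
      linarith [hT z hz w hw]
    have h2 : (u z : EReal) = (((1 - κ) * (M - m) : ℝ) : EReal) +
        ((u z - (1 - κ) * (M - m) : ℝ) : EReal) := by
      rw [← EReal.coe_add]; congr 1; ring
    rw [h2]
    exact add_le_add le_rfl h1
  have h1κ : (0 : EReal) ≤ ((1 + κ : ℝ) : EReal) := EReal.coe_nonneg.2 (by linarith)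
  calc ((1 + κ : ℝ) : EReal) * osc T u
      ≤ ((1 + κ : ℝ) : EReal) * (((1 - κ) * (M - m) : ℝ) : EReal) :=
        mul_le_mul_of_nonneg_left hoscT h1κ
    _ = (((1 + κ) * ((1 - κ) * (M - m)) : ℝ) : EReal) := (EReal.coe_mul _ _).symm
    _ ≤ ((M - m : ℝ) : EReal) := EReal.coe_le_coe_iff.2 (by nlinarith [sq_nonneg κ])
    _ = osc S u := by rw [hosc, EReal.coe_sub]

theorem cylOne_nonempty [Nonempty (Idx p)] {B : Matrix (Idx p) (Idx p) ℝ} {b K r : ℝ}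
    (hb : 0 < b) (hK : 0 < K) (hr : 0 < r) (z₀ : Pt p) : (cylOne B b K r z₀).Nonempty :=
  ⟨chart B z₀ r (0, -(b / 2)), chart_mem_cylOne hr (by simpa [spaceNorm_zero] using hK)
    (by simp; linarith) (by simp; linarith)⟩

/-- With `η = 4 κ` the stated factor is `1 + κ`, and `(1 + κ) * (1 - κ) ≤ 1`. -/
theorem OscDecay.osc_le [Nonempty (Idx p)] {B : Matrix (Idx p) (Idx p) ℝ} {b K θ κ : ℝ}
    {u : Pt p → ℝ} {z₀ : Pt p} {r : ℝ} (h : OscDecay B b K θ (1 - κ) u z₀ r) (hκ : 0 ≤ κ)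
    (hb : 0 < b) (hK : 0 < K) (hr : 0 < r) :
    ((1 + 4 * κ / 4 : ℝ) : EReal) * osc (cylOne B b K (r / θ) z₀) u ≤
      osc (cylOne B b K r z₀) u := by
  rw [mul_div_cancel_left₀ κ (by norm_num : (4 : ℝ) ≠ 0)]
  exact osc_le_of_forall hκ (cylOne_nonempty hb hK hr z₀) h

/-! ### From the decay of the oscillation to the Hölder estimate -/

/-- The points where a continuous function exceeds its essential supremum form an open null set,
which must be empty. -/
theorem abs_le_of_eLpNorm_top {X : Type*} [TopologicalSpace X] [MeasurableSpace X] [BorelSpace X]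
    {ν : Measure X} [ν.IsOpenPosMeasure] {D : Set X} (hD : IsOpen D) {u : X → ℝ}
    (hu : ContinuousOn u D) (hfin : eLpNorm u ∞ (ν.restrict D) ≠ ∞) {x : X} (hx : x ∈ D) :
    |u x| ≤ (eLpNorm u ∞ (ν.restrict D)).toReal := by
  by_contra! hlt
  set M := (eLpNorm u ∞ (ν.restrict D)).toReal with hM
  have hopen : IsOpen (D ∩ {y | M < |u y|}) := hu.abs.isOpen_inter_preimage hD isOpen_Ioi
  have hpos := hopen.measure_pos ν ⟨x, hx, hlt⟩
  have hae : ∀ᵐ y ∂(ν.restrict D), ‖u y‖ₑ ≤ eLpNormEssSup u (ν.restrict D) :=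
    ae_le_eLpNormEssSup
  rw [ae_restrict_iff' hD.measurableSet] at hae
  refine hpos.ne' (measure_mono_null ?_ (ae_iff.1 hae))
  rintro y ⟨hy1, hy2⟩ hy3
  have h1 := hy3 hy1
  rw [← eLpNorm_exponent_top, ← ofReal_norm, ← ENNReal.ofReal_toReal hfin,
    ENNReal.ofReal_le_ofReal_iff ENNReal.toReal_nonneg] at h1
  exact absurd h1 (not_le.2 hy2)

theorem cylOne_mono {B : Matrix (Idx p) (Idx p) ℝ} {b K r r' : ℝ} (hb : 0 ≤ b) (hK : 0 ≤ K)
    (hr : 0 ≤ r) (h : r ≤ r') (z₀ : Pt p) : cylOne B b K r z₀ ⊆ cylOne B b K r' z₀ := by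
  refine image_mono (prod_mono (fun x hx => ?_) (Ioo_subset_Ioo_left ?_))
  · exact lt_of_lt_of_le hx (mul_le_mul_of_nonneg_left h hK)
  · have : r ^ 2 ≤ r' ^ 2 := pow_le_pow_left₀ hr h 2
    exact neg_le_neg (mul_le_mul_of_nonneg_left this hb)

theorem tendsto_gmul_time (B : Matrix (Idx p) (Idx p) ℝ) (ζ : Pt p) (y : Space p) (T : ℝ) :
    Tendsto (fun δ : ℝ => gmul B ζ (y, T - δ)) (𝓝[>] 0) (𝓝 (gmul B ζ (y, T))) := by
  have hc : Continuous fun δ : ℝ => gmul B ζ (y, T - δ) := by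
    unfold gmul
    refine Continuous.prodMk (continuous_const.add ?_) (by fun_prop)
    exact ((contDiff_flow B (m := 0)).continuous.comp (by fun_prop)).clm_apply continuous_const
  have := hc.tendsto 0
  rw [sub_zero] at this
  exact this.mono_left nhdsWithin_le_nhds

theorem eventually_gmul_mem_cylOne {B : Matrix (Idx p) (Idx p) ℝ} {b K r : ℝ} {ζ : Pt p}
    {y : Space p} {T : ℝ} (hy : spaceNorm y < K * r) (hT : T ≤ 0) (hT' : -(b * r ^ 2) < T) :
    ∀ᶠ δ : ℝ in 𝓝[>] 0, gmul B ζ (y, T - δ) ∈ cylOne B b K r ζ := by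
  have h1 : ∀ᶠ δ : ℝ in 𝓝[>] 0, δ < T + b * r ^ 2 :=
    nhdsWithin_le_nhds (gt_mem_nhds (by linarith))
  filter_upwards [h1, self_mem_nhdsWithin] with δ hδ hδ0
  have hδ0' : 0 < δ := hδ0
  refine mem_image_of_mem _ (mk_mem_prod hy ?_)
  constructor <;> linarith

theorem mem_closure_cylOne {B : Matrix (Idx p) (Idx p) ℝ} {b K r : ℝ} (hb : 0 < b) (hK : 0 < K)
    (hr : 0 < r) (ζ : Pt p) : ζ ∈ closure (cylOne B b K r ζ) := by
  have h1 := tendsto_gmul_time B ζ 0 0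
  rw [gmul_zero] at h1
  refine mem_closure_of_tendsto h1 (eventually_gmul_mem_cylOne ?_ le_rfl ?_)
  · rw [spaceNorm_zero]; positivity
  · have : 0 < b * r ^ 2 := by positivity
    linarith

/-- A bound for the oscillation in `𝒬¹_r(ζ)` extends to the points of its top. -/
theorem abs_sub_le_of_osc_le {B : Matrix (Idx p) (Idx p) ℝ} {b K r V : ℝ} {u : Pt p → ℝ}
    (hb : 0 < b) (hK : 0 < K) (hr : 0 < r) {ζ z : Pt p} (hcz : ContinuousAt u z)
    (hcζ : ContinuousAt u ζ)
    (hV : ∀ v ∈ cylOne B b K r ζ, ∀ w ∈ cylOne B b K r ζ, u v - u w ≤ V)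
    (h1 : spaceNorm (z.1 - flow B (z.2 - ζ.2) ζ.1) < K * r) (h2 : z.2 ≤ ζ.2)
    (h3 : -(b * r ^ 2) < z.2 - ζ.2) : |u z - u ζ| ≤ V := by
  have t1 := tendsto_gmul_time B ζ (z.1 - flow B (z.2 - ζ.2) ζ.1) (z.2 - ζ.2)
  have e1 : gmul B ζ (z.1 - flow B (z.2 - ζ.2) ζ.1, z.2 - ζ.2) = z := by
    rw [← gmul_ginv, gmul_ginv_gmul]
  rw [e1] at t1
  have t2 := tendsto_gmul_time B ζ 0 0
  rw [gmul_zero] at t2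
  have m1 := eventually_gmul_mem_cylOne (B := B) (ζ := ζ) h1 (sub_nonpos.2 h2) h3
  have m2 := eventually_gmul_mem_cylOne (B := B) (ζ := ζ) (b := b) (K := K) (r := r) (y := 0)
    (T := 0) (by rw [spaceNorm_zero]; positivity) le_rfl
    (by have : 0 < b * r ^ 2 := by positivity
        linarith)
  have lim := ((hcz.tendsto.comp t1).sub (hcζ.tendsto.comp t2)).abs
  refine le_of_tendsto lim ?_
  filter_upwards [m1, m2] with δ hδ1 hδ2
  rw [abs_le]
  have a1 := hV _ hδ1 _ hδ2
  have a2 := hV _ hδ2 _ hδ1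
  simp only [Function.comp_apply]
  constructor <;> linarith

theorem OscDecay.iterate {B : Matrix (Idx p) (Idx p) ℝ} {b K θ q V R : ℝ} {u : Pt p → ℝ}
    {z₀ : Pt p} (hθ : 1 < θ) (hR : 0 < R)
    (hdecay : ∀ r, 0 < r → r ≤ R → OscDecay B b K θ q u z₀ r)
    (hV : ∀ v ∈ cylOne B b K R z₀, ∀ w ∈ cylOne B b K R z₀, u v - u w ≤ V) (k : ℕ) :
    ∀ v ∈ cylOne B b K (R / θ ^ k) z₀, ∀ w ∈ cylOne B b K (R / θ ^ k) z₀,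
      u v - u w ≤ q ^ k * V := by
  induction k with
  | zero => simpa using hV
  | succ k ih =>
    have h0 : 0 < θ := by linarith
    have h1 : 0 < R / θ ^ k := by positivity
    have h2 : R / θ ^ k ≤ R := div_le_self hR.le (one_le_pow₀ hθ.le)
    have h3 := hdecay _ h1 h2 _ ih
    rw [pow_succ, ← div_div, pow_succ', mul_assoc]
    exact h3

/-- Geometric decay of the oscillation at all small scales implies a Hölder estimate. -/
theorem exists_holderEstimate {B : Matrix (Idx p) (Idx p) ℝ} (hB : IsDriftMatrix p B)
    {b K θ κ : ℝ} (hb : 0 < b) (hK : 1 ≤ K) (hθ : 1 < θ) (hκ : 0 < κ) (hκ1 : κ < 1) :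
    ∃ α : ℝ, 0 < α ∧ ∀ r₀ : ℝ, 0 < r₀ → ∀ ρ : ℝ, 0 < ρ → ∃ C : ℝ, 0 < C ∧
      ∀ (D : Set (Pt p)) (u : Pt p → ℝ), IsOpen D → ContinuousOn u D →
        (∀ (z₀ : Pt p) (r : ℝ), 0 < r → r ≤ r₀ → cylOne B b K r z₀ ⊆ D →
          OscDecay B b K θ (1 - κ) u z₀ r) →
        HolderEstimate B b K ρ C α D u := by
  have hθ0 : 0 < θ := by linarith
  have hK0 : 0 < K := by linarith
  set q := 1 - κ with hq
  have hq0 : 0 < q := by linarith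
  set α := -Real.log q / Real.log θ with hα
  have hlogθ : 0 < Real.log θ := Real.log_pos hθ
  have hlogq : Real.log q < 0 := Real.log_neg hq0 (by linarith)
  have hα0 : 0 < α := div_pos (by linarith) hlogθ
  have hqθ : q = (θ⁻¹) ^ α := by
    rw [Real.rpow_def_of_pos (by positivity), Real.log_inv, hα]
    have : -Real.log θ * (-Real.log q / Real.log θ) = Real.log q := by field_simp
    rw [this, Real.exp_log hq0]
  obtain ⟨Cq, hCq1, hCq⟩ := exists_spaceNorm_flow_le hB
  refine ⟨α, hα0, fun r₀ hr₀ ρ hρ => ?_⟩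
  set R := min ρ r₀ with hR
  have hR0 : 0 < R := lt_min hρ hr₀
  have hsb : 0 < √b := Real.sqrt_pos.2 hb
  -- If `c * d ≤ r`, the cylinder of radius `r` is large enough for the displacement and its
  -- inverse: `Cq` takes care of space, `1 / √b` of time.
  set c := Cq + 1 / √b with hc
  have hc0 : 0 < c := by positivity
  refine ⟨2 * (θ * c / R) ^ α, by positivity, ?_⟩
  intro D u hD hu hdecay z ζ hz hζ
  have hzD : z ∈ D := hz.2 (mem_closure_cylOne hb hK0 hρ z)
  have hζD : ζ ∈ D := hζ.2 (mem_closure_cylOne hb hK0 hρ ζ)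
  have hcz : ContinuousAt u z := hu.continuousAt (hD.mem_nhds hzD)
  have hcζ : ContinuousAt u ζ := hu.continuousAt (hD.mem_nhds hζD)
  rw [gmul_ginv]
  set T := z.2 - ζ.2 with hT
  set y := z.1 - flow B T ζ.1 with hy
  set d := homNorm ((y, T) : Pt p) with hd
  have hdsum : d = spaceNorm y + √|T| := by rw [hd, homNorm, Real.sqrt_eq_rpow]
  have hd0 : 0 ≤ d := homNorm_nonneg _
  have hyd : spaceNorm y ≤ d := by linarith [Real.sqrt_nonneg |T|]
  have hTd : |T| ≤ d ^ 2 := by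
    rw [← Real.sq_sqrt (abs_nonneg T)]
    exact pow_le_pow_left₀ (Real.sqrt_nonneg _) (by linarith [spaceNorm_nonneg y]) 2
  rcases hd0.eq_or_lt with hdz | hdpos
  · have h1 : spaceNorm y = 0 := le_antisymm (by linarith) (spaceNorm_nonneg y)
    have h2 : T = 0 := by
      rw [← hdz] at hTd
      simpa using hTd
    have h3 : y = 0 := eq_zero_of_spaceNorm h1
    rw [hy, h2, flow_zero_apply, sub_eq_zero] at h3
    have h4 : z = ζ := Prod.ext h3 (sub_eq_zero.1 h2)
    rw [h4]; simp
  by_cases hfin : eLpNorm u ∞ (volume.restrict D) = ∞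
  · rw [hfin, ENNReal.mul_top]
    · exact le_top
    · exact (ENNReal.ofReal_pos.2 (by positivity)).ne'
  rw [← ENNReal.ofReal_toReal hfin, ← ENNReal.ofReal_mul (by positivity)]
  refine ENNReal.ofReal_le_ofReal ?_
  set M := (eLpNorm u ∞ (volume.restrict D)).toReal with hM
  have hM0 : 0 ≤ M := ENNReal.toReal_nonneg
  have hbound : ∀ x ∈ D, |u x| ≤ M := fun x hx => abs_le_of_eLpNorm_top hD hu hfin hx
  have hdiff : ∀ v ∈ D, ∀ w ∈ D, u v - u w ≤ 2 * M := by
    intro v hv w hw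
    have h1 := abs_le.1 (hbound v hv)
    have h2 := abs_le.1 (hbound w hw)
    linarith [h1.2, h2.1]
  have hscale : (θ * c / R) ^ α * d ^ α = (θ * (c * d / R)) ^ α := by
    rw [← Real.mul_rpow (by positivity) hd0]
    congr 1; ring
  rcases le_or_gt (c * d) R with hsmall | hlarge
  -- The last `k` for which the radius `R / θ ^ k` is at least `c * d`; being last, it loses only
  -- one factor `θ` in the final bound.
  · obtain ⟨k, hk1, hk2⟩ := exists_nat_pow_near (x := R / (c * d)) (y := θ)
      ((one_le_div (by positivity)).2 hsmall) hθ
    set r := R / θ ^ k with hr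
    have hr0 : 0 < r := by positivity
    have hcd : c * d ≤ r := by
      rw [hr, le_div_iff₀ (by positivity)]
      rw [le_div_iff₀ (by positivity)] at hk1
      linarith
    have hosc : ∀ x : Pt p, CompactlyIn (cylOne B b K ρ x) D → ∀ v ∈ cylOne B b K r x,
        ∀ w ∈ cylOne B b K r x, u v - u w ≤ q ^ k * (2 * M) := by
      intro x hx
      have hsub : ∀ r', 0 < r' → r' ≤ R → cylOne B b K r' x ⊆ D := fun r' h0 h1 =>
        (cylOne_mono hb.le hK0.le h0.le (h1.trans (min_le_left _ _)) x).trans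
          (subset_closure.trans hx.2)
      exact OscDecay.iterate hθ hR0
        (fun r' h0 h1 => hdecay x r' h0 (h1.trans (min_le_right _ _)) (hsub r' h0 h1))
        (fun v hv w hw => hdiff v (hsub R hR0 le_rfl hv) w (hsub R hR0 le_rfl hw)) k
    have hspace : ∀ y' : Space p, spaceNorm y' ≤ Cq * d → spaceNorm y' < K * r := by
      intro y' hy'
      have h1 : Cq * d < c * d := mul_lt_mul_of_pos_right (by rw [hc]; linarith [one_div_pos.2 hsb])
        hdpos
      have h2 : r ≤ K * r := le_mul_of_one_le_left hr0.le hK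
      linarith
    have htime : |T| < b * r ^ 2 := by
      have h1 : d / √b < r := by
        have : d / √b < c * d := by
          rw [hc, add_mul, one_div_mul_eq_div]
          have : 0 < Cq * d := by positivity
          linarith
        linarith
      have h2 : d < √b * r := by
        rw [div_lt_iff₀ hsb] at h1
        linarith
      have h3 : d ^ 2 < (√b * r) ^ 2 := pow_lt_pow_left₀ h2 hd0 two_ne_zero
      rw [mul_pow, Real.sq_sqrt hb.le] at h3
      linarith
    have hmain : |u z - u ζ| ≤ q ^ k * (2 * M) := by
      -- Cylinders extend only into the past, so the later of the two points has to be the vertex.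
      rcases le_or_gt z.2 ζ.2 with hle | hlt
      · refine abs_sub_le_of_osc_le hb hK0 hr0 hcz hcζ (hosc ζ hζ) (hspace _ ?_) hle ?_
        · exact hyd.trans (le_mul_of_one_le_left hd0 hCq1)
        · have := neg_abs_le T
          linarith
      · rw [abs_sub_comm]
        refine abs_sub_le_of_osc_le hb hK0 hr0 hcζ hcz (hosc z hz) (hspace _ ?_) hlt.le ?_
        · have e1 : ζ.1 - flow B (ζ.2 - z.2) z.1 = -flow B (-T) y := by
            have e2 : ζ.2 - z.2 = -T := by rw [hT]; ring
            rw [e2, hy, map_sub, flow_flow, neg_add_cancel, flow_zero_apply]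
            abel
          rw [e1, spaceNorm_neg]
          exact hCq y T
        · have := le_abs_self T
          linarith
    refine hmain.trans ?_
    have hpow : q ^ k ≤ (θ * (c * d / R)) ^ α := by
      have e1 : q ^ k = ((θ⁻¹) ^ k) ^ α := by
        rw [hqθ, ← Real.rpow_natCast, ← Real.rpow_natCast, ← Real.rpow_mul (by positivity),
          ← Real.rpow_mul (by positivity), mul_comm]
      rw [e1]
      refine Real.rpow_le_rpow (by positivity) ?_ hα0.le
      rw [div_lt_iff₀ (by positivity)] at hk2
      rw [inv_pow, inv_le_iff_one_le_mul₀ (by positivity), mul_div_assoc', div_mul_eq_mul_div,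
        le_div_iff₀ hR0, one_mul]
      calc R ≤ θ ^ (k + 1) * (c * d) := hk2.le
        _ = θ * (c * d) * θ ^ k := by ring
    calc q ^ k * (2 * M) ≤ (θ * (c * d / R)) ^ α * (2 * M) := by gcongr
      _ = 2 * (θ * c / R) ^ α * d ^ α * M := by rw [← hscale]; ring
  -- For distant points the trivial bound `2 * M` suffices, since the homogeneous factor is at least
  -- 1.
  · have h1 : |u z - u ζ| ≤ 2 * M := by
      rw [abs_le]
      have := hdiff z hzD ζ hζD
      have := hdiff ζ hζD z hzD
      constructor <;> linarith
    have h2 : 1 ≤ (θ * (c * d / R)) ^ α := by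
      refine Real.one_le_rpow ?_ hα0.le
      have : 1 ≤ c * d / R := (one_le_div hR0).2 hlarge.le
      nlinarith
    calc |u z - u ζ| ≤ 1 * (2 * M) := by linarith
      _ ≤ (θ * (c * d / R)) ^ α * (2 * M) := by gcongr
      _ = 2 * (θ * c / R) ^ α * d ^ α * M := by rw [← hscale]; ring

/-! ### Comparison of the coefficients with model matrices -/

theorem dotProduct_mulVec_eq_topBlock {M : Matrix (Idx p) (Idx p) ℝ}
    (hM : ∀ k l : Idx p, (k.1 ≠ 0 ∨ l.1 ≠ 0) → M k l = 0) (v : Idx p → ℝ) :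
    v ⬝ᵥ M *ᵥ v = (fun a => v ⟨0, a⟩) ⬝ᵥ topBlock p M *ᵥ (fun a => v ⟨0, a⟩) := by
  simp only [dotProduct, Matrix.mulVec, Fintype.sum_sigma]
  rw [Finset.sum_eq_single 0]
  · refine Finset.sum_congr rfl fun a _ => ?_
    rw [Finset.sum_eq_single 0]
    · rfl
    · intro j _ hj
      exact Finset.sum_eq_zero fun c _ => by rw [hM _ _ (Or.inr hj), zero_mul]
    · simp
  · intro i _ hi
    refine Finset.sum_eq_zero fun a _ => ?_
    simp [hM ⟨i, a⟩ _ (Or.inl hi)]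
  · simp

theorem isPinched_of_forall {A a : Matrix (Idx p) (Idx p) ℝ} {μ : ℝ} (hA : A.IsSymm)
    (ha : a.IsSymm) (hoff : ∀ k l : Idx p, (k.1 ≠ 0 ∨ l.1 ≠ 0) → a k l = 0)
    (h1 : ∀ v : Idx p → ℝ, v ⬝ᵥ A *ᵥ v ≤ v ⬝ᵥ a *ᵥ v)
    (h2 : ∀ v : Idx p → ℝ, v ⬝ᵥ a *ᵥ v ≤ μ * (v ⬝ᵥ A *ᵥ v)) : IsPinched A μ a := by
  refine ⟨hoff, .of_dotProduct_mulVec_nonneg ?_ fun v => ?_,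
    .of_dotProduct_mulVec_nonneg ?_ fun v => ?_⟩
  · rw [Matrix.IsHermitian, Matrix.conjTranspose_eq_transpose_of_trivial]
    exact ha.sub hA
  · rw [star_trivial, Matrix.sub_mulVec, dotProduct_sub]
    linarith [h1 v]
  · rw [Matrix.IsHermitian, Matrix.conjTranspose_eq_transpose_of_trivial]
    exact (hA.smul μ).sub ha
  · rw [star_trivial, Matrix.sub_mulVec, dotProduct_sub, Matrix.smul_mulVec, dotProduct_smul,
      smul_eq_mul]
    linarith [h2 v]

theorem IsElliptic.isModelMatrix {lam Lam : ℝ} {Ω : Set (Pt p)}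
    {A : Pt p → Matrix (Idx p) (Idx p) ℝ} (hA : IsElliptic p lam Lam Ω A) {z : Pt p} (hz : z ∈ Ω) :
    IsModelMatrix p lam Lam (A z) := by
  refine ⟨hA.symm z hz, hA.off_block z hz, fun v => ?_, fun v => ?_⟩
  · have := (hA.lower z hz).dotProduct_mulVec_nonneg (fun a => v ⟨0, a⟩)
    rw [star_trivial, Matrix.sub_mulVec, dotProduct_sub, Matrix.smul_mulVec, Matrix.one_mulVec,
      dotProduct_smul, smul_eq_mul, ← dotProduct_mulVec_eq_topBlock (hA.off_block z hz)] at this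
    simp only [dotProduct, ← sq] at this ⊢
    linarith
  · have := (hA.upper z hz).dotProduct_mulVec_nonneg (fun a => v ⟨0, a⟩)
    rw [star_trivial, Matrix.sub_mulVec, dotProduct_sub, Matrix.smul_mulVec, Matrix.one_mulVec,
      dotProduct_smul, smul_eq_mul, ← dotProduct_mulVec_eq_topBlock (hA.off_block z hz)] at this
    simp only [dotProduct, ← sq] at this ⊢
    linarith

/-- The matrix `lam 𝕀` in the upper left block. -/
def topIdentity (p : Fin (n + 1) → ℕ) (lam : ℝ) : Matrix (Idx p) (Idx p) ℝ :=
  Matrix.diagonal fun k => if k.1 = 0 then lam else 0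

theorem topIdentity_apply_eq_zero (lam : ℝ) (k l : Idx p) (h : k.1 ≠ 0 ∨ l.1 ≠ 0) :
    topIdentity p lam k l = 0 := by
  rw [topIdentity, Matrix.diagonal_apply]
  split_ifs with h1 h2
  · subst h1
    simp_all
  all_goals rfl

theorem dotProduct_topIdentity_mulVec (lam : ℝ) (v : Idx p → ℝ) :
    v ⬝ᵥ topIdentity p lam *ᵥ v = lam * ∑ a, v ⟨0, a⟩ ^ 2 := by
  have h : topBlock p (topIdentity p lam) = lam • 1 := by
    ext a c
    simp [topBlock, topIdentity, Matrix.diagonal_apply, Matrix.one_apply]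
  rw [dotProduct_mulVec_eq_topBlock (topIdentity_apply_eq_zero lam), h, Matrix.smul_mulVec,
    Matrix.one_mulVec, dotProduct_smul, smul_eq_mul]
  simp only [dotProduct, ← sq]

theorem isModelMatrix_topIdentity (lam : ℝ) : IsModelMatrix p lam lam (topIdentity p lam) :=
  ⟨Matrix.isSymm_diagonal _, topIdentity_apply_eq_zero lam,
    fun v => (dotProduct_topIdentity_mulVec lam v).ge,
    fun v => (dotProduct_topIdentity_mulVec lam v).le⟩

theorem IsElliptic.isPinched_topIdentity {lam Lam : ℝ} (hlam : 0 < lam) {Ω : Set (Pt p)}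
    {A : Pt p → Matrix (Idx p) (Idx p) ℝ} (hA : IsElliptic p lam Lam Ω A) {z : Pt p} (hz : z ∈ Ω) :
    IsPinched (topIdentity p lam) (Lam / lam) (A z) := by
  have h := hA.isModelMatrix hz
  refine isPinched_of_forall (Matrix.isSymm_diagonal _) h.symm h.off_block (fun v => ?_) fun v => ?_
  · rw [dotProduct_topIdentity_mulVec]
    exact h.lower v
  · rw [dotProduct_topIdentity_mulVec, ← mul_assoc, div_mul_cancel₀ _ hlam.ne']
    exact h.upper v

theorem abs_dotProduct_mulVec_le {ι : Type*} [Fintype ι] [DecidableEq ι] (M : Matrix ι ι ℝ)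
    (v : ι → ℝ) :
    |v ⬝ᵥ M *ᵥ v| ≤ ‖Matrix.toEuclideanCLM (n := ι) (𝕜 := ℝ) M‖ * ∑ a, v a ^ 2 := by
  set x : EuclideanSpace ℝ ι := WithLp.toLp 2 v
  have h1 : v ⬝ᵥ M *ᵥ v = inner ℝ x (Matrix.toEuclideanCLM (n := ι) (𝕜 := ℝ) M x) := by
    rw [Matrix.toEuclideanCLM_toLp, EuclideanSpace.inner_toLp_toLp, star_trivial, dotProduct_comm]
  have h2 : ∑ a, v a ^ 2 = ‖x‖ ^ 2 := (EuclideanSpace.real_norm_sq_eq x).symm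
  rw [h1, h2]
  calc _ ≤ ‖x‖ * ‖Matrix.toEuclideanCLM (n := ι) (𝕜 := ℝ) M x‖ := abs_real_inner_le_norm _ _
    _ ≤ ‖x‖ * (‖Matrix.toEuclideanCLM (n := ι) (𝕜 := ℝ) M‖ * ‖x‖) := by
        gcongr
        exact ContinuousLinearMap.le_opNorm _ _
    _ = _ := by ring

/-- Coefficients close to a frozen elliptic matrix `M` are pinched by a multiple of `M`. -/
theorem isPinched_of_norm_sub_le {lam Lam δ : ℝ} (hδ : δ < 1) {M a : Matrix (Idx p) (Idx p) ℝ}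
    (hM : IsModelMatrix p lam Lam M) (ha : a.IsSymm)
    (hoff : ∀ k l : Idx p, (k.1 ≠ 0 ∨ l.1 ≠ 0) → a k l = 0) (hδ0 : 0 ≤ δ)
    (h : ‖Matrix.toEuclideanCLM (n := Fin (p 0)) (𝕜 := ℝ) (topBlock p a - topBlock p M)‖
      ≤ δ * lam) :
    IsPinched ((1 - δ) • M) ((1 + δ) / (1 - δ)) a := by
  have key (v : Idx p → ℝ) : |v ⬝ᵥ a *ᵥ v - v ⬝ᵥ M *ᵥ v| ≤ δ * (v ⬝ᵥ M *ᵥ v) := by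
    have h1 := abs_dotProduct_mulVec_le (topBlock p a - topBlock p M) (fun c => v ⟨0, c⟩)
    rw [Matrix.sub_mulVec, dotProduct_sub, ← dotProduct_mulVec_eq_topBlock hoff,
      ← dotProduct_mulVec_eq_topBlock hM.off_block] at h1
    refine h1.trans ((mul_le_mul_of_nonneg_right h
      (Finset.sum_nonneg fun _ _ => sq_nonneg _)).trans ?_)
    rw [mul_assoc]
    exact mul_le_mul_of_nonneg_left (hM.lower v) hδ0
  have hs : (1 - δ) ≠ 0 := by linarith
  refine isPinched_of_forall (hM.symm.smul _) ha hoff (fun v => ?_) fun v => ?_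
  · rw [Matrix.smul_mulVec, dotProduct_smul, smul_eq_mul]
    linarith [(abs_le.1 (key v)).1]
  · rw [Matrix.smul_mulVec, dotProduct_smul, smul_eq_mul, ← mul_assoc, div_mul_cancel₀ _ hs]
    linarith [(abs_le.1 (key v)).2]

theorem IsModelMatrix.smul_one_sub {lam Lam δ : ℝ} (hlam : 0 ≤ lam) (hδ : 0 ≤ δ) (hδ1 : δ ≤ 1 / 2)
    {M : Matrix (Idx p) (Idx p) ℝ} (hM : IsModelMatrix p lam Lam M) :
    IsModelMatrix p (lam / 2) Lam ((1 - δ) • M) := by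
  refine ⟨hM.symm.smul _, fun k l hkl => ?_, fun v => ?_, fun v => ?_⟩
  · rw [Matrix.smul_apply, hM.off_block k l hkl, smul_zero]
  all_goals
    have h1 := hM.lower v
    have h2 := hM.upper v
    have h3 : 0 ≤ lam * ∑ a, v ⟨0, a⟩ ^ 2 :=
      mul_nonneg hlam (Finset.sum_nonneg fun _ _ => sq_nonneg _)
    rw [Matrix.smul_mulVec, dotProduct_smul, smul_eq_mul]
    nlinarith

/-! ### Small cylinders are contained in the cylinders of the modulus of continuity -/

/-- The centre of the cylinder `𝒬¹_r(z₀)`. -/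
def cylCentre (B : Matrix (Idx p) (Idx p) ℝ) (b r : ℝ) (z₀ : Pt p) : Pt p :=
  gmul B z₀ (0, -(b * r ^ 2 / 2))

theorem cylCentre_mem {B : Matrix (Idx p) (Idx p) ℝ} {b K r : ℝ} (hb : 0 < b) (hK : 0 < K)
    (hr : 0 < r) (z₀ : Pt p) : cylCentre B b r z₀ ∈ cylOne B b K r z₀ := by
  have h : 0 < b * r ^ 2 := by positivity
  refine mem_image_of_mem _ (mk_mem_prod ?_ ?_)
  · change spaceNorm 0 < K * r
    rw [spaceNorm_zero]
    positivity
  · constructor <;> linarith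

/-- The vertex `z₀` may lie outside `Ω`, whereas the modulus compares values at points of `Ω`; hence
the coefficients are frozen at the centre. The centre is `z₀` moved along the flow, so spatial
displacements are the same as from `z₀`. -/
theorem cylOne_subset_cyl_cylCentre {B : Matrix (Idx p) (Idx p) ℝ} {b K r ε : ℝ} (hb : 0 < b)
    (hb1 : b ≤ 1) (hK : 1 ≤ K) (hr : 0 < r) (h : K * r ≤ ε) (z₀ : Pt p) :
    cylOne B b K r z₀ ⊆ cyl B ε (-ε ^ 2) (ε ^ 2) (cylCentre B b r z₀) := by
  rintro _ ⟨w, ⟨hw1, hw2, hw3⟩, rfl⟩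
  have hrε : r ≤ ε := (le_mul_of_one_le_left hr.le hK).trans h
  have h1 : b * r ^ 2 ≤ ε ^ 2 := by nlinarith
  have h2 : 0 < b * r ^ 2 := by positivity
  rw [mem_cyl, gmul_ginv]
  simp only [cylCentre, gmul, flow_flow, zero_add]
  refine ⟨?_, ?_, ?_⟩
  · have e : z₀.2 + w.2 - (z₀.2 + -(b * r ^ 2 / 2)) + -(b * r ^ 2 / 2) = w.2 := by ring
    rw [e, add_sub_cancel_right]
    exact lt_of_lt_of_le hw1 h
  · linarith
  · linarith

theorem HasModulus.isPinched {B : Matrix (Idx p) (Idx p) ℝ} {ω : ℝ → ℝ} {Ω : Set (Pt p)}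
    {A : Pt p → Matrix (Idx p) (Idx p) ℝ} {lam Lam δ b K r ε : ℝ} (hω : HasModulus B ω Ω A)
    (hA : IsElliptic p lam Lam Ω A) (hδ0 : 0 ≤ δ) (hδ : δ < 1) (hε0 : 0 < ε) (hε1 : ε < 1)
    (hε : ω ε ≤ δ * lam) (hb : 0 < b) (hb1 : b ≤ 1) (hK : 1 ≤ K) (hr : 0 < r) (h : K * r ≤ ε)
    {z₀ : Pt p} (hΩ : cylOne B b K r z₀ ⊆ Ω) {z : Pt p} (hz : z ∈ cylOne B b K r z₀) :
    IsPinched ((1 - δ) • A (cylCentre B b r z₀)) ((1 + δ) / (1 - δ)) (A z) := by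
  have hc := hΩ (cylCentre_mem (B := B) hb (by linarith) hr z₀)
  exact isPinched_of_norm_sub_le hδ (hA.isModelMatrix hc) (hA.symm z (hΩ hz))
    (hA.off_block z (hΩ hz)) hδ0 ((hω ε hε0 hε1 _ hc z
      ⟨hΩ hz, cylOne_subset_cyl_cylCentre hb hb1 hK hr h z₀ hz⟩).trans hε)

theorem IsModulus.exists_le {ω : ℝ → ℝ} (hω : IsModulus ω) {c : ℝ} (hc : 0 < c) :
    ∃ ε : ℝ, 0 < ε ∧ ε < 1 ∧ ω ε ≤ c := by
  have h1 : ∀ᶠ ε in 𝓝[>] (0 : ℝ), ω ε < c := hω.tendsto (gt_mem_nhds hc)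
  have h2 : ∀ᶠ ε in 𝓝[>] (0 : ℝ), ε < 1 := nhdsWithin_le_nhds (gt_mem_nhds one_pos)
  obtain ⟨ε, h3, h4, h5⟩ := (h1.and (h2.and self_mem_nhdsWithin)).exists
  exact ⟨ε, h5, h4, h3.le⟩

end Kolmogorov

end

/-! ### The two cases of the theorem -/

theorem corollary5p3 {n : ℕ} (hn : 1 ≤ n) (p : Fin (n + 1) → ℕ) (hp : Antitone p)
    (hpn : 1 ≤ p (Fin.last n))
    (B : Matrix (Idx p) (Idx p) ℝ) (hB : IsDriftMatrix p B)
    (lam Lam : ℝ) (hlam : 0 < lam) (hLam : 0 < Lam)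
    (b : ℝ) (hb : IsTimeScale B b) :
    -- the Cordes-Landis case
    (Lam / lam < 1 + 2 / (hdim p : ℝ) →
      ∃ K₀ : ℝ, ∀ K : ℝ, K₀ < K → 1 < K / sigmaMin p ∧
        ∃ η : ℝ, 0 < η ∧
          (∀ (Ω : Set (Pt p)) (A : Pt p → Matrix (Idx p) (Idx p) ℝ), IsOpen Ω →
            IsElliptic p lam Lam Ω A →
            ∀ (D : Set (Pt p)) (u : Pt p → ℝ), IsOpen D → D ⊆ Ω →
            IsClassicalSolution B A D u →
            ∀ (z₀ : Pt p) (r : ℝ), 0 < r → CompactlyIn (cylOne B b K r z₀) D →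
              ((1 + η / 4 : ℝ) : EReal) * osc (cylOne B b K (r / (K / sigmaMin p)) z₀) u
                ≤ osc (cylOne B b K r z₀) u) ∧
          ∃ α : ℝ, 0 < α ∧ ∀ ρ : ℝ, 0 < ρ → ∃ C : ℝ, 0 < C ∧
            ∀ (Ω : Set (Pt p)) (A : Pt p → Matrix (Idx p) (Idx p) ℝ), IsOpen Ω →
              IsElliptic p lam Lam Ω A →
              ∀ (D : Set (Pt p)) (u : Pt p → ℝ), IsOpen D → D ⊆ Ω →
              IsClassicalSolution B A D u → HolderEstimate B b K ρ C α D u) ∧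
    -- the case of uniformly continuous coefficients
    (∃ K₀ : ℝ, ∀ K : ℝ, K₀ < K → 1 < K / sigmaMin p ∧
        ∃ η : ℝ, 0 < η ∧ ∃ α : ℝ, 0 < α ∧
          ∀ ω : ℝ → ℝ, IsModulus ω → ∃ ε₀ : ℝ, 0 < ε₀ ∧ ε₀ < 1 ∧
            (∀ (Ω : Set (Pt p)) (A : Pt p → Matrix (Idx p) (Idx p) ℝ), IsOpen Ω →
              IsElliptic p lam Lam Ω A → HasModulus B ω Ω A →
              ∀ (D : Set (Pt p)) (u : Pt p → ℝ), IsOpen D → D ⊆ Ω →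
              IsClassicalSolution B A D u →
              ∀ (z₀ : Pt p) (r : ℝ), 0 < r → r ≤ ε₀ / K → cylOne B b K r z₀ ⊆ D →
                ((1 + η / 4 : ℝ) : EReal) * osc (cylOne B b K (r / (K / sigmaMin p)) z₀) u
                  ≤ osc (cylOne B b K r z₀) u) ∧
            ∀ ρ : ℝ, 0 < ρ → ∃ C : ℝ, 0 < C ∧
              ∀ (Ω : Set (Pt p)) (A : Pt p → Matrix (Idx p) (Idx p) ℝ), IsOpen Ω →
                IsElliptic p lam Lam Ω A → HasModulus B ω Ω A →
                ∀ (D : Set (Pt p)) (u : Pt p → ℝ), IsOpen D → D ⊆ Ω →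
                IsClassicalSolution B A D u → HolderEstimate B b K ρ C α D u) := by
  have : Nonempty (Idx p) := ⟨⟨Fin.last n, ⟨0, hpn⟩⟩⟩
  have hb0 := hb.pos
  have hb1 := hb.le_one
  refine ⟨fun hμ => ?_, ?_⟩
  -- The model matrix is `lam` times the identity of the upper block: both its ellipticity constants
  -- are `lam`, and the pinching ratio is `Lam / lam`.
  · obtain ⟨K₀, κ, hκ, hκ1, H⟩ := exists_oscDecay hB hlam hlam hμ hb
    refine ⟨K₀, fun K hK => ?_⟩
    obtain ⟨hK1, hθ, H⟩ := H K hK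
    replace H := H _ (isModelMatrix_topIdentity lam)
    refine ⟨hθ, 4 * κ, by positivity, ?_, ?_⟩
    · intro Ω A _ hA D u hD hDΩ hu z₀ r hr hc
      have hsub := subset_closure.trans hc.2
      exact (H A D u hD hu z₀ r hr hsub fun z hz =>
        hA.isPinched_topIdentity hlam (hDΩ (hsub hz))).osc_le hκ.le hb0 (by linarith) hr
    · obtain ⟨α, hα, G⟩ := exists_holderEstimate hB hb0 hK1 hθ hκ hκ1
      refine ⟨α, hα, fun ρ hρ => ?_⟩
      -- The oscillation decays at all scales in this case, so the threshold `1` is arbitrary.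
      obtain ⟨C, hC, G⟩ := G 1 one_pos ρ hρ
      refine ⟨C, hC, fun Ω A _ hA D u hD hDΩ hu => G D u hD hu.1.continuousOn ?_⟩
      exact fun z₀ r hr _ hsub => H A D u hD hu z₀ r hr hsub fun z hz =>
        hA.isPinched_topIdentity hlam (hDΩ (hsub hz))
  · have hQ : (1 : ℝ) ≤ hdim p := by exact_mod_cast hdim_pos (p := p)
    -- With this `δ` one has `2 / Q = 8 * δ`, and `(1 + δ) / (1 - δ) < 1 + 8 * δ` because `0 < δ < 3
    -- / 4`.
    set δ : ℝ := 1 / (4 * hdim p) with hδ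
    have hδ0 : 0 < δ := by positivity
    have hδQ : δ * hdim p = 1 / 4 := by rw [hδ]; field_simp
    have hδ1 : δ ≤ 1 / 4 := by nlinarith
    have hμ : (1 + δ) / (1 - δ) < 1 + 2 / (hdim p : ℝ) := by
      have : 2 / (hdim p : ℝ) = 8 * δ := by rw [hδ]; field_simp; norm_num
      rw [this, div_lt_iff₀ (by linarith)]
      nlinarith
    -- The model matrix will be `1 - δ` times a frozen coefficient matrix, with lower constant at
    -- least `lam / 2`. Since `κ` is fixed before `ω` is introduced, `η` and `α` do not depend on
    -- the modulus.
    obtain ⟨K₀, κ, hκ, hκ1, H⟩ := exists_oscDecay hB (half_pos hlam) hLam hμ hb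
    refine ⟨K₀, fun K hK => ?_⟩
    obtain ⟨hK1, hθ, H⟩ := H K hK
    have hK0 : 0 < K := by linarith
    obtain ⟨α, hα, G⟩ := exists_holderEstimate hB hb0 hK1 hθ hκ hκ1
    refine ⟨hθ, 4 * κ, by positivity, α, hα, fun ω hω => ?_⟩
    -- At scale `ε` the coefficients vary by at most `δ * lam`, which is what pinching with ratio
    -- `(1 + δ) / (1 - δ)` requires.
    obtain ⟨ε, hε0, hε1, hε⟩ := hω.exists_le (mul_pos hδ0 hlam)
    have decay (Ω : Set (Pt p)) (A : Pt p → Matrix (Idx p) (Idx p) ℝ)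
        (hA : IsElliptic p lam Lam Ω A) (hAω : HasModulus B ω Ω A) (D : Set (Pt p)) (u : Pt p → ℝ)
        (hD : IsOpen D) (hDΩ : D ⊆ Ω) (hu : IsClassicalSolution B A D u) (z₀ : Pt p) (r : ℝ)
        (hr : 0 < r) (hrε : r ≤ ε / K) (hsub : cylOne B b K r z₀ ⊆ D) :
        OscDecay B b K (K / sigmaMin p) (1 - κ) u z₀ r := by
      have hKr : K * r ≤ ε := by rwa [le_div_iff₀' hK0] at hrε
      have hc := hDΩ (hsub (cylCentre_mem (B := B) hb0 hK0 hr z₀))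
      exact H _ ((hA.isModelMatrix hc).smul_one_sub hlam.le hδ0.le (by linarith)) A D u hD hu z₀ r
        hr hsub fun z hz => hAω.isPinched hA hδ0.le (by linarith) hε0 hε1 hε hb0 hb1 hK1 hr hKr
          (hsub.trans hDΩ) hz
    refine ⟨ε, hε0, hε1, ?_, fun ρ hρ => ?_⟩
    · intro Ω A _ hA hAω D u hD hDΩ hu z₀ r hr hrε hsub
      exact (decay Ω A hA hAω D u hD hDΩ hu z₀ r hr hrε hsub).osc_le hκ.le hb0 hK0 hr
    · obtain ⟨C, hC, G⟩ := G (ε / K) (div_pos hε0 hK0) ρ hρ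
      exact ⟨C, hC, fun Ω A _ hA hAω D u hD hDΩ hu => G D u hD hu.1.continuousOn
        (decay Ω A hA hAω D u hD hDΩ hu)⟩
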